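/- **Setting.** Let $\{t_n\}$ be a nonempty finite or countable family of distinct nonzero real numbers, with $|t_n|\to\infty$ if it is infinite, let $\mu=\sum_n\mu_n\delta_{t_n}$ with $\mu_n>0$, and let $A$ be the operator of multiplication by $x$ in $L^2(\mu)$ with its maximal domain. Let $a,b$ be functions with $a/x,\ b/x\in L^2(\mu)$ and let $\kappa\in\mathbb C\setminus\{0\}$ satisfy $\kappa\neq\int x^{-1}a(x)\overline{b(x)}\,d\mu(x)$ in case $a\in L^2(\mu)$. The singular rank one perturbation $L=L(A,a,b,\kappa)$ is the operator in $L^2(\mu)$ with $$\mathcal D(L)=\{y=y_0+c\,A^{-1}a:\ c\in\mathbb C,\ y_0\in\mathcal D(A),\ \kappa c+\langle y_0,b\rangle=0\},\qquad Ly=Ay_0 ,$$ where $\langle y_0,b\rangle=\int y_0\overline b\,d\mu$. An entire function $E$ is Hermite–Biehler if it has no zeros in $\{\operatorname{Im}z\ge 0\}$ and $|E(z)|>|E^*(z)|$ for $\operatorname{Im}z>0$, where $E^*(z)=\overline{E(\bar z)}$; put $A_E=(E+E^*)/2$. The de Branges space $\mathcal H(E)$ consists of all entire $F$ such that $F/E$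 and $F^*/E$ belong to the Hardy space $H^2$ of the upper half-plane, with inner product $(F,K)_E=\int_{\mathbb R}F\overline K\,|E|^{-2}\,dt$. Call $(E,G)$ an *admissible pair* if $E$ is Hermite–Biehler with $A_E\notin\mathcal H(E)$ and $A_E(0)\ne0$, and $G$ is an entire function with $G(0)\neq 0$ and $$G\notin\mathcal H(E),\qquad \frac{G(z)}{z-z_0}\in\mathcal H(E)\ \text{ whenever } G(z_0)=0,$$ where, if $G$ has no zeros, the second condition is replaced by $G\in\mathcal H(E)+z\mathcal H(E)$ (if $G$ has a zero, this inclusion follows from the second condition). For such a pair let $T=T(E,G)$ be the operator in $\mathcal H(E)$ with $$\mathcal D(T)=\{F\in\mathcal H(E):\ \exists\,c=c(F)\in\mathbb C,\ zF-cG\in\mathcal H(E)\},\qquad TF=zF-cG .$$ **Theorem.** (1) Let $L=L(A,a,b,\kappa)$ be a singular rank one perturbation of $A$ with $b$ cyclic for the resolvent of $A$, i.e. $b(t_n)\ne0$ for all $n$. Then there is an admissible pair $(E,G)$ such that $L$ is unitarily equivalent to $T(E,G)$. (2) Conversely, for every admissible pair $(E,G)$ there are $\mu$, $a$, $b$, $\kappa$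 as above, with $b(t_n)\neq0$ for all $n$, such that $T(E,G)$ is unitarily equivalent to $L(A,a,b,\kappa)$. -/

import Mathlib

open MeasureTheory Filter Topology ComplexConjugate

noncomputable section

/-! ### Unitary equivalence of unbounded operators -/

/-- Two (possibly unbounded) operators `S` in `H` and `T` in `K` are unitarily equivalent if some
unitary map `U : H → K` satisfies `U (D(S)) = D(T)` and `T U = U S` on `D(S)`, i.e. maps the graph
of `S` onto the graph of `T`. -/
def UnitarilyEquivalent {H K : Type*} [NormedAddCommGroup H] [InnerProductSpace ℂ H]
    [NormedAddCommGroup K] [InnerProductSpace ℂ K] (S : H →ₗ.[ℂ] H) (T : K →ₗ.[ℂ] K) : Prop :=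
  ∃ U : H ≃ₗᵢ[ℂ] K, ∀ x y : H, (x, y) ∈ S.graph ↔ (U x, U y) ∈ T.graph

/-! ### Discrete measures, multiplication operators and singular rank one perturbations -/

/-- The data of a discrete measure `μ = ∑ n, mass n • δ (t n)` on the real line: a nonempty family
of pairwise distinct nonzero points, only finitely many of them in each bounded interval
(so the family is at most countable), with positive masses. -/
structure DiscreteMeasure (ι : Type) where
  t : ι → ℝ
  mass : ι → ℝ
  nonempty : Nonempty ι
  injective : Function.Injective t
  ne_zero : ∀ n, t n ≠ 0
  tendsto : Tendsto (fun n => |t n|) cofinite atTop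
  mass_pos : ∀ n, 0 < mass n

/-- The measure `∑ n, mass n • δ (t n)`. -/
def DiscreteMeasure.measure {ι : Type} (d : DiscreteMeasure ι) : Measure ℝ :=
  Measure.sum fun n => ENNReal.ofReal (d.mass n) • Measure.dirac (d.t n)

theorem DiscreteMeasure.ae_ne_zero {ι : Type} (d : DiscreteMeasure ι) :
    ∀ᵐ x ∂d.measure, x ≠ 0 := by
  have hm : MeasurableSet {x : ℝ | x ≠ 0} := (measurableSet_singleton (0 : ℝ)).compl
  rw [DiscreteMeasure.measure, Measure.ae_sum_iff' hm]
  intro n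
  refine Measure.ae_smul_measure ?_ _
  rw [ae_dirac_iff hm]
  exact d.ne_zero n

/-- The operator `A` of multiplication by the independent variable in `L²(μ)`, with its maximal
domain `{f ∈ L²(μ) : x f ∈ L²(μ)}`. -/
def mulOp (μ : Measure ℝ) : Lp ℂ 2 μ →ₗ.[ℂ] Lp ℂ 2 μ where
  domain :=
    { carrier := {f | MemLp (fun x : ℝ => (x : ℂ) * f x) 2 μ}
      zero_mem' := by
        refine (MemLp.zero (ε := ℂ) (p := 2) (μ := μ)).ae_eq ?_
        filter_upwards [Lp.coeFn_zero ℂ 2 μ] with x hx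
        rw [hx]; simp
      add_mem' := by
        intro f g hf hg
        refine (MemLp.add hf hg).ae_eq ?_
        filter_upwards [Lp.coeFn_add f g] with x hx
        rw [hx, Pi.add_apply, Pi.add_apply, mul_add]
      smul_mem' := by
        intro c f hf
        refine (MemLp.const_smul hf c).ae_eq ?_
        filter_upwards [Lp.coeFn_smul c f] with x hx
        simp [hx, mul_left_comm] }
  toFun :=
    { toFun := fun f => MemLp.toLp _ f.2
      map_add' := by
        intro f g
        rw [← MemLp.toLp_add, MemLp.toLp_eq_toLp_iff]
        filter_upwards [Lp.coeFn_add f.1 g.1] with x hx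
        rw [Submodule.coe_add, hx, Pi.add_apply, Pi.add_apply, mul_add]
      map_smul' := by
        intro c f
        rw [RingHom.id_apply, ← MemLp.toLp_const_smul, MemLp.toLp_eq_toLp_iff]
        filter_upwards [Lp.coeFn_smul c f.1] with x hx
        simp [hx, mul_left_comm] }

/-- The data `(a, b, κ)` of a singular rank one perturbation of the multiplication operator `A` in
`L²(μ)`: `a / x` and `b / x` lie in `L²(μ)` (`a` and `b` themselves need not), `κ ≠ 0`, and
`κ ≠ ∫ x⁻¹ a b̄ dμ` in case `a ∈ L²(μ)`. -/
structure SingularPerturbation {ι : Type} (d : DiscreteMeasure ι) where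
  a : ℝ → ℂ
  b : ℝ → ℂ
  κ : ℂ
  memLp_a : MemLp (fun x : ℝ => a x / (x : ℂ)) 2 d.measure
  memLp_b : MemLp (fun x : ℝ => b x / (x : ℂ)) 2 d.measure
  κ_ne_zero : κ ≠ 0
  κ_ne : MemLp a 2 d.measure → κ ≠ ∫ x, (x : ℂ)⁻¹ * a x * conj (b x) ∂d.measure

namespace SingularPerturbation

variable {ι : Type} {d : DiscreteMeasure ι} (P : SingularPerturbation d)

/-- `A⁻¹ a` as an element of `L²(μ)`. -/
def invA : Lp ℂ 2 d.measure := P.memLp_a.toLp _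

/-- The pairing `⟨y, b⟩ = ∫ y b̄ dμ`, used for `y ∈ D(A)`, where the integral converges. -/
def pairing (y : Lp ℂ 2 d.measure) : ℂ := ∫ x, y x * conj (P.b x) ∂d.measure

theorem integrable_pairing {y : Lp ℂ 2 d.measure} (hy : y ∈ (mulOp d.measure).domain) :
    Integrable (fun x => y x * conj (P.b x)) d.measure := by
  have hy' : MemLp (fun x : ℝ => (x : ℂ) * y x) 2 d.measure := hy
  have h := MemLp.integrable_mul hy' P.memLp_b.star
  refine h.congr ?_
  filter_upwards [d.ae_ne_zero] with x hx
  have hx' : (x : ℂ) ≠ 0 := by exact_mod_cast hx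
  simp only [Pi.mul_apply, Pi.star_apply, RCLike.star_def, map_div₀, Complex.conj_ofReal]
  field_simp

theorem pairing_add {y z : Lp ℂ 2 d.measure} (hy : y ∈ (mulOp d.measure).domain)
    (hz : z ∈ (mulOp d.measure).domain) : P.pairing (y + z) = P.pairing y + P.pairing z := by
  rw [pairing, pairing, pairing,
    ← integral_add (P.integrable_pairing hy) (P.integrable_pairing hz)]
  refine integral_congr_ae ?_
  filter_upwards [Lp.coeFn_add y z] with x hx
  rw [hx, Pi.add_apply, add_mul]

theorem pairing_smul (c : ℂ) (y : Lp ℂ 2 d.measure) :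
    P.pairing (c • y) = c * P.pairing y := by
  rw [pairing, pairing, ← integral_const_mul]
  refine integral_congr_ae ?_
  filter_upwards [Lp.coeFn_smul c y] with x hx
  simp [hx, mul_assoc]

/-- The graph of `L(A, a, b, κ)`: the pairs `(y₀ + c A⁻¹ a, A y₀)` with `c ∈ ℂ`, `y₀ ∈ D(A)` and
`κ c + ⟨y₀, b⟩ = 0`. -/
def graph : Submodule ℂ (Lp ℂ 2 d.measure × Lp ℂ 2 d.measure) where
  carrier := {p | ∃ (c : ℂ) (y₀ : (mulOp d.measure).domain),
    P.κ * c + P.pairing y₀ = 0 ∧ p.1 = y₀ + c • P.invA ∧ p.2 = mulOp d.measure y₀}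
  zero_mem' := ⟨0, 0, by simpa using P.pairing_smul 0 0, by simp, by simp⟩
  add_mem' := by
    rintro p q ⟨c, y, h1, h2, h3⟩ ⟨c', y', h1', h2', h3'⟩
    refine ⟨c + c', y + y', ?_, ?_, ?_⟩
    · rw [Submodule.coe_add, P.pairing_add y.2 y'.2]
      linear_combination h1 + h1'
    · rw [Prod.fst_add, h2, h2', Submodule.coe_add]
      module
    · rw [Prod.snd_add, h3, h3', LinearPMap.map_add]
  smul_mem' := by
    rintro r p ⟨c, y, h1, h2, h3⟩
    refine ⟨r * c, r • y, ?_, ?_, ?_⟩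
    · rw [Submodule.coe_smul, P.pairing_smul]
      linear_combination r * h1
    · rw [Prod.smul_fst, h2, Submodule.coe_smul]
      module
    · rw [Prod.smul_snd, h3, LinearPMap.map_smul]

/-- The singular rank one perturbation `L = L(A, a, b, κ)`: `L y = A y₀` for
`y = y₀ + c A⁻¹ a` with `y₀ ∈ D(A)` and `κ c + ⟨y₀, b⟩ = 0`. -/
def op : Lp ℂ 2 d.measure →ₗ.[ℂ] Lp ℂ 2 d.measure := P.graph.toLinearPMap

/-- `L` is correctly defined: its graph is single-valued. -/
theorem graph_single_valued (p : Lp ℂ 2 d.measure × Lp ℂ 2 d.measure) (hp : p ∈ P.graph)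
    (h0 : p.1 = 0) : p.2 = 0 := by
  obtain ⟨c, y, h1, h2, h3⟩ := hp
  rw [h0] at h2
  rcases eq_or_ne c 0 with rfl | hc
  · have hy : y = 0 := Subtype.ext (by simpa using h2.symm)
    rw [h3, hy, LinearPMap.map_zero]
  · exfalso
    have hy : (y : Lp ℂ 2 d.measure) = (-c) • P.invA := by
      rw [neg_smul]; exact eq_neg_of_add_eq_zero_left h2.symm
    have hyae : (y : Lp ℂ 2 d.measure) =ᵐ[d.measure] fun x => -c * (P.a x / (x : ℂ)) := by
      rw [hy]
      filter_upwards [Lp.coeFn_smul (-c) P.invA, P.memLp_a.coeFn_toLp] with x hx hx'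
      rw [hx, Pi.smul_apply, invA, hx', smul_eq_mul]
    have hyd : MemLp (fun x : ℝ => (x : ℂ) * (y : Lp ℂ 2 d.measure) x) 2 d.measure := y.2
    have ha : MemLp P.a 2 d.measure := by
      refine (hyd.const_smul (-c⁻¹)).ae_eq ?_
      filter_upwards [hyae, d.ae_ne_zero] with x hx hx0
      have hx' : (x : ℂ) ≠ 0 := by exact_mod_cast hx0
      simp only [Pi.smul_apply, smul_eq_mul, hx]
      field_simp
    refine P.κ_ne ha ?_
    have hpair : P.pairing y = -c * ∫ x, (x : ℂ)⁻¹ * P.a x * conj (P.b x) ∂d.measure := by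
      rw [pairing, ← integral_const_mul]
      refine integral_congr_ae ?_
      filter_upwards [hyae] with x hx
      rw [hx]; ring
    rw [hpair] at h1
    exact mul_left_cancel₀ hc (by linear_combination h1)

theorem mem_graph_op (y w : Lp ℂ 2 d.measure) : (y, w) ∈ P.op.graph ↔
    ∃ (c : ℂ) (y₀ : (mulOp d.measure).domain),
      P.κ * c + P.pairing y₀ = 0 ∧ y = y₀ + c • P.invA ∧ w = mulOp d.measure y₀ := by
  rw [op, Submodule.toLinearPMap_graph_eq _ P.graph_single_valued]
  rfl

end SingularPerturbation

/-! ### Hermite–Biehler functions and de Branges spaces -/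

/-- `F* z = conj (F (conj z))`. -/
def starFun (F : ℂ → ℂ) : ℂ → ℂ := fun z => conj (F (conj z))

/-- The Hermite–Biehler class: entire functions without zeros in the closed upper half-plane such
that `|E z| > |E* z|` for `Im z > 0`. -/
structure HermiteBiehler where
  E : ℂ → ℂ
  entire : Differentiable ℂ E
  ne_zero : ∀ z : ℂ, 0 ≤ z.im → E z ≠ 0
  norm_lt : ∀ z : ℂ, 0 < z.im → ‖starFun E z‖ < ‖E z‖

/-- The Hardy space `H²` of the upper half-plane: holomorphic functions there with
`sup_{y > 0} ∫ |f (x + i y)|² dx < ∞`. -/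
def IsHardy (f : ℂ → ℂ) : Prop :=
  DifferentiableOn ℂ f {z | 0 < z.im} ∧
    ∃ C : NNReal, ∀ y : ℝ, 0 < y → ∫⁻ x : ℝ, ‖f (x + y * Complex.I)‖ₑ ^ 2 ≤ C

theorem lintegral_sq_eq (g : ℝ → ℂ) :
    ∫⁻ x : ℝ, ‖g x‖ₑ ^ 2 = (eLpNorm g 2 volume) ^ 2 := by
  have h := eLpNorm_nnreal_pow_eq_lintegral (f := g) (μ := volume) (p := 2) (by norm_num)
  simpa using h.symm

theorem IsHardy.aesm {f : ℂ → ℂ} (hf : DifferentiableOn ℂ f {z | 0 < z.im}) {y : ℝ}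
    (hy : 0 < y) : AEStronglyMeasurable (fun x : ℝ => f (x + y * Complex.I)) volume := by
  have : Continuous (fun x : ℝ => f (x + y * Complex.I)) := by
    refine hf.continuousOn.comp_continuous (by fun_prop) ?_
    intro x
    simpa using hy
  exact this.aestronglyMeasurable

theorem IsHardy.add {f g : ℂ → ℂ} (hf : IsHardy f) (hg : IsHardy g) :
    IsHardy (fun z => f z + g z) := by
  obtain ⟨hf1, C, hC⟩ := hf
  obtain ⟨hg1, D, hD⟩ := hg
  refine ⟨hf1.add hg1, 2 * (C + D), fun y hy => ?_⟩
  have hb : ∀ x : ℝ, ‖f (x + y * Complex.I) + g (x + y * Complex.I)‖ₑ ^ 2 ≤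
      2 * (‖f (x + y * Complex.I)‖ₑ ^ 2 + ‖g (x + y * Complex.I)‖ₑ ^ 2) := by
    intro x
    refine (pow_le_pow_left' (enorm_add_le _ _) 2).trans ?_
    simp only [enorm_eq_nnnorm]
    exact_mod_cast (add_sq_le : (‖f (x + y * Complex.I)‖₊ + ‖g (x + y * Complex.I)‖₊) ^ 2 ≤ _)
  calc _ ≤ ∫⁻ x : ℝ, 2 * (‖f (x + y * Complex.I)‖ₑ ^ 2 + ‖g (x + y * Complex.I)‖ₑ ^ 2) :=
        lintegral_mono hb
    _ = 2 * ((∫⁻ x : ℝ, ‖f (x + y * Complex.I)‖ₑ ^ 2) +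
          (∫⁻ x : ℝ, ‖g (x + y * Complex.I)‖ₑ ^ 2)) := by
        rw [lintegral_const_mul' _ _ (by norm_num), lintegral_add_left']
        exact (IsHardy.aesm hf1 hy).enorm.pow_const 2
    _ ≤ _ := by
        push_cast
        gcongr
        · exact hC y hy
        · exact hD y hy

theorem IsHardy.const_mul {f : ℂ → ℂ} (c : ℂ) (hf : IsHardy f) :
    IsHardy (fun z => c * f z) := by
  obtain ⟨hf1, C, hC⟩ := hf
  refine ⟨hf1.const_mul c, ‖c‖₊ ^ 2 * C, fun y hy => ?_⟩
  simp only [enorm_mul, mul_pow]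
  rw [lintegral_const_mul' _ _ (by simp)]
  push_cast
  rw [← enorm_eq_nnnorm]
  gcongr
  exact hC y hy

theorem IsHardy.zero : IsHardy (fun _ => 0) :=
  ⟨differentiableOn_const 0, 0, by simp⟩

namespace HermiteBiehler

variable (E : HermiteBiehler)

/-- `A_E = (E + E*) / 2`. -/
def A : ℂ → ℂ := fun z => (E.E z + starFun E.E z) / 2

/-- The functions in the de Branges space `H(E)`: the entire functions `F` such that `F / E` and
`F* / E` belong to the Hardy space of the upper half-plane. -/
def space : Submodule ℂ (ℂ → ℂ) where
  carrier := {F | Differentiable ℂ F ∧ IsHardy (fun z => F z / E.E z) ∧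
    IsHardy (fun z => starFun F z / E.E z)}
  zero_mem' := by
    refine ⟨differentiable_const 0, ?_, ?_⟩
    · simpa using IsHardy.zero
    · simpa [starFun] using IsHardy.zero
  add_mem' := by
    rintro F G ⟨h1, h2, h3⟩ ⟨h1', h2', h3'⟩
    refine ⟨h1.add h1', ?_, ?_⟩
    · simpa [add_div] using h2.add h2'
    · simpa [starFun, add_div] using h3.add h3'
  smul_mem' := by
    rintro c F ⟨h1, h2, h3⟩
    refine ⟨h1.const_smul c, ?_, ?_⟩
    · simpa [mul_div_assoc] using h2.const_mul c
    · simpa [starFun, mul_div_assoc] using h3.const_mul (conj c)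

/-- The de Branges space `H(E)` as a type. -/
def Space : Type := E.space

instance : AddCommGroup E.Space := inferInstanceAs (AddCommGroup E.space)

instance : Module ℂ E.Space := inferInstanceAs (Module ℂ E.space)

variable {E}

/-- The entire function underlying an element of `H(E)`. -/
def Space.fn (F : E.Space) : ℂ → ℂ := Subtype.val (p := fun F => F ∈ E.space) F

theorem Space.fn_mem (F : E.Space) : F.fn ∈ E.space :=
  Subtype.property (p := fun F => F ∈ E.space) F

theorem Space.fn_injective : Function.Injective (Space.fn (E := E)) :=
  Subtype.val_injective

@[simp] theorem Space.fn_zero : (0 : E.Space).fn = 0 := rfl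

@[simp] theorem Space.fn_add (F G : E.Space) : (F + G).fn = F.fn + G.fn := rfl

@[simp] theorem Space.fn_smul (c : ℂ) (F : E.Space) : (c • F).fn = c • F.fn := rfl

theorem Space.continuous_quot (F : E.Space) :
    Continuous (fun t : ℝ => F.fn t / E.E t) := by
  have h1 : Continuous F.fn := F.fn_mem.1.continuous
  have h2 : Continuous E.E := E.entire.continuous
  exact (h1.comp Complex.continuous_ofReal).div (h2.comp Complex.continuous_ofReal)
    fun t => E.ne_zero t (by simp)

/-- By Fatou's lemma, `F / E` is square integrable on the real line for `F ∈ H(E)`. -/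
theorem Space.memLp_quot (F : E.Space) :
    MemLp (fun t : ℝ => F.fn t / E.E t) 2 volume := by
  refine ⟨F.continuous_quot.aestronglyMeasurable, ?_⟩
  obtain ⟨hd, C, hC⟩ := F.fn_mem.2.1
  set u : ℕ → ℝ := fun n => 1 / ((n : ℝ) + 1) with hu
  have hupos : ∀ n, 0 < u n := fun n => by positivity
  have hu0 : Tendsto u atTop (𝓝 0) := tendsto_one_div_add_atTop_nhds_zero_nat
  have hlim : ∀ x : ℝ, Tendsto
      (fun n => ‖F.fn (x + u n * Complex.I) / E.E (x + u n * Complex.I)‖ₑ ^ 2) atTop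
      (𝓝 (‖F.fn x / E.E x‖ₑ ^ 2)) := by
    intro x
    have hz : Tendsto (fun n => (x : ℂ) + u n * Complex.I) atTop (𝓝 (x : ℂ)) := by
      have h : Continuous (fun s : ℝ => (x : ℂ) + s * Complex.I) := by fun_prop
      have := (h.tendsto 0).comp hu0
      simpa [Function.comp_def] using this
    have h1 : ContinuousAt (fun z => F.fn z / E.E z) (x : ℂ) :=
      F.fn_mem.1.continuous.continuousAt.div E.entire.continuous.continuousAt
        (E.ne_zero x (by simp))
    have h3 := (h1.tendsto.comp hz).enorm
    exact ((ENNReal.continuous_pow 2).tendsto _).comp h3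
  have hfat : ∫⁻ x : ℝ, ‖F.fn x / E.E x‖ₑ ^ 2 ≤ C := by
    calc ∫⁻ x : ℝ, ‖F.fn x / E.E x‖ₑ ^ 2
        = ∫⁻ x : ℝ, liminf (fun n =>
            ‖F.fn (x + u n * Complex.I) / E.E (x + u n * Complex.I)‖ₑ ^ 2) atTop :=
          lintegral_congr fun x => ((hlim x).liminf_eq).symm
      _ ≤ liminf (fun n => ∫⁻ x : ℝ,
            ‖F.fn (x + u n * Complex.I) / E.E (x + u n * Complex.I)‖ₑ ^ 2) atTop :=
          lintegral_liminf_le' fun n => (IsHardy.aesm hd (hupos n)).enorm.pow_const 2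
      _ ≤ C := by
          refine liminf_le_of_le (by isBoundedDefault) fun b hb => ?_
          obtain ⟨n, hn⟩ := hb.exists
          exact hn.trans (hC _ (hupos n))
  rw [lintegral_sq_eq] at hfat
  by_contra h
  rw [not_lt, top_le_iff] at h
  rw [h] at hfat
  simp at hfat

/-- The inner product of `H(E)`; the integrand is `F(t) conj (G(t)) / |E(t)|²`, and, as everywhere
in Mathlib, `inner` is conjugate linear in its first argument. -/
instance : Inner ℂ E.Space where
  inner G F := ∫ t : ℝ, F.fn t * conj (G.fn t) / (‖E.E t‖ ^ 2 : ℝ)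

theorem Space.inner_def (G F : E.Space) :
    inner ℂ G F = ∫ t : ℝ, F.fn t * conj (G.fn t) / (‖E.E t‖ ^ 2 : ℝ) := rfl

theorem Space.integrand_eq (G F : E.Space) (t : ℝ) :
    F.fn t * conj (G.fn t) / (‖E.E t‖ ^ 2 : ℝ) =
      (F.fn t / E.E t) * conj (G.fn t / E.E t) := by
  have h : E.E t ≠ 0 := E.ne_zero t (by simp)
  rw [map_div₀, div_mul_div_comm, Complex.mul_conj, Complex.normSq_eq_norm_sq]

theorem Space.integrable_integrand (G F : E.Space) :
    Integrable (fun t : ℝ => F.fn t * conj (G.fn t) / (‖E.E t‖ ^ 2 : ℝ)) := by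
  simp_rw [Space.integrand_eq]
  exact MemLp.integrable_mul F.memLp_quot G.memLp_quot.star

theorem Space.integrand_self (F : E.Space) (t : ℝ) :
    F.fn t * conj (F.fn t) / (‖E.E t‖ ^ 2 : ℝ) =
      ((‖F.fn t / E.E t‖ ^ 2 : ℝ) : ℂ) := by
  rw [Space.integrand_eq, Complex.mul_conj, Complex.normSq_eq_norm_sq]

theorem Space.inner_self (F : E.Space) :
    inner ℂ F F = ((∫ t : ℝ, ‖F.fn t / E.E t‖ ^ 2 : ℝ) : ℂ) := by
  rw [Space.inner_def, ← integral_complex_ofReal]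
  exact integral_congr_ae (.of_forall fun t => Space.integrand_self F t)

theorem Space.eq_zero_of_inner_self (F : E.Space) (h : inner ℂ F F = 0) : F = 0 := by
  rw [Space.inner_self, Complex.ofReal_eq_zero] at h
  have hc : Continuous (fun t : ℝ => ‖F.fn t / E.E t‖ ^ 2) := F.continuous_quot.norm.pow 2
  have hi : Integrable (fun t : ℝ => ‖F.fn t / E.E t‖ ^ 2) :=
    (memLp_two_iff_integrable_sq_norm F.continuous_quot.aestronglyMeasurable).1 F.memLp_quot
  rw [integral_eq_zero_iff_of_nonneg (fun t => by positivity) hi] at h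
  have h0 : (fun t : ℝ => ‖F.fn t / E.E t‖ ^ 2) = 0 :=
    (hc.ae_eq_iff_eq volume continuous_zero).1 h
  have hreal : ∀ t : ℝ, F.fn t = 0 := by
    intro t
    have := congrFun h0 t
    simpa [E.ne_zero t (by simp)] using this
  refine Space.fn_injective ?_
  have han : AnalyticOnNhd ℂ F.fn Set.univ := fun z _ => F.fn_mem.1.analyticAt z
  refine han.eq_of_frequently_eq (z₀ := 0) (analyticOnNhd_const (v := (0 : ℂ))) ?_
  have hz : Tendsto (fun n : ℕ => ((1 / ((n : ℝ) + 1) : ℝ) : ℂ)) atTop (𝓝[≠] 0) := by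
    refine tendsto_nhdsWithin_iff.2 ⟨?_, .of_forall fun n => ?_⟩
    · have := (Complex.continuous_ofReal.tendsto 0).comp
        (tendsto_one_div_add_atTop_nhds_zero_nat (𝕜 := ℝ))
      simpa [Function.comp_def] using this
    · have : (1 / ((n : ℝ) + 1)) ≠ 0 := by positivity
      simpa only [Set.mem_compl_iff, Set.mem_singleton_iff, Complex.ofReal_eq_zero] using this
  exact hz.frequently (Frequently.of_forall fun n => hreal _)

/-- The de Branges space as an inner product space. -/
@[reducible] def core : InnerProductSpace.Core ℂ E.Space where
  conj_inner_symm F G := by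
    rw [Space.inner_def, Space.inner_def, ← integral_conj]
    refine integral_congr_ae (.of_forall fun t => ?_)
    simp [mul_comm]
  re_inner_nonneg F := by
    rw [Space.inner_self]
    exact integral_nonneg fun t => by positivity
  add_left F G K := by
    rw [Space.inner_def, Space.inner_def, Space.inner_def,
      ← integral_add (Space.integrable_integrand _ _) (Space.integrable_integrand _ _)]
    refine integral_congr_ae (.of_forall fun t => ?_)
    simp [mul_add, add_div]
  smul_left F G c := by
    rw [Space.inner_def, Space.inner_def, ← integral_const_mul]
    refine integral_congr_ae (.of_forall fun t => ?_)
    simp only [Space.fn_smul, Pi.smul_apply, smul_eq_mul, map_mul]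
    ring
  definite F h := Space.eq_zero_of_inner_self F h

instance : NormedAddCommGroup E.Space := core.toNormedAddCommGroup

instance : InnerProductSpace ℂ E.Space := InnerProductSpace.ofCore core.toCore

/-! ### The model operator -/

variable (E)

/-- The graph of `T(E, G)`: the pairs `(F, z F - c G)` with `F ∈ H(E)` and `c ∈ ℂ` such that
`z F - c G ∈ H(E)`. -/
def modelGraph (G : ℂ → ℂ) : Submodule ℂ (E.Space × E.Space) where
  carrier := {p | ∃ c : ℂ, ∀ z, p.2.fn z = z * p.1.fn z - c * G z}
  zero_mem' := ⟨0, by simp⟩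
  add_mem' := by
    rintro p q ⟨c, h⟩ ⟨c', h'⟩
    refine ⟨c + c', fun z => ?_⟩
    simp only [Prod.snd_add, Prod.fst_add, Space.fn_add, Pi.add_apply, h, h']
    ring
  smul_mem' := by
    rintro r p ⟨c, h⟩
    refine ⟨r * c, fun z => ?_⟩
    simp only [Prod.smul_snd, Prod.smul_fst, Space.fn_smul, Pi.smul_apply, smul_eq_mul, h]
    ring

/-- The model operator `T = T(E, G)` in `H(E)`: its domain consists of the `F ∈ H(E)` for which
there is `c ∈ ℂ` with `z F - c G ∈ H(E)`, and `T F = z F - c G`. -/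
def modelOp (G : ℂ → ℂ) : E.Space →ₗ.[ℂ] E.Space := (E.modelGraph G).toLinearPMap

/-- `T(E, G)` is correctly defined when `G ∉ H(E)`. -/
theorem modelGraph_single_valued {G : ℂ → ℂ} (hG : G ∉ E.space) (p : E.Space × E.Space)
    (hp : p ∈ E.modelGraph G) (h0 : p.1 = 0) : p.2 = 0 := by
  obtain ⟨c, h⟩ := hp
  rw [h0] at h
  have h2 : p.2.fn = (-c) • G := by
    funext z
    simp [h z]
  rcases eq_or_ne c 0 with rfl | hc
  · exact Space.fn_injective (by simpa using h2)
  · exfalso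
    refine hG ?_
    have h3 : G = (-c)⁻¹ • p.2.fn := by
      rw [h2, smul_smul, inv_mul_cancel₀ (neg_ne_zero.2 hc), one_smul]
    rw [h3]
    exact E.space.smul_mem _ p.2.fn_mem

theorem mem_graph_modelOp {G : ℂ → ℂ} (hG : G ∉ E.space) (F K : E.Space) :
    (F, K) ∈ (E.modelOp G).graph ↔ ∃ c : ℂ, ∀ z, K.fn z = z * F.fn z - c * G z := by
  rw [modelOp, Submodule.toLinearPMap_graph_eq _ (E.modelGraph_single_valued hG)]
  rfl

/-- `G` is an entire function with `G ∉ H(E)` and `G / (z - z₀) ∈ H(E)` for each zero `z₀` of `G`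
(the quotient being extended to an entire function, so it is the entire `F` with
`(z - z₀) F(z) = G(z)`); if `G` has no zeros, the requirement is `G ∈ H(E) + z H(E)`. The last
condition follows from the previous one if `G` has a zero, since then `G = (z - z₀) F`. -/
structure IsGenerator (G : ℂ → ℂ) : Prop where
  entire : Differentiable ℂ G
  notMem : G ∉ E.space
  quot : ∀ z₀, G z₀ = 0 → ∃ F ∈ E.space, ∀ z, (z - z₀) * F z = G z
  zeroFree : (∀ z, G z ≠ 0) → ∃ F₀ ∈ E.space, ∃ F₁ ∈ E.space, ∀ z, G z = F₀ z + z * F₁ z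

end HermiteBiehler

end

noncomputable section

/-! ### The Hardy space: functions continuous up to the real line -/

/-! Both directions rest on one dictionary. Write `A_E` for `E.A`, let `t_n` be its zeros and `e_n =
A_E / (z - t_n)`. Multiplication by `z` modulo `A_E` is symmetric in `H(E)` (`inner_mul_eq`), so the
`e_n` are orthogonal; they are complete when `A_E ∉ H(E)` (`Space.eq_zero_of_forall_zero`). If
`‖e_n‖⁻² = |b(t_n)|² μ_n`, then `U f = ∑ f(t_n) conj(b(t_n)) μ_n e_n` is a unitary map of `L²(μ)`
onto `H(E)` (`exists_unitary`). Since `t_n e_n = z e_n - A_E`, it satisfies `U(Ay) = z Uy - ⟨y, b⟩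
A_E` on `D(A)` (`sampling_mulOp`). Put `G = κ A_E - z U(A⁻¹a)`. For `y = y₀ + c A⁻¹a` the relation
`κc + ⟨y₀, b⟩ = 0` turns `U(Ay₀)` into `z Uy + cG`, so `L` becomes `T(E, G)`
(`unitarilyEquivalent_of_model`). The condition on `κ` when `a ∈ L²(μ)` is what gives `G ∉ H(E)`,
and `G(0) = κ A_E(0)`.

For (1), `E` must have prescribed zeros of `A_E` and prescribed norms `‖e_n‖`
(`exists_hermiteBiehler`). Take a Weierstrass product for `A`, define `B` by `B/A = ∑ c_n (1/(t_n -
z) - 1/t_n)` with `c_n = π |b(t_n)|² μ_n`, and put `E = A - iB`. Positivity of the imaginary part of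
`B/A` makes `E` Hermite–Biehler, the residues give the norms, and growth along the imaginary axis
excludes `A ∈ H(E)`.

For (2), take `b = 1`, `μ_n = ‖e_n‖⁻²`, `κ = G(0)/A_E(0)`, and let `A⁻¹a` be the preimage under `U`
of `(κ A_E - G)/z`, which lies in `H(E)` because `G ∈ H(E) + z H(E)`.

The analytic input is the Cauchy and Poisson formulas for `H²` functions continuous up to the real
line. This class suffices because `E` has no real zeros. -/

theorem inv_sub_sq_add_sq_eq (u : ℝ) {s : ℝ} (hs : 0 < s) (x : ℝ) :
    ((x - u) ^ 2 + s ^ 2)⁻¹ = (s ^ 2)⁻¹ * (1 + ((x - u) / s) ^ 2)⁻¹ := by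
  rw [← mul_inv]
  congr 1
  field_simp
  ring

theorem integrable_inv_sub_sq_add_sq (u : ℝ) {s : ℝ} (hs : 0 < s) :
    Integrable fun x : ℝ => ((x - u) ^ 2 + s ^ 2)⁻¹ := by
  simp_rw [inv_sub_sq_add_sq_eq u hs]
  exact ((integrable_inv_one_add_sq.comp_div hs.ne').comp_sub_right u).const_mul _

theorem integral_inv_sub_sq_add_sq (u : ℝ) {s : ℝ} (hs : 0 < s) :
    ∫ x : ℝ, ((x - u) ^ 2 + s ^ 2)⁻¹ = Real.pi / s := by
  simp_rw [inv_sub_sq_add_sq_eq u hs]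
  rw [integral_const_mul, integral_sub_right_eq_self (fun x : ℝ => (1 + (x / s) ^ 2)⁻¹) u,
    Measure.integral_comp_div (fun x : ℝ => (1 + x ^ 2)⁻¹), integral_univ_inv_one_add_sq,
    abs_of_pos hs, smul_eq_mul]
  field_simp

theorem lintegral_inv_sub_sq_add_sq (u : ℝ) {s : ℝ} (hs : 0 < s) :
    ∫⁻ x : ℝ, ENNReal.ofReal ((x - u) ^ 2 + s ^ 2)⁻¹ = ENNReal.ofReal (Real.pi / s) := by
  rw [← ofReal_integral_eq_lintegral_ofReal (integrable_inv_sub_sq_add_sq u hs)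
    (.of_forall fun x => by positivity), integral_inv_sub_sq_add_sq u hs]

/-- A holomorphic function in the upper half-plane, continuous up to the real line, whose product
with `z - w` is dominated by an `H²` function plus a constant lies in `H²`. -/
theorem isHardy_of_norm_mul_le {f h : ℂ → ℂ} (hc : ContinuousOn f {z | 0 ≤ z.im})
    (hd : DifferentiableOn ℂ f {z | 0 < z.im}) (hh : IsHardy h) (w : ℂ) (M : ℝ)
    (hb : ∀ z : ℂ, 0 < z.im → ‖f z‖ * ‖z - w‖ ≤ ‖h z‖ + M) : IsHardy f := by
  refine ⟨hd, ?_⟩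
  obtain ⟨hhd, C, hC⟩ := hh
  have hcl : IsClosed {z : ℂ | 0 ≤ z.im} := isClosed_le continuous_const Complex.continuous_im
  have hcomp : IsCompact (Metric.closedBall w 1 ∩ {z : ℂ | 0 ≤ z.im}) :=
    (isCompact_closedBall w 1).inter_right hcl
  obtain ⟨M₁, hM₁⟩ := hcomp.exists_bound_of_continuousOn (hc.mono Set.inter_subset_right)
  -- Where `|z - w| ≥ 1` the hypothesis `hb` is used and costs `4 M²`; where `|z - w| ≤ 1` the
  -- compactness bound `M₁` costs `2 M₁²`.
  set K : ℝ := 4 * M ^ 2 + 2 * M₁ ^ 2 with hK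
  have key : ∀ z : ℂ, 0 < z.im →
      ‖f z‖ ^ 2 ≤ 2 * ‖h z‖ ^ 2 + K * ((z.re - w.re) ^ 2 + 1 ^ 2)⁻¹ := by
    intro z hz
    have hnz : ‖z - w‖ ^ 2 = (z.re - w.re) ^ 2 + (z.im - w.im) ^ 2 := by
      rw [Complex.sq_norm, Complex.normSq_apply]; simp; ring
    have hq : 0 < (z.re - w.re) ^ 2 + 1 ^ 2 := by positivity
    rw [← div_eq_mul_inv, ← sub_le_iff_le_add', le_div_iff₀ hq]
    rcases le_total 1 ‖z - w‖ with h1 | h1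
    · have h2 : 1 ≤ ‖z - w‖ ^ 2 := one_le_pow₀ h1
      have h3 : (z.re - w.re) ^ 2 + 1 ^ 2 ≤ 2 * ‖z - w‖ ^ 2 := by
        nlinarith [sq_nonneg (z.im - w.im)]
      have h4 : ‖f z‖ ^ 2 * ‖z - w‖ ^ 2 ≤ 2 * ‖h z‖ ^ 2 + 2 * M ^ 2 := by
        have := pow_le_pow_left₀ (by positivity) (hb z hz) 2
        rw [mul_pow] at this
        nlinarith [sq_nonneg (‖h z‖ - M)]
      rcases le_total (‖f z‖ ^ 2 - 2 * ‖h z‖ ^ 2) 0 with h5 | h5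
      · have : 0 ≤ K := by positivity
        nlinarith
      · have h6 : ‖h z‖ ^ 2 ≤ ‖h z‖ ^ 2 * ‖z - w‖ ^ 2 := le_mul_of_one_le_right (by positivity) h2
        have := mul_le_mul_of_nonneg_left h3 h5
        nlinarith [sq_nonneg M₁]
    · have h2 : ‖f z‖ ≤ M₁ := hM₁ z ⟨by simpa [dist_eq_norm] using h1, hz.le⟩
      have h3 : ‖f z‖ ^ 2 ≤ M₁ ^ 2 := pow_le_pow_left₀ (norm_nonneg _) h2 2
      have h4 : (z.re - w.re) ^ 2 + 1 ^ 2 ≤ 2 := by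
        have : ‖z - w‖ ^ 2 ≤ 1 := pow_le_one₀ (norm_nonneg _) h1
        nlinarith [sq_nonneg (z.im - w.im)]
      nlinarith [sq_nonneg M, sq_nonneg ‖h z‖, sq_nonneg M₁]
  refine ⟨2 * C + (K * Real.pi).toNNReal, fun y hy => ?_⟩
  have hm : AEMeasurable (fun x : ℝ => 2 * ‖h (x + y * Complex.I)‖ₑ ^ 2) volume :=
    ((IsHardy.aesm hhd hy).enorm.pow_const 2).const_mul 2
  calc ∫⁻ x : ℝ, ‖f (x + y * Complex.I)‖ₑ ^ 2
      ≤ ∫⁻ x : ℝ, (2 * ‖h (x + y * Complex.I)‖ₑ ^ 2 +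
          ENNReal.ofReal K * ENNReal.ofReal ((x - w.re) ^ 2 + 1 ^ 2)⁻¹) := by
        refine lintegral_mono fun x => ?_
        have h1 := key (x + y * Complex.I) (by simpa using hy)
        rw [← ofReal_norm, ← ofReal_norm, ← ENNReal.ofReal_pow (norm_nonneg _),
          ← ENNReal.ofReal_pow (norm_nonneg _), ← ENNReal.ofReal_mul (by positivity),
          show (2 : ENNReal) = ENNReal.ofReal 2 by simp, ← ENNReal.ofReal_mul (by positivity),
          ← ENNReal.ofReal_add (by positivity) (by positivity)]
        refine ENNReal.ofReal_le_ofReal ?_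
        simpa using h1
    _ = 2 * (∫⁻ x : ℝ, ‖h (x + y * Complex.I)‖ₑ ^ 2) +
          ENNReal.ofReal K * ENNReal.ofReal (Real.pi / 1) := by
        rw [lintegral_add_left' hm, lintegral_const_mul' _ _ (by norm_num),
          lintegral_const_mul' _ _ (by simp), lintegral_inv_sub_sq_add_sq w.re one_pos]
    _ ≤ _ := by
        push_cast
        rw [← ENNReal.ofReal_mul (by positivity), div_one]
        gcongr
        · exact hC y hy
        · exact le_rfl

/-- Cauchy's theorem for the real line. -/
theorem integral_real_eq_zero {f : ℂ → ℂ} (hc : ContinuousOn f {z | 0 ≤ z.im})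
    (hd : DifferentiableOn ℂ f {z | 0 < z.im}) (hi : Integrable fun x : ℝ => f x)
    {N : ℝ → ℝ} {C : ℝ} (hN : ∀ y : ℝ, 0 < y → ∫⁻ x : ℝ, ‖f (x + y * Complex.I)‖ₑ ≤ ENNReal.ofReal (N y))
    (hNC : ∀ y, 0 < y → N y ≤ C) (hN0 : Tendsto N atTop (𝓝 0)) : ∫ x : ℝ, f x = 0 := by
  by_contra hne
  set δ := ‖∫ x : ℝ, f x‖ with hδ
  have hδ0 : 0 < δ := norm_pos_iff.2 hne
  obtain ⟨Y, hYN, hY⟩ := ((hN0.eventually (gt_mem_nhds (show 0 < δ / 4 by positivity))).and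
    (eventually_gt_atTop 0)).exists
  have hI : Tendsto (fun R : ℝ => ‖∫ x in (-R)..R, f x‖) atTop (𝓝 δ) :=
    (intervalIntegral_tendsto_integral hi tendsto_neg_atTop_atBot tendsto_id).norm
  obtain ⟨R₀, hR₀⟩ := eventually_atTop.1 ((hI.eventually
    (lt_mem_nhds (show δ / 2 < δ by linarith))).and (eventually_gt_atTop 0))
  have hcont : Continuous fun p : ℝ × ℝ => f (p.1 + (max p.2 0 : ℝ) * Complex.I) :=
    hc.comp_continuous (by fun_prop) (by intro p; simp)
  -- `V R` bounds the contribution of the vertical side at abscissa `R`. By Tonelli `V` is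
  -- integrable, whereas a nonzero integral would force `V R + V (-R) ≥ δ/4` for all large `R`. Thus
  -- no pointwise decay of `f` is needed. The `max` only makes the integrand continuous on the whole
  -- plane.
  set V : ℝ → ENNReal := fun R =>
    ∫⁻ y in Set.Ioc 0 Y, ‖f (R + (max y 0 : ℝ) * Complex.I)‖ₑ with hV
  have hVm : Measurable V := by
    have : Measurable fun p : ℝ × ℝ => ‖f (p.1 + (max p.2 0 : ℝ) * Complex.I)‖ₑ :=
      hcont.enorm.measurable
    exact this.lintegral_prod_right'
  have hVfin : ∫⁻ R, V R ≤ ENNReal.ofReal C * ENNReal.ofReal Y := by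
    have hsw : ∫⁻ R, V R = ∫⁻ y in Set.Ioc 0 Y, ∫⁻ R : ℝ,
        ‖f (R + (max y 0 : ℝ) * Complex.I)‖ₑ := by
      refine lintegral_lintegral_swap ?_
      exact hcont.enorm.measurable.aemeasurable
    rw [hsw]
    calc _ ≤ ∫⁻ y in Set.Ioc 0 Y, ENNReal.ofReal C := by
          refine setLIntegral_mono measurable_const fun y hy => ?_
          rw [max_eq_left hy.1.le]
          exact (hN y hy.1).trans (ENNReal.ofReal_le_ofReal (hNC y hy.1))
      _ = _ := by rw [setLIntegral_const, Real.volume_Ioc, sub_zero]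
  have hbig : ∀ R, R₀ ≤ R → ENNReal.ofReal (δ / 4) ≤ V R + V (-R) := by
    intro R hR
    obtain ⟨h1, hRpos⟩ := hR₀ R hR
    have hrect := Complex.integral_boundary_rect_eq_zero_of_continuousOn_of_differentiableOn f
      (-R : ℝ) ((R : ℝ) + Y * Complex.I)
      (hc.mono (by
        intro z hz
        have := hz.2
        simp [Set.uIcc_of_le hY.le] at this
        exact this.1))
      (hd.mono (by
        intro z hz
        have := hz.2
        simp [hY.le] at this
        exact this.1))
    simp only [Complex.ofReal_neg, Complex.neg_re, Complex.ofReal_re, Complex.neg_im,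
      Complex.ofReal_im, neg_zero, Complex.ofReal_zero, zero_mul, add_zero, Complex.add_re,
      Complex.mul_re, Complex.I_re, mul_zero, Complex.I_im, mul_one, sub_self, Complex.add_im,
      Complex.mul_im, zero_add, smul_eq_mul] at hrect
    have hvert : ∀ r : ℝ, ‖∫ y in (0 : ℝ)..Y, f (r + y * Complex.I)‖ₑ ≤ V r := by
      intro r
      rw [intervalIntegral.integral_of_le hY.le]
      refine (enorm_integral_le_lintegral_enorm _).trans (le_of_eq ?_)
      refine setLIntegral_congr_fun measurableSet_Ioc fun y hy => ?_
      simp only [max_eq_left hy.1.le]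
    have htop : ‖∫ x in (-R)..R, f (x + Y * Complex.I)‖ₑ ≤ ENNReal.ofReal (δ / 4) := by
      rw [intervalIntegral.integral_of_le (by linarith)]
      refine (enorm_integral_le_lintegral_enorm _).trans ?_
      exact (setLIntegral_le_lintegral _ _).trans ((hN Y hY).trans
        (ENNReal.ofReal_le_ofReal hYN.le))
    have hv1 := hvert R
    have hv2 := hvert (-R)
    simp only [Complex.ofReal_neg] at hv2
    have h2 : ‖∫ x in (-R)..R, f x‖ₑ ≤ ENNReal.ofReal (δ / 4) + (V R + V (-R)) := by
      have : (∫ x in (-R)..R, f x) = (∫ x in (-R)..R, f (x + Y * Complex.I)) +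
          (-(Complex.I * ∫ y in (0 : ℝ)..Y, f (R + y * Complex.I)) +
            Complex.I * ∫ y in (0 : ℝ)..Y, f (-R + y * Complex.I)) := by
        linear_combination hrect
      rw [this]
      refine (enorm_add_le _ _).trans (add_le_add htop ((enorm_add_le _ _).trans ?_))
      rw [enorm_neg, enorm_mul, enorm_mul]
      have hIe : ‖Complex.I‖ₑ = 1 := by rw [← ofReal_norm]; simp
      rw [hIe, one_mul, one_mul]
      exact add_le_add hv1 hv2
    have h3 : ENNReal.ofReal (δ / 2) ≤ ENNReal.ofReal (δ / 4) + (V R + V (-R)) := by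
      refine le_trans ?_ h2
      rw [← ofReal_norm]
      exact ENNReal.ofReal_le_ofReal h1.le
    rw [show δ / 2 = δ / 4 + δ / 4 by ring, ENNReal.ofReal_add (by positivity) (by positivity)] at h3
    exact (ENNReal.add_le_add_iff_left ENNReal.ofReal_ne_top).1 h3
  have hsum : ∫⁻ R, (V R + V (-R)) ≤ 2 * (ENNReal.ofReal C * ENNReal.ofReal Y) := by
    rw [lintegral_add_left hVm, lintegral_neg_eq_self, two_mul]
    exact add_le_add hVfin hVfin
  have hinf : (⊤ : ENNReal) ≤ ∫⁻ R, (V R + V (-R)) := by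
    calc (⊤ : ENNReal) = ∫⁻ R in Set.Ici R₀, ENNReal.ofReal (δ / 4) := by
          rw [setLIntegral_const, Real.volume_Ici, ENNReal.mul_top]
          simpa using hδ0
      _ ≤ ∫⁻ R in Set.Ici R₀, (V R + V (-R)) :=
          setLIntegral_mono (hVm.add (hVm.comp measurable_neg)) fun R hR => hbig R hR
      _ ≤ _ := setLIntegral_le_lintegral _ _
  have := hinf.trans hsum
  rw [top_le_iff] at this
  exact (ENNReal.mul_lt_top (by simp) (ENNReal.mul_lt_top (by simp) (by simp))).ne this

/-- Functions of the Hardy space `H²` that are continuous up to the real line. -/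
structure IsHardyCont (f : ℂ → ℂ) : Prop where
  hardy : IsHardy f
  cont : ContinuousOn f {z | 0 ≤ z.im}

theorem IsHardyCont.continuous_line {f : ℂ → ℂ} (hf : IsHardyCont f) :
    Continuous fun t : ℝ => f t :=
  hf.cont.comp_continuous (by fun_prop) (by intro t; simp)

theorem IsHardyCont.add {f g : ℂ → ℂ} (hf : IsHardyCont f) (hg : IsHardyCont g) :
    IsHardyCont fun z => f z + g z :=
  ⟨hf.hardy.add hg.hardy, hf.cont.add hg.cont⟩

theorem IsHardyCont.const_mul {f : ℂ → ℂ} (c : ℂ) (hf : IsHardyCont f) :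
    IsHardyCont fun z => c * f z :=
  ⟨hf.hardy.const_mul c, hf.cont.const_mul c⟩

/-- Fatou's lemma along the lines `Im z = 1/(n+1)`; continuity up to the boundary identifies the
limit. -/
theorem IsHardyCont.lintegral_line_le {f : ℂ → ℂ} (hf : IsHardyCont f) :
    ∃ C : NNReal, ∫⁻ x : ℝ, ‖f x‖ₑ ^ 2 ≤ C := by
  obtain ⟨hd, C, hC⟩ := hf.hardy
  refine ⟨C, ?_⟩
  set u : ℕ → ℝ := fun n => 1 / ((n : ℝ) + 1) with hu
  have hupos : ∀ n, 0 < u n := fun n => by positivity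
  have hu0 : Tendsto u atTop (𝓝 0) := tendsto_one_div_add_atTop_nhds_zero_nat
  have hlim : ∀ x : ℝ, Tendsto (fun n => ‖f (x + u n * Complex.I)‖ₑ ^ 2) atTop
      (𝓝 (‖f x‖ₑ ^ 2)) := by
    intro x
    have hz : Tendsto (fun n => (x : ℂ) + u n * Complex.I) atTop (𝓝[{z | 0 ≤ z.im}] (x : ℂ)) := by
      refine tendsto_nhdsWithin_iff.2 ⟨?_, .of_forall fun n => by simpa using (hupos n).le⟩
      have h : Continuous (fun s : ℝ => (x : ℂ) + s * Complex.I) := by fun_prop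
      have := (h.tendsto 0).comp hu0
      simpa [Function.comp_def] using this
    have h3 := ((hf.cont x (by simp)).tendsto.comp hz).enorm
    exact ((ENNReal.continuous_pow 2).tendsto _).comp h3
  calc ∫⁻ x : ℝ, ‖f x‖ₑ ^ 2
      = ∫⁻ x : ℝ, liminf (fun n => ‖f (x + u n * Complex.I)‖ₑ ^ 2) atTop :=
        lintegral_congr fun x => ((hlim x).liminf_eq).symm
    _ ≤ liminf (fun n => ∫⁻ x : ℝ, ‖f (x + u n * Complex.I)‖ₑ ^ 2) atTop :=
        lintegral_liminf_le' fun n => (IsHardy.aesm hd (hupos n)).enorm.pow_const 2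
    _ ≤ C := by
        refine liminf_le_of_le (by isBoundedDefault) fun b hb => ?_
        obtain ⟨n, hn⟩ := hb.exists
        exact hn.trans (hC _ (hupos n))

theorem IsHardyCont.memLp {f : ℂ → ℂ} (hf : IsHardyCont f) :
    MemLp (fun x : ℝ => f x) 2 volume := by
  refine ⟨hf.continuous_line.aestronglyMeasurable, ?_⟩
  obtain ⟨C, hC⟩ := hf.lintegral_line_le
  rw [lintegral_sq_eq] at hC
  by_contra h
  rw [not_lt, top_le_iff] at h
  rw [h] at hC
  simp at hC

theorem IsHardyCont.integrable_sq {f : ℂ → ℂ} (hf : IsHardyCont f) :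
    Integrable fun x : ℝ => ‖f x‖ ^ 2 :=
  (memLp_two_iff_integrable_sq_norm hf.continuous_line.aestronglyMeasurable).1 hf.memLp

theorem norm_sub_sq_of_real (x : ℝ) (w : ℂ) : ‖(x : ℂ) - w‖ ^ 2 = (x - w.re) ^ 2 + w.im ^ 2 := by
  rw [Complex.sq_norm, Complex.normSq_apply]; simp; ring

theorem memLp_inv_sub {w : ℂ} (hw : w.im ≠ 0) : MemLp (fun x : ℝ => ((x : ℂ) - w)⁻¹) 2 volume := by
  have hne : ∀ x : ℝ, (x : ℂ) - w ≠ 0 := fun x h => hw (by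
    rw [← sub_eq_zero.1 h]; simp)
  have hcont : Continuous fun x : ℝ => ((x : ℂ) - w)⁻¹ :=
    Continuous.inv₀ (by fun_prop) hne
  rw [memLp_two_iff_integrable_sq_norm hcont.aestronglyMeasurable]
  have := integrable_inv_sub_sq_add_sq w.re (abs_pos.2 hw)
  refine this.congr (.of_forall fun x => ?_)
  simp [norm_sub_sq_of_real]

theorem IsHardyCont.integrable_div {f : ℂ → ℂ} (hf : IsHardyCont f) {w : ℂ} (hw : w.im ≠ 0) :
    Integrable fun x : ℝ => f x / (x - w) := by
  simp_rw [div_eq_mul_inv]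
  exact hf.memLp.integrable_mul (memLp_inv_sub hw)

/-- The Cauchy integral of an `H²` function vanishes in the lower half-plane. -/
theorem IsHardyCont.integral_div_eq_zero {g : ℂ → ℂ} (hg : IsHardyCont g) {ζ : ℂ} (hζ : ζ.im < 0) :
    ∫ x : ℝ, g x / (x - ζ) = 0 := by
  obtain ⟨hd, C, hC⟩ := hg.hardy
  have hne : ∀ z : ℂ, 0 ≤ z.im → z - ζ ≠ 0 := fun z hz h => by
    rw [sub_eq_zero.1 h] at hz; linarith
  -- With `s = y - Im ζ`, the weighted inequality `|g|/|z - ζ| ≤ |g|²/(2√s) + (√s/2)|z - ζ|⁻²` and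
  -- `∫ |z - ζ|⁻² = π/s` give an `L¹` bound of order `s^(-1/2)`, which tends to zero.
  refine integral_real_eq_zero (f := fun z => g z / (z - ζ))
    (N := fun y => (C + Real.pi) / 2 / √(y - ζ.im)) (C := (C + Real.pi) / 2 / √(- ζ.im))
    (hg.cont.div (by fun_prop) fun z hz => hne z hz)
    (hd.div (by fun_prop) fun z hz => hne z (le_of_lt hz))
    (hg.integrable_div hζ.ne) ?_ ?_ ?_
  · intro y hy
    set s := y - ζ.im with hs
    have hs0 : 0 < s := by linarith
    have hsq : 0 < √s := Real.sqrt_pos.2 hs0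
    have hss : √s * √s = s := Real.mul_self_sqrt hs0.le
    have hpt : ∀ x : ℝ, ‖g (x + y * Complex.I) / (x + y * Complex.I - ζ)‖ₑ ≤
        ENNReal.ofReal (1 / (2 * √s)) * ‖g (x + y * Complex.I)‖ₑ ^ 2 +
          ENNReal.ofReal (√s / 2) * ENNReal.ofReal ((x - ζ.re) ^ 2 + s ^ 2)⁻¹ := by
      intro x
      set z : ℂ := x + y * Complex.I
      have hz : ‖z - ζ‖ ^ 2 = (x - ζ.re) ^ 2 + s ^ 2 := by
        rw [Complex.sq_norm, Complex.normSq_apply]; simp [z]; ring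
      rw [← hz, ← ofReal_norm, ← ofReal_norm, ← ENNReal.ofReal_pow (norm_nonneg _),
        ← ENNReal.ofReal_mul (by positivity), ← ENNReal.ofReal_mul (by positivity),
        ← ENNReal.ofReal_add (by positivity) (by positivity)]
      refine ENNReal.ofReal_le_ofReal ?_
      rw [norm_div, div_eq_mul_inv, ← inv_pow]
      have h0 := sq_nonneg (‖g z‖ - √s * ‖z - ζ‖⁻¹)
      have : 1 / (2 * √s) * ‖g z‖ ^ 2 + √s / 2 * ‖z - ζ‖⁻¹ ^ 2 - ‖g z‖ * ‖z - ζ‖⁻¹ =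
          1 / (2 * √s) * (‖g z‖ - √s * ‖z - ζ‖⁻¹) ^ 2 := by
        field_simp
        ring
      have h1 : 0 ≤ 1 / (2 * √s) * (‖g z‖ - √s * ‖z - ζ‖⁻¹) ^ 2 := by positivity
      linarith
    refine (lintegral_mono hpt).trans ?_
    rw [lintegral_add_left' (((IsHardy.aesm hd hy).enorm.pow_const 2).const_mul _),
      lintegral_const_mul' _ _ ENNReal.ofReal_ne_top,
      lintegral_const_mul' _ _ ENNReal.ofReal_ne_top, lintegral_inv_sub_sq_add_sq _ hs0]
    calc _ ≤ ENNReal.ofReal (1 / (2 * √s)) * C + ENNReal.ofReal (√s / 2) *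
          ENNReal.ofReal (Real.pi / s) := by
          gcongr
          exact hC y hy
      _ = _ := by
          rw [show (C : ENNReal) = ENNReal.ofReal (C : ℝ) by simp,
            ← ENNReal.ofReal_mul (by positivity), ← ENNReal.ofReal_mul (by positivity),
            ← ENNReal.ofReal_add (by positivity) (by positivity)]
          congr 1
          have : √s / 2 * (Real.pi / s) = Real.pi / (2 * √s) := by
            rw [div_mul_div_comm, div_eq_div_iff (by positivity) (by positivity)]
            linear_combination 2 * Real.pi * hss
          rw [this]
          field_simp
  · intro y hy
    have : 0 < √(-ζ.im) := Real.sqrt_pos.2 (by linarith)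
    have h2 := Real.pi_pos
    gcongr
    linarith
  · refine Tendsto.const_div_atTop ?_ _
    exact Real.tendsto_sqrt_atTop.comp (tendsto_atTop_add_const_right _ _ tendsto_id)

/-- If `f` and `(z - w) f` are `H²` functions, then `∫ f = 0`. -/
theorem IsHardyCont.integral_eq_zero {f h : ℂ → ℂ} (hf : IsHardyCont f) (hh : IsHardyCont h)
    (w : ℂ) (hfh : ∀ z : ℂ, 0 ≤ z.im → (z - w) * f z = h z) :
    (Integrable fun x : ℝ => f x) ∧ ∫ x : ℝ, f x = 0 := by
  -- This function equals `(z + i) f`, so `f` is an `H²` function divided by `z + i`, and the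
  -- vanishing Cauchy integral at `-i` applies.
  have hg : IsHardyCont fun z => h z + (w + Complex.I) * f z := hh.add (hf.const_mul _)
  have heq : (fun x : ℝ => (h x + (w + Complex.I) * f x) / (x - (-Complex.I))) =
      fun x : ℝ => f x := by
    funext x
    have : (x : ℂ) - (-Complex.I) ≠ 0 := fun h => by
      have := congrArg Complex.im h
      simp at this
    rw [div_eq_iff this, ← hfh x (by simp)]
    ring
  have h1 := hg.integrable_div (w := -Complex.I) (by simp)
  have h2 := hg.integral_div_eq_zero (ζ := -Complex.I) (by simp)
  simp only [heq] at h1 h2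
  exact ⟨h1, h2⟩

theorem ofReal_sub_ne {w : ℂ} (hw : w.im ≠ 0) (x : ℝ) : (x : ℂ) - w ≠ 0 := fun h => hw (by
  rw [← sub_eq_zero.1 h]; simp)

theorem sub_mul_sub_conj (x : ℝ) (w : ℂ) :
    ((x : ℂ) - w) * (x - conj w) = (((x - w.re) ^ 2 + w.im ^ 2 : ℝ) : ℂ) := by
  rw [← norm_sub_sq_of_real, ← Complex.normSq_eq_norm_sq, ← Complex.mul_conj]
  simp

/-- The Poisson formula. -/
theorem IsHardyCont.poisson {f : ℂ → ℂ} (hf : IsHardyCont f) {w : ℂ} (hw : 0 < w.im) :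
    ∫ x : ℝ, f x * (((x - w.re) ^ 2 + w.im ^ 2)⁻¹ : ℝ) = f w * (Real.pi / w.im : ℝ) := by
  have hopen : IsOpen {z : ℂ | 0 < z.im} := isOpen_lt continuous_const Complex.continuous_im
  have hnhds : {z : ℂ | 0 < z.im} ∈ 𝓝 w := hopen.mem_nhds hw
  have hsub : {z : ℂ | 0 < z.im} ⊆ {z | 0 ≤ z.im} := fun z (hz : 0 < z.im) => hz.le
  have hd := hf.hardy.1
  have hgc : ContinuousOn (dslope f w) {z | 0 ≤ z.im} :=
    (continuousOn_dslope (mem_of_superset hnhds hsub)).2 ⟨hf.cont, hd.differentiableAt hnhds⟩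
  -- The divided difference `(f(z) - f(w))/(z - w)` is again in `H²`. Its Cauchy integral at `conj
  -- w` vanishes, and the product of the two denominators is the Poisson denominator.
  have hg : IsHardyCont (dslope f w) := by
    refine ⟨isHardy_of_norm_mul_le hgc ((Complex.differentiableOn_dslope hnhds).2 hd) hf.hardy w
      ‖f w‖ fun z _ => ?_, hgc⟩
    rw [← norm_mul, mul_comm, ← smul_eq_mul, sub_smul_dslope]
    exact norm_sub_le _ _
  have h0 := hg.integral_div_eq_zero (ζ := conj w) (by simpa using hw)
  have heq : ∀ x : ℝ, dslope f w x / (x - conj w) =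
      f x * (((x - w.re) ^ 2 + w.im ^ 2)⁻¹ : ℝ) - f w * (((x - w.re) ^ 2 + w.im ^ 2)⁻¹ : ℝ) := by
    intro x
    have h1 := ofReal_sub_ne hw.ne' x
    have h2 := ofReal_sub_ne (w := conj w) (by simpa using hw.ne') x
    rw [Complex.ofReal_inv, ← sub_mul_sub_conj, dslope_of_ne _ (sub_ne_zero.1 h1), slope_def_field]
    field_simp
  have hi1 : Integrable fun x : ℝ => f x * (((x - w.re) ^ 2 + w.im ^ 2)⁻¹ : ℝ) := by
    have := (hf.memLp.integrable_mul (memLp_inv_sub hw.ne')).bdd_mul (c := w.im⁻¹)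
      (f := fun x : ℝ => ((x : ℂ) - conj w)⁻¹)
      (memLp_inv_sub (w := conj w) (by simpa using hw.ne')).1 ?_
    · refine this.congr (.of_forall fun x => ?_)
      simp only [Pi.mul_apply]
      rw [Complex.ofReal_inv, ← sub_mul_sub_conj, mul_inv]
      ring
    · refine .of_forall fun x => ?_
      rw [norm_inv]
      refine inv_anti₀ hw ?_
      refine le_trans ?_ (Complex.abs_im_le_norm _)
      simp [abs_of_pos hw]
  have hi2 : Integrable fun x : ℝ => f w * (((x - w.re) ^ 2 + w.im ^ 2)⁻¹ : ℝ) :=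
    (integrable_inv_sub_sq_add_sq w.re hw).ofReal.const_mul _
  simp_rw [heq] at h0
  rw [integral_sub hi1 hi2, sub_eq_zero, integral_const_mul, integral_complex_ofReal,
    integral_inv_sub_sq_add_sq _ hw] at h0
  exact h0

/-- The Cauchy formula for the upper half-plane. -/
theorem IsHardyCont.cauchy {f : ℂ → ℂ} (hf : IsHardyCont f) {w : ℂ} (hw : 0 < w.im) :
    ∫ x : ℝ, f x / (x - w) = 2 * Real.pi * Complex.I * f w := by
  have h1 := hf.integral_div_eq_zero (ζ := conj w) (by simpa using hw)
  have h2 := hf.poisson hw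
  have hi1 := hf.integrable_div (w := w) hw.ne'
  have hi2 := hf.integrable_div (w := conj w) (by simpa using hw.ne')
  have heq : ∀ x : ℝ, f x / (x - w) - f x / (x - conj w) =
      (2 * w.im * Complex.I) * (f x * (((x - w.re) ^ 2 + w.im ^ 2)⁻¹ : ℝ)) := by
    intro x
    have h1 := ofReal_sub_ne hw.ne' x
    have h2 := ofReal_sub_ne (w := conj w) (by simpa using hw.ne') x
    have h3 : w - conj w = 2 * w.im * Complex.I := by
      rw [Complex.sub_conj]; push_cast; ring
    rw [Complex.ofReal_inv, ← sub_mul_sub_conj, ← h3]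
    field_simp
    ring
  have h3 := integral_sub hi1 hi2
  simp_rw [heq] at h3
  rw [integral_const_mul, h1, h2, sub_zero] at h3
  rw [← h3]
  have : (w.im : ℂ) ≠ 0 := by exact_mod_cast hw.ne'
  push_cast
  field_simp

/-- Poisson's formula followed by Jensen's inequality for the square. The latter comes from the
nonnegativity of the variance of `|f|` about its Poisson mean `c`. -/
theorem IsHardyCont.norm_sq_le {f : ℂ → ℂ} (hf : IsHardyCont f) {w : ℂ} (hw : 0 < w.im) :
    ‖f w‖ ^ 2 ≤ ∫ x : ℝ, ‖f x‖ ^ 2 * (w.im / Real.pi * ((x - w.re) ^ 2 + w.im ^ 2)⁻¹) := by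
  set k : ℝ → ℝ := fun x => ((x - w.re) ^ 2 + w.im ^ 2)⁻¹ with hk
  have hk0 : ∀ x, 0 < k x := fun x => by positivity
  have hkle : ∀ x, k x ≤ (w.im ^ 2)⁻¹ := fun x => by
    refine inv_anti₀ (by positivity) ?_
    nlinarith [sq_nonneg (x - w.re)]
  have hki : Integrable k := integrable_inv_sub_sq_add_sq w.re hw
  have hkc : Continuous k := Continuous.inv₀ (by fun_prop) fun x => (by positivity)
  have hi2 : Integrable fun x : ℝ => ‖f x‖ ^ 2 * k x := by
    refine hf.integrable_sq.mul_bdd (c := (w.im ^ 2)⁻¹) hkc.aestronglyMeasurable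
      (.of_forall fun x => ?_)
    rw [Real.norm_of_nonneg (hk0 x).le]
    exact hkle x
  have hi1 : Integrable fun x : ℝ => ‖f x‖ * k x := by
    refine (hi2.add hki).mono' (hf.continuous_line.norm.mul hkc).aestronglyMeasurable
      (.of_forall fun x => ?_)
    rw [norm_mul, norm_norm, Real.norm_of_nonneg (hk0 x).le, Pi.add_apply]
    nlinarith [mul_nonneg (sq_nonneg (‖f x‖ - 1)) (hk0 x).le, mul_nonneg (norm_nonneg (f x)) (hk0 x).le,
      mul_nonneg (sq_nonneg (‖f x‖)) (hk0 x).le, hk0 x]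
  set p := ∫ x : ℝ, ‖f x‖ * k x with hp
  have hle : ‖f w‖ * (Real.pi / w.im) ≤ p := by
    have h1 := norm_integral_le_integral_norm (μ := volume) fun x : ℝ => f x * (k x : ℝ)
    rw [hf.poisson hw, norm_mul, Complex.norm_real, Real.norm_of_nonneg (by positivity)] at h1
    refine h1.trans (le_of_eq (integral_congr_ae (.of_forall fun x => ?_)))
    simp [abs_of_pos (hk0 x)]
  set c := p * (w.im / Real.pi) with hc
  have hnn : 0 ≤ ∫ x : ℝ, (‖f x‖ - c) ^ 2 * k x :=
    integral_nonneg fun x => mul_nonneg (sq_nonneg _) (hk0 x).le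
  have heq : ∀ x : ℝ, (‖f x‖ - c) ^ 2 * k x =
      ‖f x‖ ^ 2 * k x - 2 * c * (‖f x‖ * k x) + c ^ 2 * k x := fun x => by ring
  simp_rw [heq] at hnn
  rw [integral_add (f := fun x : ℝ => ‖f x‖ ^ 2 * k x - 2 * c * (‖f x‖ * k x))
    (hi2.sub (hi1.const_mul _)) (hki.const_mul _), integral_sub hi2 (hi1.const_mul _),
    integral_const_mul, integral_const_mul, integral_inv_sub_sq_add_sq _ hw, ← hp] at hnn
  have hpc : p = c * (Real.pi / w.im) := by
    rw [hc]; field_simp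
  have hfc : ‖f w‖ ≤ c := by
    rw [hpc] at hle
    exact le_of_mul_le_mul_right hle (by positivity)
  have h2 : ‖f w‖ ^ 2 ≤ c ^ 2 := pow_le_pow_left₀ (norm_nonneg _) hfc 2
  have h3 : ∀ x : ℝ, ‖f x‖ ^ 2 * (w.im / Real.pi * k x) = w.im / Real.pi * (‖f x‖ ^ 2 * k x) :=
    fun x => by ring
  refine le_trans ?_ (le_of_eq (integral_congr_ae (.of_forall fun x => (h3 x).symm)))
  rw [integral_const_mul]
  have h4 : c ^ 2 * (Real.pi / w.im) ≤ ∫ x : ℝ, ‖f x‖ ^ 2 * k x := by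
    rw [hpc] at hnn
    nlinarith
  calc ‖f w‖ ^ 2 ≤ c ^ 2 := h2
    _ = w.im / Real.pi * (c ^ 2 * (Real.pi / w.im)) := by field_simp
    _ ≤ _ := mul_le_mul_of_nonneg_left h4 (by positivity)

/-- The Poisson kernel at `w` is at most `1/(π Im w)`. This is the source of the bounded point
evaluations on `H(E)`. -/
theorem IsHardyCont.norm_sq_le_integral {f : ℂ → ℂ} (hf : IsHardyCont f) {w : ℂ} (hw : 0 < w.im) :
    ‖f w‖ ^ 2 ≤ (Real.pi * w.im)⁻¹ * ∫ x : ℝ, ‖f x‖ ^ 2 := by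
  refine (hf.norm_sq_le hw).trans ?_
  rw [← integral_const_mul]
  refine integral_mono_of_nonneg (.of_forall fun x => by positivity)
    (hf.integrable_sq.const_mul _) (.of_forall fun x => ?_)
  have h : w.im / Real.pi * ((x - w.re) ^ 2 + w.im ^ 2)⁻¹ ≤ (Real.pi * w.im)⁻¹ := by
    rw [div_mul_eq_mul_div, div_le_iff₀ Real.pi_pos]
    have : ((x - w.re) ^ 2 + w.im ^ 2)⁻¹ ≤ (w.im ^ 2)⁻¹ :=
      inv_anti₀ (by positivity) (by nlinarith [sq_nonneg (x - w.re)])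
    calc _ ≤ w.im * (w.im ^ 2)⁻¹ := by gcongr
      _ = _ := by field_simp
  calc _ ≤ ‖f x‖ ^ 2 * (Real.pi * w.im)⁻¹ := by
        simp only
        gcongr
    _ = _ := mul_comm _ _

/-- The means of `|f|²` on horizontal lines are dominated by the mean on the real line. -/
theorem IsHardyCont.lintegral_le {f : ℂ → ℂ} (hf : IsHardyCont f) {y : ℝ} (hy : 0 < y) :
    ∫⁻ x : ℝ, ‖f (x + y * Complex.I)‖ₑ ^ 2 ≤ ∫⁻ t : ℝ, ‖f t‖ₑ ^ 2 := by
  have hpt : ∀ x : ℝ, ‖f (x + y * Complex.I)‖ₑ ^ 2 ≤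
      ∫⁻ t : ℝ, ‖f t‖ₑ ^ 2 * ENNReal.ofReal (y / Real.pi * ((x - t) ^ 2 + y ^ 2)⁻¹) := by
    intro x
    have h := hf.norm_sq_le (w := x + y * Complex.I) (by simpa using hy)
    rw [← ofReal_norm, ← ENNReal.ofReal_pow (norm_nonneg _)]
    refine (ENNReal.ofReal_le_ofReal h).trans ?_
    refine (Real.ofReal_le_enorm _).trans ((enorm_integral_le_lintegral_enorm _).trans (le_of_eq ?_))
    refine lintegral_congr fun t => ?_
    rw [enorm_mul, ← ofReal_norm, ← ofReal_norm, ← ofReal_norm, ← ENNReal.ofReal_pow (norm_nonneg _)]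
    congr 2
    · simp
    · rw [Real.norm_of_nonneg (by simp; positivity)]
      simp
      left
      ring
  refine (lintegral_mono hpt).trans ?_
  -- By Tonelli it remains to integrate the kernel in `x`; it depends on `x - t` only, so this
  -- integral is also one.
  rw [lintegral_lintegral_swap]
  · refine lintegral_mono fun t => ?_
    have hne : ‖f t‖ₑ ^ 2 ≠ ⊤ := by simp
    rw [lintegral_const_mul' _ _ hne]
    have : ∀ x : ℝ, ENNReal.ofReal (y / Real.pi * ((x - t) ^ 2 + y ^ 2)⁻¹) =
        ENNReal.ofReal (y / Real.pi) * ENNReal.ofReal (((x - t) ^ 2 + y ^ 2)⁻¹) := fun x =>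
      ENNReal.ofReal_mul (by positivity)
    simp_rw [this]
    rw [lintegral_const_mul' _ _ ENNReal.ofReal_ne_top, lintegral_inv_sub_sq_add_sq _ hy,
      ← ENNReal.ofReal_mul (by positivity)]
    have : y / Real.pi * (Real.pi / y) = 1 := by field_simp
    rw [this]
    simp
  · have h1 : Measurable fun p : ℝ × ℝ => ‖f p.2‖ₑ ^ 2 :=
      ((hf.continuous_line.comp continuous_snd).enorm.measurable).pow_const 2
    have h2 : Measurable fun p : ℝ × ℝ =>
        ENNReal.ofReal (y / Real.pi * ((p.1 - p.2) ^ 2 + y ^ 2)⁻¹) := by fun_prop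
    exact (h1.mul h2).aemeasurable

/-! ### De Branges spaces -/

theorem starFun_ofReal (F : ℂ → ℂ) (t : ℝ) : starFun F t = conj (F t) := by
  simp [starFun]

theorem Differentiable.starFun {F : ℂ → ℂ} (hF : Differentiable ℂ F) :
    Differentiable ℂ (starFun F) := fun z => by
  have h := (hF (conj z)).conj_conj
  rw [Complex.conj_conj] at h
  exact h

/-- `dslope F w` serves throughout as the entire function `F/(z - w)`, with value `F'(w)` at the
removable singularity. -/
theorem exists_entire_sub_mul_eq {F : ℂ → ℂ} (hF : Differentiable ℂ F) {w : ℂ} (hw : F w = 0) :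
    Differentiable ℂ (dslope F w) ∧ ∀ z, (z - w) * dslope F w z = F z := by
  refine ⟨?_, fun z => ?_⟩
  · rw [← differentiableOn_univ, Complex.differentiableOn_dslope univ_mem, differentiableOn_univ]
    exact hF
  · rw [← smul_eq_mul, sub_smul_dslope, hw, sub_zero]

namespace HermiteBiehler

variable {E : HermiteBiehler}

theorem norm_starFun_le {z : ℂ} (hz : 0 ≤ z.im) : ‖starFun E.E z‖ ≤ ‖E.E z‖ := by
  rcases hz.lt_or_eq with h | h
  · exact (E.norm_lt z h).le
  · obtain ⟨x, rfl⟩ : ∃ x : ℝ, (x : ℂ) = z := ⟨z.re, Complex.ext (by simp) (by simp [h])⟩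
    rw [starFun_ofReal, RCLike.norm_conj]

theorem norm_A_div_le {z : ℂ} (hz : 0 ≤ z.im) : ‖E.A z / E.E z‖ ≤ 1 := by
  rw [norm_div, div_le_one (norm_pos_iff.2 (E.ne_zero z hz)), A, norm_div]
  have h1 := norm_add_le (E.E z) (starFun E.E z)
  have h2 := norm_starFun_le (E := E) hz
  simp only [Complex.norm_ofNat]
  linarith

theorem differentiable_A : Differentiable ℂ E.A := by
  have h : Differentiable ℂ fun z => (E.E z + starFun E.E z) / 2 :=
    (E.entire.add E.entire.starFun).div_const 2
  exact h

theorem starFun_A : starFun E.A = E.A := by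
  funext z
  simp [starFun, A, add_comm, map_ofNat]

theorem A_ne_zero {z : ℂ} (hz : z.im ≠ 0) : E.A z ≠ 0 := by
  have key : ∀ w : ℂ, 0 < w.im → E.A w ≠ 0 := by
    intro w hw h
    have h1 := E.norm_lt w hw
    have h2 : E.E w = -starFun E.E w := by
      rw [A] at h
      linear_combination 2 * h
    rw [h2, norm_neg] at h1
    exact lt_irrefl _ h1
  rcases lt_or_gt_of_ne hz with h | h
  · intro h0
    refine key (conj z) (by simpa using h) ?_
    rw [← starFun_A]
    simp [starFun, h0]
  · exact key z h

/-- Continuity up to the line is automatic, since `E` has no zeros in the closed upper half-plane.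
-/
theorem mem_space_iff {F : ℂ → ℂ} : F ∈ E.space ↔ Differentiable ℂ F ∧
    IsHardyCont (fun z => F z / E.E z) ∧ IsHardyCont fun z => starFun F z / E.E z := by
  have hE : ∀ G : ℂ → ℂ, Differentiable ℂ G → ContinuousOn (fun z => G z / E.E z) {z | 0 ≤ z.im} :=
    fun G hG => hG.continuous.continuousOn.div E.entire.continuous.continuousOn E.ne_zero
  exact ⟨fun h => ⟨h.1, ⟨h.2.1, hE _ h.1⟩, ⟨h.2.2, hE _ h.1.starFun⟩⟩,
    fun h => ⟨h.1, h.2.1.1, h.2.2.1⟩⟩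

theorem Space.hardy (F : E.Space) : IsHardyCont fun z => F.fn z / E.E z :=
  (mem_space_iff.1 F.fn_mem).2.1

theorem Space.hardy_star (F : E.Space) : IsHardyCont fun z => starFun F.fn z / E.E z :=
  (mem_space_iff.1 F.fn_mem).2.2

theorem Space.differentiable (F : E.Space) : Differentiable ℂ F.fn := F.fn_mem.1

/-- A member of the set `H(E)` as an element of the type. -/
def Space.of (F : ℂ → ℂ) (h : F ∈ E.space) : E.Space := (⟨F, h⟩ : E.space)

@[simp] theorem Space.fn_of (F : ℂ → ℂ) (h : F ∈ E.space) : (Space.of F h).fn = F := rfl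

@[simp] theorem Space.fn_sub (F G : E.Space) : (F - G).fn = F.fn - G.fn := rfl

@[simp] theorem Space.fn_neg (F : E.Space) : (-F).fn = -F.fn := rfl

theorem Space.ext {F G : E.Space} (h : ∀ z, F.fn z = G.fn z) : F = G :=
  Space.fn_injective (funext h)

/-- Division of elements of `H(E) + ℂ A` by `z - w`. -/
theorem mem_space_of_sub_mul_eq {K : ℂ → ℂ} (hK : Differentiable ℂ K) (H : E.Space) (q w : ℂ)
    (h : ∀ z, (z - w) * K z = H.fn z + q * E.A z) : K ∈ E.space := by
  have key : ∀ (K H : ℂ → ℂ) (q w : ℂ), Differentiable ℂ K → IsHardyCont (fun z => H z / E.E z) →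
      (∀ z, (z - w) * K z = H z + q * E.A z) → IsHardy fun z => K z / E.E z := by
    intro K H q w hK hH h
    refine isHardy_of_norm_mul_le (h := fun z => H z / E.E z) ?_ ?_ hH.1 w ‖q‖ fun z hz => ?_
    · exact hK.continuous.continuousOn.div E.entire.continuous.continuousOn E.ne_zero
    · exact hK.differentiableOn.div E.entire.differentiableOn
        fun z (hz : 0 < z.im) => E.ne_zero z hz.le
    · have : K z / E.E z * (z - w) = H z / E.E z + q * (E.A z / E.E z) := by
        rw [div_mul_eq_mul_div, mul_comm, h z]
        ring
      rw [← norm_mul, this]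
      refine (norm_add_le _ _).trans ?_
      rw [norm_mul q]
      gcongr
      -- `|A/E| ≤ 1` is why a multiple of `A` is harmless here, although `A` itself need not lie in
      -- `H(E)`.
      exact mul_le_of_le_one_right (norm_nonneg _) (norm_A_div_le hz.le)
  refine ⟨hK, key K H.fn q w hK H.hardy h,
    key (starFun K) (starFun H.fn) (conj q) (conj w) hK.starFun H.hardy_star fun z => ?_⟩
  have h1 := congrArg conj (h (conj z))
  have h2 : conj (E.A (conj z)) = E.A z := congrFun starFun_A z
  simpa [starFun, h2] using h1

/-- Multiplication by `z` modulo `A` is symmetric. -/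
theorem inner_mul_eq {K₁ K₂ H₁ H₂ : E.Space} {q₁ q₂ : ℂ}
    (h₁ : ∀ z, H₁.fn z = z * K₁.fn z + q₁ * E.A z) (h₂ : ∀ z, H₂.fn z = z * K₂.fn z + q₂ * E.A z) :
    inner ℂ K₂ H₁ = inner ℂ H₂ K₁ := by
  have hA : ∀ z, conj (E.A (conj z)) = E.A z := fun z => congrFun starFun_A z
  have hs₁ : ∀ z, starFun H₁.fn z = z * starFun K₁.fn z + conj q₁ * E.A z := by
    intro z
    have := h₁ (conj z)
    simp [starFun, this, hA]
  have hs₂ : ∀ z, starFun H₂.fn z = z * starFun K₂.fn z + conj q₂ * E.A z := by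
    intro z
    have := h₂ (conj z)
    simp [starFun, this, hA]
  -- On the line the factor `t` cancels in `H₁ conj K₂ - K₁ conj H₂`, leaving `A (q₁ conj K₂ - conj
  -- q₂ K₁)`, and `A/|E|² = (1/E + 1/conj E)/2`. The half with `1/E` is the boundary value of `(q₁
  -- K₂* - conj q₂ K₁)/E`. This function and its product with `z` are in `H²`, since the terms with
  -- `A` cancel, so its integral is zero. The other half is the conjugate of a function of the same
  -- kind.
  obtain ⟨hi, h0⟩ := IsHardyCont.integral_eq_zero
    (f := fun z => q₁ * (starFun K₂.fn z / E.E z) + -conj q₂ * (K₁.fn z / E.E z))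
    (h := fun z => q₁ * (starFun H₂.fn z / E.E z) + -conj q₂ * (H₁.fn z / E.E z))
    ((K₂.hardy_star.const_mul _).add (K₁.hardy.const_mul _))
    ((H₂.hardy_star.const_mul _).add (H₁.hardy.const_mul _)) 0 (fun z _ => by
      rw [hs₂, h₁]
      ring)
  obtain ⟨hi', h0'⟩ := IsHardyCont.integral_eq_zero
    (f := fun z => conj q₁ * (K₂.fn z / E.E z) + -q₂ * (starFun K₁.fn z / E.E z))
    (h := fun z => conj q₁ * (H₂.fn z / E.E z) + -q₂ * (starFun H₁.fn z / E.E z))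
    ((K₂.hardy.const_mul _).add (K₁.hardy_star.const_mul _))
    ((H₂.hardy.const_mul _).add (H₁.hardy_star.const_mul _)) 0 (fun z _ => by
      rw [hs₁, h₂]
      ring)
  rw [← sub_eq_zero, Space.inner_def, Space.inner_def,
    ← integral_sub (Space.integrable_integrand _ _) (Space.integrable_integrand _ _)]
  have h0c : ∫ x : ℝ, conj (conj q₁ * (K₂.fn x / E.E x) + -q₂ * (starFun K₁.fn x / E.E x)) = 0 := by
    rw [integral_conj, h0', map_zero]
  have hic : Integrable fun x : ℝ =>
      conj (conj q₁ * (K₂.fn x / E.E x) + -q₂ * (starFun K₁.fn x / E.E x)) :=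
    LinearIsometryEquiv.integrable_comp_iff (Complex.conjLIE) |>.2 hi'
  have hsum := integral_add hi hic
  rw [h0, h0c, add_zero] at hsum
  have : (0 : ℂ) = 1 / 2 * 0 := by ring
  rw [this, ← hsum, ← integral_const_mul]
  refine integral_congr_ae (.of_forall fun t => ?_)
  have hE : E.E t ≠ 0 := E.ne_zero t (by simp)
  have hE' : conj (E.E t) ≠ 0 := by simpa using hE
  have hAt : E.A t = (E.E t + conj (E.E t)) / 2 := by rw [A, starFun_ofReal]
  have hns : ((‖E.E t‖ ^ 2 : ℝ) : ℂ) = E.E t * conj (E.E t) := by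
    rw [Complex.mul_conj, Complex.normSq_eq_norm_sq]
  simp only [hns, h₁, h₂, hAt, starFun_ofReal, map_add, map_mul, map_neg, map_div₀,
    Complex.conj_conj, Complex.conj_ofReal, map_ofNat]
  field_simp
  ring

theorem Space.norm_sq_eq (F : E.Space) : ‖F‖ ^ 2 = ∫ t : ℝ, ‖F.fn t / E.E t‖ ^ 2 := by
  rw [@norm_sq_eq_re_inner ℂ, Space.inner_self]
  simp

/-- Point evaluations at the points of the upper half-plane are bounded. -/
theorem Space.norm_sq_fn_le (F : E.Space) {z : ℂ} (hz : 0 < z.im) :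
    ‖F.fn z‖ ^ 2 ≤ ‖E.E z‖ ^ 2 * (Real.pi * z.im)⁻¹ * ‖F‖ ^ 2 := by
  have h := F.hardy.norm_sq_le_integral hz
  rw [← F.norm_sq_eq] at h
  have hE : E.E z ≠ 0 := E.ne_zero z hz.le
  calc ‖F.fn z‖ ^ 2 = ‖E.E z‖ ^ 2 * ‖F.fn z / E.E z‖ ^ 2 := by
        rw [← mul_pow, ← norm_mul, mul_div_cancel₀ _ hE]
    _ ≤ _ := by
        rw [mul_assoc]
        gcongr

/-- The resolvent estimate for the selfadjoint realization of multiplication by `z`. -/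
theorem Space.norm_le_of_sub_mul_eq {K F : E.Space} {w q : ℂ} (hw : w.im ≠ 0)
    (h : ∀ z, (z - w) * K.fn z = F.fn z + q * E.A z) : ‖K‖ ≤ |w.im|⁻¹ * ‖F‖ := by
  have h1 : ∀ z, (F + w • K).fn z = z * K.fn z + (-q) * E.A z := fun z => by
    simp only [Space.fn_add, Space.fn_smul, Pi.add_apply, Pi.smul_apply, smul_eq_mul]
    linear_combination -h z
  have h2 := inner_mul_eq h1 h1
  have h3 : (inner ℂ K (F + w • K)).im = 0 := by
    have := congrArg Complex.im h2
    rw [← inner_conj_symm (F + w • K) K, Complex.conj_im] at this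
    linarith
  rw [inner_add_right, inner_smul_right, inner_self_eq_norm_sq_to_K] at h3
  have h4 : (inner ℂ K F).im = -(w.im * ‖K‖ ^ 2) := by
    simp [← Complex.ofReal_pow] at h3
    linarith
  have h5 : |w.im| * ‖K‖ ^ 2 ≤ ‖K‖ * ‖F‖ := by
    calc |w.im| * ‖K‖ ^ 2 = |(inner ℂ K F).im| := by rw [h4, abs_neg, abs_mul, abs_of_nonneg (sq_nonneg ‖K‖)]
      _ ≤ ‖inner ℂ K F‖ := Complex.abs_im_le_norm _
      _ ≤ _ := norm_inner_le_norm _ _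
  have hw' : 0 < |w.im| := abs_pos.2 hw
  rcases (norm_nonneg K).eq_or_lt with h6 | h6
  · rw [← h6]; positivity
  · rw [← div_eq_inv_mul, le_div_iff₀ hw']
    nlinarith

/-- For multiplication by `z` modulo `A`, the function `e = A/(z - t)` is an eigenvector with
eigenvalue `t`, while `F = (z - t) K` lies in the range of multiplication minus `t`. Symmetry makes
the two orthogonal. -/
theorem Space.inner_eq_zero_of_apply_eq_zero {e F : E.Space} {t : ℝ}
    (he : ∀ z, (z - t) * e.fn z = E.A z) (hF : F.fn t = 0) : inner ℂ e F = 0 := by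
  obtain ⟨hd, hK⟩ := exists_entire_sub_mul_eq F.differentiable hF
  set K : E.Space := Space.of _ (mem_space_of_sub_mul_eq hd F 0 t fun z => by rw [hK]; ring)
    with hKdef
  have h1 : ∀ z, (F + (t : ℂ) • K).fn z = z * K.fn z + 0 * E.A z := fun z => by
    simp only [Space.fn_add, Space.fn_smul, Pi.add_apply, Pi.smul_apply, smul_eq_mul, hKdef,
      Space.fn_of]
    linear_combination -hK z
  have h2 : ∀ z, ((t : ℂ) • e).fn z = z * e.fn z + (-1) * E.A z := fun z => by
    simp only [Space.fn_smul, Pi.smul_apply, smul_eq_mul]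
    linear_combination -he z
  have := inner_mul_eq h1 h2
  rw [inner_add_right, inner_smul_right, inner_smul_left, Complex.conj_ofReal] at this
  linear_combination this

variable (E) in
/-- The function `A / (z - t)` for a zero `t` of `A`, as an element of `H(E)`. -/
def zeroFn (t : ℝ) (ht : E.A t = 0) : E.Space :=
  Space.of (dslope E.A t) (mem_space_of_sub_mul_eq
    (exists_entire_sub_mul_eq differentiable_A ht).1 0 1 t fun z => by
      rw [(exists_entire_sub_mul_eq differentiable_A ht).2]; simp)

theorem zeroFn_mul (t : ℝ) (ht : E.A t = 0) (z : ℂ) : (z - t) * (E.zeroFn t ht).fn z = E.A z :=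
  (exists_entire_sub_mul_eq differentiable_A ht).2 z

theorem zeroFn_apply_of_ne {t s : ℝ} (ht : E.A t = 0) (hs : E.A s = 0) (hst : s ≠ t) :
    (E.zeroFn t ht).fn s = 0 := by
  have h := zeroFn_mul t ht s
  rw [hs] at h
  refine (mul_eq_zero.1 h).resolve_left ?_
  exact sub_ne_zero.2 (by exact_mod_cast hst)

theorem zeroFn_ne_zero (t : ℝ) (ht : E.A t = 0) : E.zeroFn t ht ≠ 0 := fun h => by
  have h1 := zeroFn_mul t ht Complex.I
  rw [h] at h1
  exact A_ne_zero (E := E) (z := Complex.I) (by simp) (by rw [← h1]; simp)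

/-- Otherwise `A/(z - t)` would be orthogonal to itself. Consequently the zeros of `A` are simple.
-/
theorem zeroFn_apply_self_ne_zero (t : ℝ) (ht : E.A t = 0) : (E.zeroFn t ht).fn t ≠ 0 := fun h =>
  zeroFn_ne_zero t ht (inner_self_eq_zero.1
    (Space.inner_eq_zero_of_apply_eq_zero (zeroFn_mul t ht) h))

theorem inner_zeroFn_of_ne {t s : ℝ} (ht : E.A t = 0) (hs : E.A s = 0) (hst : s ≠ t) :
    inner ℂ (E.zeroFn s hs) (E.zeroFn t ht) = 0 :=
  Space.inner_eq_zero_of_apply_eq_zero (zeroFn_mul s hs) (zeroFn_apply_of_ne ht hs hst)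

/-- `A/(z - t)` is a multiple of the reproducing kernel at `t`: subtracting the right multiple of it
from `F` leaves a function vanishing at `t`. -/
theorem inner_zeroFn (t : ℝ) (ht : E.A t = 0) (F : E.Space) : inner ℂ (E.zeroFn t ht) F =
    F.fn t / (E.zeroFn t ht).fn t * (‖E.zeroFn t ht‖ ^ 2 : ℝ) := by
  have h1 := Space.inner_eq_zero_of_apply_eq_zero (zeroFn_mul t ht)
    (F := F - (F.fn t / (E.zeroFn t ht).fn t) • E.zeroFn t ht) (by
      simp [div_mul_cancel₀ _ (zeroFn_apply_self_ne_zero t ht)])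
  rw [inner_sub_right, inner_smul_right, inner_self_eq_norm_sq_to_K] at h1
  rw [sub_eq_zero.1 h1]
  simp

end HermiteBiehler

/-- An entire function bounded by `C / |Im w|` vanishes. -/
theorem eq_zero_of_norm_mul_abs_im_le {h : ℂ → ℂ} (hh : Differentiable ℂ h) {C : ℝ}
    (hC : ∀ w : ℂ, w.im ≠ 0 → ‖h w‖ * |w.im| ≤ C) (w : ℂ) : h w = 0 := by
  have hC0 : 0 ≤ C := le_trans (by positivity) (hC Complex.I (by simp))
  have key : ∀ R : ℝ, ‖w‖ < R → ‖h w‖ * (R ^ 2 - ‖w‖ ^ 2) ≤ 2 * R * C := by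
    intro R hR
    have hR0 : 0 < R := (norm_nonneg w).trans_lt hR
    -- On `|z| = R` one has `z² - R² = 2i z Im z`, and this factor absorbs the blow-up of the bound
    -- at the real axis. The maximum principle then yields `|h(w)| = O(1/R)`.
    have hb : ‖h w * (w ^ 2 - (R : ℂ) ^ 2)‖ ≤ 2 * R * C := by
      refine Complex.norm_le_of_forall_mem_frontier_norm_le (f := fun z => h z * (z ^ 2 - (R : ℂ) ^ 2))
        (U := Metric.ball 0 R) Metric.isBounded_ball ?_ ?_ ?_
      · exact (hh.mul (by fun_prop)).diffContOnCl
      · intro z hz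
        rw [frontier_ball _ hR0.ne', mem_sphere_zero_iff_norm] at hz
        have hzz : z * conj z = (R : ℂ) ^ 2 := by
          rw [Complex.mul_conj, Complex.normSq_eq_norm_sq, hz]; push_cast; rfl
        have h1 : z ^ 2 - (R : ℂ) ^ 2 = z * (2 * z.im * Complex.I) := by
          rw [← hzz]
          have := Complex.sub_conj z
          push_cast at this
          linear_combination z * this
        rw [h1, norm_mul, norm_mul, hz]
        have h2 : ‖(2 * z.im * Complex.I : ℂ)‖ = 2 * |z.im| := by simp
        rw [h2]
        by_cases h3 : z.im = 0
        · simp [h3]; positivity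
        · have := hC z h3
          nlinarith
      · exact subset_closure (by simpa using hR)
    refine le_trans ?_ hb
    rw [norm_mul]
    gcongr
    have := norm_sub_norm_le ((R : ℂ) ^ 2) (w ^ 2)
    rw [norm_sub_rev] at this
    simpa using this
  by_contra hne
  have hpos : 0 < ‖h w‖ := norm_pos_iff.2 hne
  have h1 := key (2 * ‖w‖ + 1 + 4 * C / ‖h w‖) (by
    have : 0 ≤ 4 * C / ‖h w‖ := by positivity
    linarith [norm_nonneg w])
  set D := 4 * C / ‖h w‖ with hD
  have hD0 : 0 ≤ D := by positivity
  have hDC : ‖h w‖ * D = 4 * C := by rw [hD]; field_simp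
  set r := ‖w‖
  have hr : 0 ≤ r := norm_nonneg w
  have h2 : 2 * (2 * r + 1 + D) * C * 2 ≤ ‖h w‖ * ((2 * r + 1 + D) * D) := by
    rw [show ‖h w‖ * ((2 * r + 1 + D) * D) = (2 * r + 1 + D) * (‖h w‖ * D) by ring, hDC]
    linarith
  nlinarith [mul_nonneg hr hD0, mul_pos hpos (show 0 < 2 * r + 1 + D by positivity),
    mul_nonneg (mul_pos hpos (show 0 < 2 * r + 1 + D by positivity)).le hr]

/-! ### The zeros of `A` as a uniqueness set -/

namespace HermiteBiehler

variable {E : HermiteBiehler}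

/-- At a zero of `A` the l'Hôpital value removes the singularity: nearby, `Q` is the quotient of the
two divided differences, whose denominator does not vanish there. -/
theorem differentiable_of_zeros {F A Q : ℂ → ℂ} (hF : Differentiable ℂ F) (hA : Differentiable ℂ A)
    (hsimple : ∀ z, A z = 0 → deriv A z ≠ 0) (hFA : ∀ z, A z = 0 → F z = 0)
    (hQ : ∀ z, Q z = if A z = 0 then deriv F z / deriv A z else F z / A z) :
    Differentiable ℂ Q := by
  intro w
  by_cases hw : A w = 0
  · obtain ⟨hd1, h1⟩ := exists_entire_sub_mul_eq hF (hFA w hw)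
    obtain ⟨hd2, h2⟩ := exists_entire_sub_mul_eq hA hw
    have hne : dslope A w w ≠ 0 := by rw [dslope_same]; exact hsimple w hw
    have hev : Q =ᶠ[𝓝 w] fun z => dslope F w z / dslope A w z := by
      filter_upwards [hd2.continuous.continuousAt.eventually_ne hne] with z hz
      rcases eq_or_ne z w with rfl | hzw
      · rw [hQ, if_pos hw, dslope_same, dslope_same]
      · have hz0 : z - w ≠ 0 := sub_ne_zero.2 hzw
        rw [hQ, ← h1 z, ← h2 z, if_neg (mul_ne_zero hz0 hz), mul_div_mul_left _ _ hz0]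
    exact ((hd1 w).div (hd2 w) hne).congr_of_eventuallyEq hev
  · have hev : Q =ᶠ[𝓝 w] fun z => F z / A z := by
      filter_upwards [hA.continuous.continuousAt.eventually_ne hw] with z hz
      rw [hQ, if_neg hz]
    exact ((hF w).div (hA w) hw).congr_of_eventuallyEq hev

theorem exists_ofReal_of_A_eq_zero {z : ℂ} (hz : E.A z = 0) : ∃ t : ℝ, (t : ℂ) = z := by
  have : z.im = 0 := by
    by_contra h
    exact A_ne_zero h hz
  exact ⟨z.re, Complex.ext (by simp) (by simp [this])⟩

theorem deriv_A_ne_zero {z : ℂ} (hz : E.A z = 0) : deriv E.A z ≠ 0 := by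
  obtain ⟨t, rfl⟩ := exists_ofReal_of_A_eq_zero hz
  have := zeroFn_apply_self_ne_zero t hz
  rwa [zeroFn, Space.fn_of, dslope_same] at this

open Classical in
/-- If `A ∉ H(E)`, then the zero set of `A` is a uniqueness set for `H(E)`. -/
theorem Space.eq_zero_of_forall_zero (hA : E.A ∉ E.space) (F : E.Space)
    (hF : ∀ t : ℝ, E.A t = 0 → F.fn t = 0) : F = 0 := by
  have hFA : ∀ z, E.A z = 0 → F.fn z = 0 := fun z hz => by
    obtain ⟨t, rfl⟩ := exists_ofReal_of_A_eq_zero hz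
    exact hF t hz
  set Q : ℂ → ℂ := fun z => if E.A z = 0 then deriv F.fn z / deriv E.A z else F.fn z / E.A z
    with hQdef
  have hQ : Differentiable ℂ Q := differentiable_of_zeros F.differentiable differentiable_A
    (fun z hz => deriv_A_ne_zero hz) hFA fun z => rfl
  have hQA : ∀ z, Q z * E.A z = F.fn z := by
    intro z
    simp only [hQdef]
    split_ifs with h
    · rw [h, mul_zero, hFA z h]
    · rw [div_mul_cancel₀ _ h]
  have hI : (0 : ℝ) < Complex.I.im := by simp
  have hdQ : ∀ w, Differentiable ℂ (dslope Q w) := fun w => by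
    rw [← differentiableOn_univ, Complex.differentiableOn_dslope univ_mem, differentiableOn_univ]
    exact hQ
  have hsub : ∀ w z, (z - w) * dslope Q w z = Q z - Q w := fun w z => by
    rw [← smul_eq_mul, sub_smul_dslope]
  -- With `Q = F/A`, the function `A (Q - Q(w))/(z - w)` is the resolvent at `w` applied to `F`, so
  -- its norm is at most `‖F‖/|Im w|`.
  have hmem : ∀ w z, (z - w) * (E.A z * dslope Q w z) = F.fn z + (-Q w) * E.A z := fun w z => by
    linear_combination E.A z * hsub w z + hQA z
  have hbound : ∃ C : ℝ, ∀ w : ℂ, w.im ≠ 0 → ‖dslope Q Complex.I w‖ * |w.im| ≤ C := by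
    set c : ℝ := √(‖E.E Complex.I‖ ^ 2 * (Real.pi * Complex.I.im)⁻¹) with hc
    refine ⟨‖E.A Complex.I‖⁻¹ * (c * ‖F‖), fun w hw => ?_⟩
    set K : E.Space := Space.of _ (mem_space_of_sub_mul_eq (differentiable_A.mul (hdQ w)) F _ w
      (hmem w)) with hK
    have h1 : ‖K‖ ≤ |w.im|⁻¹ * ‖F‖ := Space.norm_le_of_sub_mul_eq hw (hmem w)
    have h2 : ‖K.fn Complex.I‖ ≤ c * ‖K‖ := by
      have := K.norm_sq_fn_le hI
      refine abs_le_of_sq_le_sq' ?_ (by positivity) |>.2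
      rw [mul_pow, hc, Real.sq_sqrt (by positivity)]
      exact this
    -- Symmetry of the divided difference turns evaluation at `i` into a bound for an entire
    -- function of `w`. The Liouville-type lemma then makes `Q` constant, so `F` is a multiple of
    -- `A`.
    have hsym : dslope Q w Complex.I = dslope Q Complex.I w := by
      rcases eq_or_ne w Complex.I with rfl | hne
      · rfl
      · rw [dslope_of_ne _ hne, dslope_of_ne _ hne.symm, slope_comm]
    have h3 : K.fn Complex.I = E.A Complex.I * dslope Q Complex.I w := by
      rw [hK, Space.fn_of, ← hsym]; rfl
    rw [h3, norm_mul] at h2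
    have hAI : 0 < ‖E.A Complex.I‖ := norm_pos_iff.2 (A_ne_zero (by simp))
    have hw' : 0 < |w.im| := abs_pos.2 hw
    rw [← div_eq_inv_mul, le_div_iff₀ hAI]
    calc _ = ‖E.A Complex.I‖ * ‖dslope Q Complex.I w‖ * |w.im| := by ring
      _ ≤ c * ‖K‖ * |w.im| := by gcongr
      _ ≤ c * (|w.im|⁻¹ * ‖F‖) * |w.im| := by gcongr
      _ = c * ‖F‖ := by field_simp
  obtain ⟨C, hC⟩ := hbound
  have hzero := eq_zero_of_norm_mul_abs_im_le (hdQ Complex.I) hC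
  have hconst : ∀ z, Q z = Q Complex.I := fun z => by
    have := hsub Complex.I z
    rw [hzero, mul_zero] at this
    exact (sub_eq_zero.1 this.symm)
  have hFc : F.fn = Q Complex.I • E.A := by
    funext z
    rw [← hQA z, hconst z]; rfl
  by_cases hq : Q Complex.I = 0
  · exact Space.fn_injective (by rw [hFc, hq, zero_smul, Space.fn_zero])
  · exfalso
    refine hA ?_
    have : E.A = (Q Complex.I)⁻¹ • F.fn := by
      rw [hFc, smul_smul, inv_mul_cancel₀ hq, one_smul]
    rw [this]
    exact E.space.smul_mem _ F.fn_mem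

end HermiteBiehler

/-! ### Discrete measures -/

namespace DiscreteMeasure

variable {ι : Type} (d : DiscreteMeasure ι)

theorem finite_abs_lt (R : ℝ) : {n | |d.t n| < R}.Finite := by
  have := d.tendsto.eventually_ge_atTop R
  rw [eventually_cofinite] at this
  simpa using this

theorem countable (d : DiscreteMeasure ι) : Countable ι := by
  rw [← Set.countable_univ_iff]
  have : (Set.univ : Set ι) = ⋃ k : ℕ, {n | |d.t n| < k} := by
    ext n
    simpa using exists_nat_gt |d.t n|
  rw [this]
  exact Set.countable_iUnion fun k => (d.finite_abs_lt k).countable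

theorem exists_pos_le_abs : ∃ δ : ℝ, 0 < δ ∧ ∀ n, δ ≤ |d.t n| := by
  have hfin := d.finite_abs_lt 1
  by_cases hne : hfin.toFinset.Nonempty
  · obtain ⟨m, _, hm⟩ := hfin.toFinset.exists_min_image (fun n => |d.t n|) hne
    refine ⟨min 1 |d.t m|, lt_min one_pos (abs_pos.2 (d.ne_zero m)), fun n => ?_⟩
    by_cases hn : |d.t n| < 1
    · exact (min_le_right _ _).trans (hm n (by simpa using hn))
    · exact (min_le_left _ _).trans (not_lt.1 hn)
  · refine ⟨1, one_pos, fun n => not_lt.1 fun hn => hne ⟨n, by simpa using hn⟩⟩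

theorem lintegral_eq (f : ℝ → ENNReal) :
    ∫⁻ x, f x ∂d.measure = ∑' n, ENNReal.ofReal (d.mass n) * f (d.t n) := by
  rw [measure, lintegral_sum_measure]
  refine tsum_congr fun n => ?_
  rw [lintegral_smul_measure, lintegral_dirac, smul_eq_mul]

/-- All masses are positive and the family is countable, so null sets are exactly the sets missing
every `t n`; no measurability of `p` is needed. -/
theorem ae_iff {p : ℝ → Prop} : (∀ᵐ x ∂d.measure, p x) ↔ ∀ n, p (d.t n) := by
  have := d.countable
  rw [measure, Measure.ae_sum_iff]
  refine forall_congr' fun n => ?_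
  rw [Measure.ae_ennreal_smul_measure_iff (by simpa using d.mass_pos n), ae_dirac_eq]
  rfl

theorem aestronglyMeasurable (f : ℝ → ℂ) : AEStronglyMeasurable f d.measure := by
  have := d.countable
  rw [measure, aestronglyMeasurable_sum_measure_iff]
  intro n
  exact aestronglyMeasurable_dirac.smul_measure _

theorem integrable_iff {f : ℝ → ℂ} :
    Integrable f d.measure ↔ Summable fun n => d.mass n * ‖f (d.t n)‖ := by
  have h : ∫⁻ x, ‖f x‖ₑ ∂d.measure = ∑' n, ENNReal.ofReal (d.mass n * ‖f (d.t n)‖) := by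
    rw [d.lintegral_eq]
    refine tsum_congr fun n => ?_
    rw [ENNReal.ofReal_mul (d.mass_pos n).le, ofReal_norm]
  have hnn : ∀ n, 0 ≤ d.mass n * ‖f (d.t n)‖ := fun n =>
    mul_nonneg (d.mass_pos n).le (norm_nonneg _)
  rw [Integrable, and_iff_right (d.aestronglyMeasurable f), hasFiniteIntegral_iff_enorm, h]
  constructor
  · intro hs
    have := ENNReal.summable_toReal hs.ne
    simpa [ENNReal.toReal_ofReal (hnn _)] using this
  · intro hs
    rw [← ENNReal.ofReal_tsum_of_nonneg hnn hs]
    exact ENNReal.ofReal_lt_top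

theorem hasSum_integral {f : ℝ → ℂ} (hf : Integrable f d.measure) :
    HasSum (fun n => (d.mass n : ℂ) * f (d.t n)) (∫ x, f x ∂d.measure) := by
  have h := hasSum_integral_measure (μ := fun n => ENNReal.ofReal (d.mass n) • Measure.dirac (d.t n)) hf
  refine h.congr_fun fun n => ?_
  simp [integral_smul_measure, (d.mass_pos n).le]

theorem memLp_two_iff {f : ℝ → ℂ} :
    MemLp f 2 d.measure ↔ Summable fun n => d.mass n * ‖f (d.t n)‖ ^ 2 := by
  have h1 : MemLp f 2 d.measure ↔ Integrable (fun x => f x * conj (f x)) d.measure := by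
    rw [memLp_two_iff_integrable_sq_norm (d.aestronglyMeasurable f),
      ← integrable_norm_iff (d.aestronglyMeasurable _)]
    refine integrable_congr (.of_forall fun x => ?_)
    simp [sq]
  rw [h1, d.integrable_iff]
  simp [sq]

theorem hasSum_norm_sq (f : Lp ℂ 2 d.measure) :
    HasSum (fun n => d.mass n * ‖f (d.t n)‖ ^ 2) (‖f‖ ^ 2) := by
  have h := d.hasSum_integral (L2.integrable_inner (𝕜 := ℂ) f f)
  rw [← L2.inner_def, inner_self_eq_norm_sq_to_K] at h
  have h2 := Complex.hasSum_re h
  simp only [inner_self_eq_norm_sq_to_K] at h2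
  simpa [← Complex.ofReal_pow] using h2

/-- Mittag-Leffler type expansions `A ∑ cₙ / (z - tₙ)` over zeros `tₙ` of an entire `A`. -/
theorem mittagLeffler {A : ℂ → ℂ} (hA : Differentiable ℂ A) (hz : ∀ n, A (d.t n) = 0) {c : ι → ℂ}
    (hc : Summable fun n => ‖c n‖ / |d.t n|) :
    (∀ z, Summable fun n => c n * dslope A (d.t n) z) ∧
      Differentiable ℂ fun z => ∑' n, c n * dslope A (d.t n) z := by
  have key : ∀ R : ℝ, 0 < R → ∃ u : ι → ℝ, Summable u ∧
      ∀ n, ∀ z ∈ Metric.ball (0 : ℂ) R, ‖c n * dslope A (d.t n) z‖ ≤ u n := by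
    intro R hR
    have hcomp : IsCompact (Metric.closedBall (0 : ℂ) R) := isCompact_closedBall 0 R
    obtain ⟨M, hM⟩ := hcomp.exists_bound_of_continuousOn hA.continuous.continuousOn
    have hfn : ∀ n, ∃ C : ℝ, ∀ z ∈ Metric.closedBall (0 : ℂ) R, ‖dslope A (d.t n) z‖ ≤ C :=
      fun n => hcomp.exists_bound_of_continuousOn
        (exists_entire_sub_mul_eq hA (hz n)).1.continuous.continuousOn
    choose C hC using hfn
    classical
    -- Finitely many points have `|t_n| < 2R`, and compactness bounds their terms. For the others
    -- `|z - t_n| ≥ |t_n|/2` on the ball.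
    refine ⟨fun n => if |d.t n| < 2 * R then ‖c n‖ * C n else 2 * M * (‖c n‖ / |d.t n|), ?_, ?_⟩
    · refine (hc.mul_left (2 * M)).congr_cofinite ?_
      rw [Filter.EventuallyEq, eventually_cofinite]
      refine (d.finite_abs_lt (2 * R)).subset fun n hn => ?_
      by_contra h
      have h' : ¬ |d.t n| < 2 * R := h
      simp [h'] at hn
    · intro n z hzR
      have hzc := Metric.ball_subset_closedBall hzR
      rw [norm_mul]
      beta_reduce
      split_ifs with h
      · gcongr
        exact hC n z hzc
      · have h1 := (exists_entire_sub_mul_eq hA (hz n)).2 z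
        have h2 : |d.t n| / 2 ≤ ‖z - d.t n‖ := by
          have := norm_sub_norm_le (d.t n : ℂ) z
          rw [norm_sub_rev, Complex.norm_real, Real.norm_eq_abs] at this
          have h3 : ‖z‖ < R := by simpa using hzR
          linarith [not_lt.1 h]
        have ht : 0 < |d.t n| := abs_pos.2 (d.ne_zero n)
        have h4 : |d.t n| / 2 * ‖dslope A (d.t n) z‖ ≤ M := by
          calc _ ≤ ‖z - d.t n‖ * ‖dslope A (d.t n) z‖ := by gcongr
            _ = ‖A z‖ := by rw [← norm_mul, h1]
            _ ≤ M := hM z hzc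
        have h5 : ‖dslope A (d.t n) z‖ ≤ 2 * M / |d.t n| := by
          rw [le_div_iff₀ ht]; linarith
        calc ‖c n‖ * ‖dslope A (d.t n) z‖ ≤ ‖c n‖ * (2 * M / |d.t n|) := by gcongr
          _ = _ := by ring
  have hd : ∀ n, Differentiable ℂ fun z => c n * dslope A (d.t n) z := fun n =>
    (exists_entire_sub_mul_eq hA (hz n)).1.const_mul _
  refine ⟨fun z => ?_, fun z => ?_⟩
  · obtain ⟨u, hu, hle⟩ := key (‖z‖ + 1) (by positivity)
    exact Summable.of_norm_bounded hu fun n => hle n z (by simp)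
  · obtain ⟨u, hu, hle⟩ := key (‖z‖ + 1) (by positivity)
    have h := Complex.differentiableOn_tsum_of_summable_norm hu
      (fun n => (hd n).differentiableOn) Metric.isOpen_ball hle
    exact h.differentiableAt (Metric.isOpen_ball.mem_nhds (by simp))

end DiscreteMeasure

/-! ### Sampling at the zeros of `A` -/

namespace HermiteBiehler

variable {E : HermiteBiehler}

theorem Space.lintegral_quot (F : E.Space) :
    ∫⁻ t : ℝ, ‖F.fn t / E.E t‖ₑ ^ 2 = ENNReal.ofReal (‖F‖ ^ 2) := by
  rw [F.norm_sq_eq, ofReal_integral_eq_lintegral_ofReal F.hardy.integrable_sq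
    (.of_forall fun t => by positivity)]
  refine lintegral_congr fun t => ?_
  rw [← ofReal_norm, ENNReal.ofReal_pow (norm_nonneg _)]

/-- A pointwise limit of a bounded sequence in `H(E)` that is entire belongs to `H(E)`. -/
theorem exists_norm_sq_le_of_tendsto {u : ℕ → E.Space} {F : ℂ → ℂ} (hF : Differentiable ℂ F)
    (hlim : ∀ z, Tendsto (fun k => (u k).fn z) atTop (𝓝 (F z))) {T : ℝ} (hT : ∀ k, ‖u k‖ ^ 2 ≤ T) :
    ∃ h : F ∈ E.space, ‖Space.of F h‖ ^ 2 ≤ T := by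
  have hT0 : 0 ≤ T := (sq_nonneg _).trans (hT 0)
  -- Fatou on each horizontal line. The means there are controlled by the norm on the real line, so
  -- one constant `T` serves every height `y`.
  have fatou : ∀ (G : ℂ → ℂ) (v : ℕ → ℂ → ℂ), (∀ k, IsHardyCont fun z => v k z / E.E z) →
      (∀ z, Tendsto (fun k => v k z) atTop (𝓝 (G z))) →
      (∀ k, ∫⁻ t : ℝ, ‖v k t / E.E t‖ₑ ^ 2 ≤ ENNReal.ofReal T) → ∀ y : ℝ, 0 ≤ y →
      ∫⁻ x : ℝ, ‖G (x + y * Complex.I) / E.E (x + y * Complex.I)‖ₑ ^ 2 ≤ ENNReal.ofReal T := by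
    intro G v hv hvG hvT y hy
    have hl : ∀ x : ℝ, Tendsto (fun k =>
        ‖v k (x + y * Complex.I) / E.E (x + y * Complex.I)‖ₑ ^ 2) atTop
        (𝓝 (‖G (x + y * Complex.I) / E.E (x + y * Complex.I)‖ₑ ^ 2)) := fun x =>
      ((ENNReal.continuous_pow 2).tendsto _).comp ((hvG _).div_const _).enorm
    have hle : ∀ k, ∫⁻ x : ℝ, ‖v k (x + y * Complex.I) / E.E (x + y * Complex.I)‖ₑ ^ 2 ≤
        ENNReal.ofReal T := by
      intro k
      rcases hy.eq_or_lt with rfl | hy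
      · simpa using hvT k
      · exact ((hv k).lintegral_le hy).trans (hvT k)
    have hm : ∀ k, AEMeasurable (fun x : ℝ =>
        ‖v k (x + y * Complex.I) / E.E (x + y * Complex.I)‖ₑ ^ 2) volume := fun k => by
      have : Continuous fun x : ℝ => v k (x + y * Complex.I) / E.E (x + y * Complex.I) :=
        (hv k).cont.comp_continuous (by fun_prop) (by intro x; simpa using hy)
      exact (this.enorm.measurable.pow_const 2).aemeasurable
    calc _ = ∫⁻ x : ℝ, liminf (fun k =>
          ‖v k (x + y * Complex.I) / E.E (x + y * Complex.I)‖ₑ ^ 2) atTop :=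
          lintegral_congr fun x => ((hl x).liminf_eq).symm
      _ ≤ liminf (fun k => ∫⁻ x : ℝ,
          ‖v k (x + y * Complex.I) / E.E (x + y * Complex.I)‖ₑ ^ 2) atTop :=
          lintegral_liminf_le' hm
      _ ≤ _ := by
          refine liminf_le_of_le (by isBoundedDefault) fun b hb => ?_
          obtain ⟨n, hn⟩ := hb.exists
          exact hn.trans (hle n)
  have hbd : ∀ k, ∫⁻ t : ℝ, ‖(u k).fn t / E.E t‖ₑ ^ 2 ≤ ENNReal.ofReal T := fun k => by
    rw [Space.lintegral_quot]
    exact ENNReal.ofReal_le_ofReal (hT k)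
  have hbd' : ∀ k, ∫⁻ t : ℝ, ‖starFun (u k).fn t / E.E t‖ₑ ^ 2 ≤ ENNReal.ofReal T := fun k => by
    refine le_trans (le_of_eq (lintegral_congr fun t => ?_)) (hbd k)
    rw [← ofReal_norm, ← ofReal_norm, starFun_ofReal, norm_div, norm_div, RCLike.norm_conj]
  have h1 := fatou F (fun k => (u k).fn) (fun k => (u k).hardy) hlim hbd
  have h2 := fatou (starFun F) (fun k => starFun (u k).fn) (fun k => (u k).hardy_star)
    (fun z => (Complex.continuous_conj.tendsto _).comp (hlim (conj z))) hbd'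
  have hmem : F ∈ E.space := by
    refine ⟨hF, ⟨?_, T.toNNReal, fun y hy => h1 y hy.le⟩, ⟨?_, T.toNNReal, fun y hy => h2 y hy.le⟩⟩
    · exact hF.differentiableOn.div E.entire.differentiableOn
        fun z (hz : 0 < z.im) => E.ne_zero z hz.le
    · exact hF.starFun.differentiableOn.div E.entire.differentiableOn
        fun z (hz : 0 < z.im) => E.ne_zero z hz.le
  refine ⟨hmem, ?_⟩
  have h3 := h1 0 le_rfl
  simp only [Complex.ofReal_zero, zero_mul, add_zero] at h3
  have h4 := Space.lintegral_quot (Space.of F hmem)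
  rw [Space.fn_of] at h4
  rw [h4] at h3
  exact (ENNReal.ofReal_le_ofReal_iff hT0).1 h3

section Sampling

variable {ι : Type} {t : ι → ℝ}

theorem norm_sum_zeroFn_sq (ht : Function.Injective t) (hz : ∀ n, E.A (t n) = 0) (s : Finset ι)
    (c : ι → ℂ) : ‖∑ n ∈ s, c n • E.zeroFn (t n) (hz n)‖ ^ 2 =
      ∑ n ∈ s, ‖c n‖ ^ 2 * ‖E.zeroFn (t n) (hz n)‖ ^ 2 := by
  classical
  induction s using Finset.induction_on with
  | empty => simp
  | insert m s hm ih =>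
    have h0 : inner ℂ (c m • E.zeroFn (t m) (hz m)) (∑ n ∈ s, c n • E.zeroFn (t n) (hz n)) = 0 := by
      rw [inner_sum]
      refine Finset.sum_eq_zero fun n hn => ?_
      rw [inner_smul_left, inner_smul_right, inner_zeroFn_of_ne, mul_zero, mul_zero]
      intro h
      exact hm (ht h ▸ hn)
    rw [Finset.sum_insert hm, Finset.sum_insert hm, ← ih, sq,
      norm_add_sq_eq_norm_sq_add_norm_sq_of_inner_eq_zero _ _ h0, norm_smul]
    ring

/-- Up to a unimodular factor, `F(t_n)/e_n(t_n) · ‖e_n‖` is the Fourier coefficient of `F` along the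
normalized `e_n`. -/
theorem bessel_zeroFn (ht : Function.Injective t) (hz : ∀ n, E.A (t n) = 0) (F : E.Space) :
    (Summable fun n => ‖F.fn (t n) / (E.zeroFn (t n) (hz n)).fn (t n)‖ ^ 2 *
        ‖E.zeroFn (t n) (hz n)‖ ^ 2) ∧
      ∑' n, ‖F.fn (t n) / (E.zeroFn (t n) (hz n)).fn (t n)‖ ^ 2 *
        ‖E.zeroFn (t n) (hz n)‖ ^ 2 ≤ ‖F‖ ^ 2 := by
  set u : ι → E.Space := fun n => ((‖E.zeroFn (t n) (hz n)‖⁻¹ : ℝ) : ℂ) • E.zeroFn (t n) (hz n)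
  have hpos : ∀ n, 0 < ‖E.zeroFn (t n) (hz n)‖ := fun n => norm_pos_iff.2 (zeroFn_ne_zero _ _)
  have hu : Orthonormal ℂ u := by
    refine ⟨fun n => ?_, fun m n hmn => ?_⟩
    · rw [norm_smul, Complex.norm_real, norm_inv, norm_norm, inv_mul_cancel₀ (hpos n).ne']
    · change inner ℂ (u m) (u n) = 0
      rw [inner_smul_left, inner_smul_right, inner_zeroFn_of_ne _ _ (ht.ne hmn), mul_zero, mul_zero]
  have heq : ∀ n, ‖inner ℂ (u n) F‖ ^ 2 = ‖F.fn (t n) / (E.zeroFn (t n) (hz n)).fn (t n)‖ ^ 2 *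
      ‖E.zeroFn (t n) (hz n)‖ ^ 2 := by
    intro n
    have := (hpos n).ne'
    rw [inner_smul_left, inner_zeroFn, Complex.conj_ofReal, norm_mul, norm_mul, Complex.norm_real,
      Complex.norm_real, norm_inv, norm_norm, norm_pow, norm_norm]
    field_simp
  have h1 := hu.inner_products_summable F
  have h2 := hu.tsum_inner_products_le F
  simp_rw [heq] at h1 h2
  exact ⟨h1, h2⟩

end Sampling

section Unitary

variable {ι : Type} {d : DiscreteMeasure ι}

theorem Space.fn_sum (r : Finset ι) (F : ι → E.Space) (z : ℂ) :
    (∑ n ∈ r, F n).fn z = ∑ n ∈ r, (F n).fn z := by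
  classical
  induction r using Finset.induction_on with
  | empty => simp
  | insert m r hm ih => rw [Finset.sum_insert hm, Finset.sum_insert hm, ← ih]; rfl

/-- Boundedness of the evaluation at `i`, tested on partial sums of its kernel: the test function
has `‖F‖² = T` and `F(i) = A(i) T`, so `|A(i)|² T² ≤ C T`. The result makes the sampling series
converge locally uniformly and, in the converse direction, puts `1/x` into `L²(μ)`. -/
theorem summable_inv_norm_zeroFn (hz : ∀ n, E.A (d.t n) = 0) :
    Summable fun n => (‖E.zeroFn (d.t n) (hz n)‖ ^ 2 * d.t n ^ 2)⁻¹ := by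
  have hI : (0 : ℝ) < Complex.I.im := by simp
  have hAI : 0 < ‖E.A Complex.I‖ := norm_pos_iff.2 (A_ne_zero (by simp))
  have hpos : ∀ n, 0 < ‖E.zeroFn (d.t n) (hz n)‖ := fun n => norm_pos_iff.2 (zeroFn_ne_zero _ _)
  have hne : ∀ n, Complex.I - d.t n ≠ 0 := fun n h => by
    have := congrArg Complex.im h
    simp at this
  set C := ‖E.E Complex.I‖ ^ 2 * (Real.pi * Complex.I.im)⁻¹ with hC
  have hsum : Summable fun n => (‖E.zeroFn (d.t n) (hz n)‖ ^ 2 * ‖Complex.I - d.t n‖ ^ 2)⁻¹ := by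
    refine summable_of_sum_le (c := C / ‖E.A Complex.I‖ ^ 2) (fun n => by positivity) fun s => ?_
    set T := ∑ n ∈ s, (‖E.zeroFn (d.t n) (hz n)‖ ^ 2 * ‖Complex.I - d.t n‖ ^ 2)⁻¹ with hT
    have hT0 : 0 ≤ T := Finset.sum_nonneg fun n _ => by positivity
    set c : ι → ℂ := fun n => ((‖E.zeroFn (d.t n) (hz n)‖ ^ 2 : ℝ) : ℂ)⁻¹ *
      conj (Complex.I - d.t n)⁻¹ with hc
    set F := ∑ n ∈ s, c n • E.zeroFn (d.t n) (hz n) with hF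
    have h1 : ‖F‖ ^ 2 = T := by
      rw [hF, norm_sum_zeroFn_sq d.injective hz]
      refine Finset.sum_congr rfl fun n _ => ?_
      have h0 := (hpos n).ne'
      have h0' := norm_ne_zero_iff.2 (hne n)
      rw [hc, norm_mul, RCLike.norm_conj, norm_inv, norm_inv, Complex.norm_real, norm_pow, norm_norm]
      field_simp
    have h2 : F.fn Complex.I = E.A Complex.I * T := by
      rw [hF, Space.fn_sum, hT, Complex.ofReal_sum, Finset.mul_sum]
      refine Finset.sum_congr rfl fun n _ => ?_
      have h3 := zeroFn_mul (d.t n) (hz n) Complex.I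
      have h4 : ((‖Complex.I - d.t n‖ ^ 2 : ℝ) : ℂ) = (Complex.I - d.t n) * conj (Complex.I - d.t n) := by
        rw [Complex.mul_conj, Complex.normSq_eq_norm_sq]
      have h5 : conj (Complex.I - d.t n) ≠ 0 :=
        (map_ne_zero (starRingEnd ℂ)).2 (hne n)
      have h6 : ((‖E.zeroFn (d.t n) (hz n)‖ ^ 2 : ℝ) : ℂ) ≠ 0 := by
        have := hpos n
        exact_mod_cast (by positivity)
      rw [← h3, Complex.ofReal_inv, Complex.ofReal_mul, h4, hc]
      simp only [map_inv₀, Space.fn_smul, Pi.smul_apply, smul_eq_mul]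
      have := hne n
      field_simp
    have h3 := F.norm_sq_fn_le hI
    rw [h1, h2, norm_mul, Complex.norm_real, Real.norm_of_nonneg hT0, mul_pow] at h3
    rw [le_div_iff₀ (by positivity)]
    rcases hT0.eq_or_lt with h4 | h4
    · rw [← h4]; simp; positivity
    · refine le_of_mul_le_mul_right ?_ h4
      linarith
  obtain ⟨δ, hδ, hle⟩ := d.exists_pos_le_abs
  -- Since `|t_n| ≥ δ`, one has `|i - t_n|² = t_n² + 1 ≤ (1 + δ⁻²) t_n²`.
  refine (hsum.mul_left (1 + (δ ^ 2)⁻¹)).of_nonneg_of_le (fun n => by positivity) fun n => ?_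
  have h1 : ‖Complex.I - d.t n‖ ^ 2 = d.t n ^ 2 + 1 := by
    rw [Complex.sq_norm, Complex.normSq_apply]; simp; ring
  have h2 : δ ^ 2 ≤ d.t n ^ 2 := by
    rw [← sq_abs (d.t n)]
    exact pow_le_pow_left₀ hδ.le (hle n) 2
  have h3 : 0 < d.t n ^ 2 := by have := d.ne_zero n; positivity
  rw [h1, mul_inv, mul_inv, mul_left_comm]
  refine mul_le_mul_of_nonneg_left ?_ (by positivity)
  rw [← div_eq_mul_inv, le_div_iff₀ (by positivity), mul_add, inv_mul_cancel₀ h3.ne', mul_one]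
  have : (d.t n ^ 2)⁻¹ ≤ (δ ^ 2)⁻¹ := inv_anti₀ (by positivity) h2
  linarith

/-- Sampling at the zeros of `A ∉ H(E)`: the functions `A / (z - tₙ)` form an orthogonal basis. -/
theorem exists_unitary (hA : E.A ∉ E.space) (hz : ∀ n, E.A (d.t n) = 0)
    (hz' : ∀ s : ℝ, E.A s = 0 → ∃ n, d.t n = s) {w : ι → ℂ}
    (hw : ∀ n, ‖w n‖ ^ 2 * ‖E.zeroFn (d.t n) (hz n)‖ ^ 2 = d.mass n) :
    ∃ U : Lp ℂ 2 d.measure ≃ₗᵢ[ℂ] E.Space, ∀ f z,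
      HasSum (fun n => f (d.t n) * w n * (E.zeroFn (d.t n) (hz n)).fn z) ((U f).fn z) := by
  have hcount := d.countable
  have hpos : ∀ n, 0 < ‖E.zeroFn (d.t n) (hz n)‖ := fun n => norm_pos_iff.2 (zeroFn_ne_zero _ _)
  have hsumm : ∀ f : Lp ℂ 2 d.measure, Summable fun n => ‖f (d.t n) * w n‖ / |d.t n| := by
    intro f
    refine ((d.hasSum_norm_sq f).summable.add (summable_inv_norm_zeroFn hz)).of_nonneg_of_le
      (fun n => by positivity) fun n => ?_
    have h0 := hpos n
    have ht : 0 < |d.t n| := abs_pos.2 (d.ne_zero n)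
    rw [← hw n, ← sq_abs (d.t n), norm_mul]
    set e := ‖E.zeroFn (d.t n) (hz n)‖
    set a := ‖f (d.t n)‖
    set b := ‖w n‖
    set τ := |d.t n|
    have h1 : b ^ 2 * e ^ 2 * a ^ 2 + (e ^ 2 * τ ^ 2)⁻¹ - a * b / τ =
        (b * e * a - (e * τ)⁻¹ / 2) ^ 2 + 3 / 4 * (e ^ 2 * τ ^ 2)⁻¹ := by
      field_simp
      ring
    have h2 : 0 ≤ (b * e * a - (e * τ)⁻¹ / 2) ^ 2 + 3 / 4 * (e ^ 2 * τ ^ 2)⁻¹ := by positivity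
    linarith
  have hML := fun f => d.mittagLeffler differentiable_A hz (hsumm f)
  -- Partial sums have norm at most `‖f‖` by orthogonality and converge pointwise to an entire
  -- function, so the limit lies in `H(E)` by Fatou; completeness of `H(E)` is not used.
  have hmem : ∀ f : Lp ℂ 2 d.measure, ∃ F : E.Space, ‖F‖ ^ 2 ≤ ‖f‖ ^ 2 ∧
      ∀ z, HasSum (fun n => f (d.t n) * w n * (E.zeroFn (d.t n) (hz n)).fn z) (F.fn z) := by
    intro f
    obtain ⟨s, hs⟩ := exists_seq_tendsto (atTop : Filter (Finset ι))
    obtain ⟨h1, h2⟩ := exists_norm_sq_le_of_tendsto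
      (u := fun k => ∑ n ∈ s k, (f (d.t n) * w n) • E.zeroFn (d.t n) (hz n)) (T := ‖f‖ ^ 2)
      (hML f).2 (fun z => by
        have := ((hML f).1 z).hasSum.comp hs
        refine this.congr fun k => ?_
        rw [Space.fn_sum]
        rfl) (fun k => by
        rw [norm_sum_zeroFn_sq d.injective hz]
        refine le_trans (le_of_eq ?_) (sum_le_hasSum (s k) (fun n _ =>
          mul_nonneg (d.mass_pos n).le (sq_nonneg _)) (d.hasSum_norm_sq f))
        refine Finset.sum_congr rfl fun n _ => ?_
        rw [← hw n, norm_mul]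
        ring)
    exact ⟨_, h2, fun z => ((hML f).1 z).hasSum⟩
  choose V hVle hV using hmem
  have hVt : ∀ f m, (V f).fn (d.t m) / (E.zeroFn (d.t m) (hz m)).fn (d.t m) = f (d.t m) * w m := by
    intro f m
    have h1 := hV f (d.t m)
    have h2 := hasSum_single (f := fun n => f (d.t n) * w n * (E.zeroFn (d.t n) (hz n)).fn (d.t m)) m
      fun n hn => by
        rw [zeroFn_apply_of_ne (hz n) (hz m) (d.injective.ne hn.symm), mul_zero]
    rw [h1.unique h2, mul_div_cancel_right₀ _ (zeroFn_apply_self_ne_zero _ _)]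
  have hw0 : ∀ n, w n ≠ 0 := fun n h => by
    have := hw n
    rw [h] at this
    simp at this
    exact (d.mass_pos n).ne this
  -- One inequality comes from the construction, the other from Bessel, because the Fourier
  -- coefficients of `V f` recover the values `f(t_n)`.
  have hnorm : ∀ f, ‖V f‖ = ‖f‖ := by
    intro f
    refine le_antisymm ((sq_le_sq₀ (norm_nonneg _) (norm_nonneg _)).1 (hVle f))
      ((sq_le_sq₀ (norm_nonneg _) (norm_nonneg _)).1 ?_)
    refine le_trans (le_of_eq ?_) (bessel_zeroFn d.injective hz (V f)).2
    rw [← (d.hasSum_norm_sq f).tsum_eq]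
    refine tsum_congr fun n => ?_
    rw [hVt, norm_mul, ← hw n]
    ring
  let V' : Lp ℂ 2 d.measure →ₗ[ℂ] E.Space :=
    { toFun := V
      map_add' := fun f g => Space.ext fun z => by
        refine (hV (f + g) z).unique ?_
        have h := (hV f z).add (hV g z)
        have hfg := d.ae_iff.1 (Lp.coeFn_add f g)
        simp only [hfg, Pi.add_apply]
        simp only [add_mul]
        exact h
      map_smul' := fun c f => Space.ext fun z => by
        refine (hV (c • f) z).unique ?_
        have h := (hV f z).mul_left c
        have hf := d.ae_iff.1 (Lp.coeFn_smul c f)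
        simp only [hf, Pi.smul_apply, smul_eq_mul, mul_assoc]
        simp only [mul_assoc] at h
        exact h }
  let V'' : Lp ℂ 2 d.measure →ₗᵢ[ℂ] E.Space := ⟨V', hnorm⟩
  have hsurj : Function.Surjective V'' := by
    intro F
    -- Bessel puts the sampled data of `F` into `L²(μ)`; its image agrees with `F` at every zero of
    -- `A`, hence equals `F`. This is where `A ∉ H(E)` enters.
    set φ : ℝ → ℂ := Function.extend d.t
      (fun n => F.fn (d.t n) / (E.zeroFn (d.t n) (hz n)).fn (d.t n) / w n) 0 with hφ
    have hφt : ∀ n, φ (d.t n) = F.fn (d.t n) / (E.zeroFn (d.t n) (hz n)).fn (d.t n) / w n :=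
      fun n => d.injective.extend_apply _ _ n
    have hmemφ : MemLp φ 2 d.measure := by
      rw [d.memLp_two_iff]
      refine (bessel_zeroFn d.injective hz F).1.congr fun n => ?_
      have := norm_ne_zero_iff.2 (hw0 n)
      rw [hφt, ← hw n, norm_div _ (w n)]
      field_simp
    have hf := d.ae_iff.1 hmemφ.coeFn_toLp
    refine ⟨hmemφ.toLp φ, ?_⟩
    rw [← sub_eq_zero]
    refine Space.eq_zero_of_forall_zero hA _ fun s hs => ?_
    obtain ⟨n, rfl⟩ := hz' s hs
    have h1 := hVt (hmemφ.toLp φ) n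
    rw [hf, hφt, div_mul_cancel₀ _ (hw0 n)] at h1
    have h2 := (div_left_inj' (zeroFn_apply_self_ne_zero _ _)).1 h1
    change (V (hmemφ.toLp φ) - F).fn (d.t n) = 0
    rw [Space.fn_sub, Pi.sub_apply, h2, sub_self]
  exact ⟨LinearIsometryEquiv.ofSurjective V'' hsurj, fun f z => hV f z⟩

end Unitary

end HermiteBiehler

namespace HermiteBiehler

variable {E : HermiteBiehler}

/-! ### The functional model -/

section Model

variable {ι : Type} {d : DiscreteMeasure ι} {P : SingularPerturbation d}
  {hz : ∀ n, E.A (d.t n) = 0} {U : Lp ℂ 2 d.measure ≃ₗᵢ[ℂ] E.Space} {w : ι → ℂ}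

theorem mulOp_apply (y : (mulOp d.measure).domain) (n : ι) :
    (mulOp d.measure y : Lp ℂ 2 d.measure) (d.t n) = d.t n * (y : Lp ℂ 2 d.measure) (d.t n) := by
  have hy : MemLp (fun x : ℝ => (x : ℂ) * (y : Lp ℂ 2 d.measure) x) 2 d.measure := y.2
  exact d.ae_iff.1 hy.coeFn_toLp n

theorem ext_of_apply {f g : Lp ℂ 2 d.measure} (h : ∀ n, f (d.t n) = g (d.t n)) : f = g :=
  Lp.ext (d.ae_iff.2 h)

theorem sampling_apply
    (hU : ∀ f z, HasSum (fun n => f (d.t n) * w n * (E.zeroFn (d.t n) (hz n)).fn z) ((U f).fn z))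
    (f : Lp ℂ 2 d.measure) (m : ι) :
    (U f).fn (d.t m) = f (d.t m) * w m * (E.zeroFn (d.t m) (hz m)).fn (d.t m) := by
  refine (hU f (d.t m)).unique (hasSum_single m fun n hn => ?_)
  rw [zeroFn_apply_of_ne (hz n) (hz m) (d.injective.ne hn.symm), mul_zero]

/-- Termwise `t_n e_n = z e_n - A`. The weights `conj(b(t_n)) μ_n` are chosen so that the
coefficients of `A` sum to `⟨y, b⟩`. -/
theorem sampling_mulOp
    (hU : ∀ f z, HasSum (fun n => f (d.t n) * (conj (P.b (d.t n)) * d.mass n) *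
      (E.zeroFn (d.t n) (hz n)).fn z) ((U f).fn z))
    (y : (mulOp d.measure).domain) (z : ℂ) :
    (U (mulOp d.measure y)).fn z = z * (U y).fn z - P.pairing y * E.A z := by
  refine (hU (mulOp d.measure y) z).unique ?_
  have h1 := (hU y z).mul_left z
  have h2 := (d.hasSum_integral (P.integrable_pairing y.2)).mul_right (E.A z)
  refine (h1.sub h2).congr_fun fun n => ?_
  rw [mulOp_apply, ← zeroFn_mul (d.t n) (hz n) z]
  ring

variable {G : ℂ → ℂ}

theorem mem_domain_of_apply {y v : Lp ℂ 2 d.measure} (h : ∀ n, v (d.t n) = d.t n * y (d.t n)) :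
    ∃ hy : y ∈ (mulOp d.measure).domain, mulOp d.measure ⟨y, hy⟩ = v := by
  have hy : MemLp (fun x : ℝ => (x : ℂ) * y x) 2 d.measure :=
    (memLp_congr_ae (d.ae_iff.2 h)).1 (Lp.memLp v)
  exact ⟨hy, ext_of_apply fun n => by rw [mulOp_apply, h]⟩

theorem pairing_invA : P.pairing P.invA =
    ∫ x, (x : ℂ)⁻¹ * P.a x * conj (P.b x) ∂d.measure := by
  rw [SingularPerturbation.pairing]
  refine integral_congr_ae ?_
  filter_upwards [P.memLp_a.coeFn_toLp] with x hx
  rw [SingularPerturbation.invA, hx]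
  ring

theorem memLp_a_of_invA_mem (h : P.invA ∈ (mulOp d.measure).domain) : MemLp P.a 2 d.measure := by
  have h' : MemLp (fun x : ℝ => (x : ℂ) * P.invA x) 2 d.measure := h
  refine h'.ae_eq ?_
  filter_upwards [P.memLp_a.coeFn_toLp, d.ae_ne_zero] with x hx hx0
  have : (x : ℂ) ≠ 0 := by exact_mod_cast hx0
  rw [SingularPerturbation.invA, hx]
  field_simp

/-- If `-G = Uv`, sampling at `t_n`, where `A` vanishes, gives `v = x A⁻¹a`. Hence `a ∈ L²(μ)`, and
the value at `0` yields `κ = ⟨A⁻¹a, b⟩`, the excluded case. -/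
theorem notMem_space_of_model (hA0 : E.A 0 ≠ 0) (hb : ∀ n, P.b (d.t n) ≠ 0)
    (hU : ∀ f z, HasSum (fun n => f (d.t n) * (conj (P.b (d.t n)) * d.mass n) *
      (E.zeroFn (d.t n) (hz n)).fn z) ((U f).fn z))
    (hG : ∀ z, G z = P.κ * E.A z - z * (U P.invA).fn z) : G ∉ E.space := by
  intro hmem
  obtain ⟨v, hv⟩ := U.surjective (-Space.of G hmem)
  have hvz : ∀ z, (U v).fn z = -G z := fun z => by rw [hv]; rfl
  have hw : ∀ n, conj (P.b (d.t n)) * (d.mass n : ℂ) ≠ 0 := fun n =>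
    mul_ne_zero ((map_ne_zero _).2 (hb n)) (by exact_mod_cast (d.mass_pos n).ne')
  obtain ⟨hy, hyv⟩ := mem_domain_of_apply (y := P.invA) (v := v) fun n => by
    have h1 := hvz (d.t n)
    rw [hG, hz n, sampling_apply hU, sampling_apply hU] at h1
    refine mul_right_cancel₀ (hw n) (mul_right_cancel₀ (zeroFn_apply_self_ne_zero _ (hz n)) ?_)
    linear_combination h1
  have h2 := sampling_mulOp hU ⟨P.invA, hy⟩ 0
  rw [hyv, hvz, hG, pairing_invA] at h2
  refine P.κ_ne (memLp_a_of_invA_mem hy) (mul_right_cancel₀ hA0 ?_)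
  linear_combination -h2

theorem unitarilyEquivalent_of_model (hA0 : E.A 0 ≠ 0) (hb : ∀ n, P.b (d.t n) ≠ 0)
    (hU : ∀ f z, HasSum (fun n => f (d.t n) * (conj (P.b (d.t n)) * d.mass n) *
      (E.zeroFn (d.t n) (hz n)).fn z) ((U f).fn z))
    (hG : ∀ z, G z = P.κ * E.A z - z * (U P.invA).fn z) :
    UnitarilyEquivalent P.op (E.modelOp G) := by
  have hGn := notMem_space_of_model hA0 hb hU hG
  have hw : ∀ n, conj (P.b (d.t n)) * (d.mass n : ℂ) ≠ 0 := fun n =>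
    mul_ne_zero ((map_ne_zero _).2 (hb n)) (by exact_mod_cast (d.mass_pos n).ne')
  refine ⟨U, fun y v => ?_⟩
  rw [P.mem_graph_op, E.mem_graph_modelOp hGn]
  constructor
  · rintro ⟨c, y₀, h1, rfl, rfl⟩
    refine ⟨-c, fun z => ?_⟩
    rw [sampling_mulOp hU, hG, map_add, map_smul]
    simp only [Space.fn_add, Space.fn_smul, Pi.add_apply, Pi.smul_apply, smul_eq_mul]
    linear_combination -E.A z * h1
  · rintro ⟨c, h⟩
    have hy₀ : ∀ z, (U (y - (-c) • P.invA)).fn z = (U y).fn z + c * (U P.invA).fn z := fun z => by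
      rw [map_sub, map_smul]
      simp
    -- At the points `t_n` the term `κ A` of `G` disappears, which shows `y₀ = y + c A⁻¹a ∈ D(A)`
    -- and `A y₀ = v`. The scalar condition is recovered afterwards at `z = 0`, where `A ≠ 0`.
    obtain ⟨hmem, hv⟩ := mem_domain_of_apply (y := y - (-c) • P.invA) (v := v) fun n => by
      have h1 := h (d.t n)
      have h2 := hy₀ (d.t n)
      rw [hG, hz n] at h1
      have h3 : (U v).fn (d.t n) = d.t n * (U (y - (-c) • P.invA)).fn (d.t n) := by
        rw [h1, h2]; ring
      rw [sampling_apply hU, sampling_apply hU] at h3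
      refine mul_right_cancel₀ (hw n) (mul_right_cancel₀ (zeroFn_apply_self_ne_zero _ (hz n)) ?_)
      linear_combination h3
    refine ⟨-c, ⟨_, hmem⟩, ?_, by simp, hv.symm⟩
    have h4 := sampling_mulOp hU ⟨_, hmem⟩ 0
    rw [hv, h, hG] at h4
    refine mul_right_cancel₀ hA0 ?_
    linear_combination h4

end Model

/-- Zeros of `A` are isolated, hence finite in number on bounded sets. -/
theorem tendsto_abs_zeros : Tendsto (fun x : {x : ℝ // E.A x = 0} => |(x : ℝ)|) cofinite atTop := by
  have hI : E.A Complex.I ≠ 0 := A_ne_zero (by simp)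
  have han : AnalyticOnNhd ℂ E.A Set.univ := fun z _ => differentiable_A.analyticAt z
  refine tendsto_atTop.2 fun R => ?_
  rw [eventually_cofinite]
  by_contra hinf
  have hinf' : Set.Infinite {x : {x : ℝ // E.A x = 0} | ¬ R ≤ |(x : ℝ)|} := hinf
  have hinj : Function.Injective fun x : {x : ℝ // E.A x = 0} => ((x : ℝ) : ℂ) := fun x y h =>
    Subtype.ext (Complex.ofReal_injective h)
  have himg := hinf'.image hinj.injOn
  obtain ⟨z, -, hz⟩ := himg.exists_accPt_of_subset_isCompact (isCompact_closedBall (0 : ℂ) R) (by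
    rintro _ ⟨x, hx, rfl⟩
    simpa using (not_le.1 hx).le)
  have hfreq : ∃ᶠ y in 𝓝[≠] z, E.A y = 0 := by
    rw [accPt_iff_frequently_nhdsNE] at hz
    refine hz.mono ?_
    rintro _ ⟨x, _, rfl⟩
    exact x.2
  exact hI (han.eqOn_zero_of_preconnected_of_frequently_eq_zero isPreconnected_univ
    (Set.mem_univ z) hfreq (Set.mem_univ _))

theorem IsGenerator.exists_decomposition {G : ℂ → ℂ} (hG : E.IsGenerator G) :
    ∃ F₀ F₁ : E.Space, ∀ z, G z = F₀.fn z + z * F₁.fn z := by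
  by_cases h : ∀ z, G z ≠ 0
  · obtain ⟨F₀, h₀, F₁, h₁, h⟩ := hG.zeroFree h
    exact ⟨Space.of F₀ h₀, Space.of F₁ h₁, h⟩
  · push Not at h
    obtain ⟨z₀, hz₀⟩ := h
    obtain ⟨F, hF, h⟩ := hG.quot z₀ hz₀
    refine ⟨(-z₀) • Space.of F hF, Space.of F hF, fun z => ?_⟩
    rw [← h z]
    simp
    ring

/-- The model operator is a singular rank one perturbation. -/
theorem exists_singularPerturbation {G : ℂ → ℂ} (hA : E.A ∉ E.space) (hA0 : E.A 0 ≠ 0)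
    (hG : E.IsGenerator G) (hG0 : G 0 ≠ 0) :
    ∃ (ι : Type) (d : DiscreteMeasure ι) (L : SingularPerturbation d),
      (∀ n, L.b (d.t n) ≠ 0) ∧ UnitarilyEquivalent L.op (E.modelOp G) := by
  obtain ⟨F₀, F₁, hF⟩ := hG.exists_decomposition
  have hpos : ∀ x : {x : ℝ // E.A x = 0}, 0 < ‖E.zeroFn x x.2‖ := fun x =>
    norm_pos_iff.2 (zeroFn_ne_zero _ _)
  -- If `A` had no zeros, uniqueness would give `H(E) = 0`, and then `G(0) = F₀(0) = 0`.
  have hne : Nonempty {x : ℝ // E.A x = 0} := by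
    by_contra hempty
    have hzero : ∀ F : E.Space, F = 0 := fun F =>
      Space.eq_zero_of_forall_zero hA F fun t ht => (hempty ⟨t, ht⟩).elim
    refine hG0 ?_
    rw [hF 0, hzero F₀]
    simp
  let d : DiscreteMeasure {x : ℝ // E.A x = 0} :=
    { t := fun x => x
      mass := fun x => (‖E.zeroFn x x.2‖ ^ 2)⁻¹
      nonempty := hne
      injective := Subtype.val_injective
      ne_zero := by
        rintro ⟨x, hx⟩ rfl
        exact hA0 (by simpa using hx)
      tendsto := tendsto_abs_zeros
      mass_pos := fun x => by have := hpos x; positivity }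
  have hz : ∀ n, E.A (d.t n) = 0 := fun n => n.2
  obtain ⟨U, hU⟩ := exists_unitary (d := d) hA hz (fun s hs => ⟨⟨s, hs⟩, rfl⟩)
    (w := fun n => conj (1 : ℂ) * d.mass n) fun n => by
      have := (hpos n).ne'
      rw [map_one, one_mul, Complex.norm_real, Real.norm_of_nonneg (d.mass_pos n).le]
      change ((‖E.zeroFn n n.2‖ ^ 2)⁻¹) ^ 2 * ‖E.zeroFn n n.2‖ ^ 2 = (‖E.zeroFn n n.2‖ ^ 2)⁻¹
      field_simp
  -- The only value for which `κ A - G` vanishes at `0` and can be divided by `z`.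
  set κ := G 0 / E.A 0 with hκ
  obtain ⟨hKd, hK⟩ := exists_entire_sub_mul_eq (F := fun z => κ * E.A z - F₀.fn z) (w := 0)
    ((differentiable_A.const_mul κ).sub F₀.differentiable) (by
      have := hF 0
      rw [zero_mul, add_zero] at this
      rw [hκ, div_mul_cancel₀ _ hA0, this, sub_self])
  set K : E.Space := Space.of _ (mem_space_of_sub_mul_eq hKd (-F₀) κ 0 fun z => by
    rw [hK, Space.fn_neg, Pi.neg_apply]; ring) with hKdef
  have hK' : ∀ z, z * (K - F₁).fn z = κ * E.A z - G z := fun z => by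
    have := hK z
    rw [Space.fn_sub, Pi.sub_apply, hKdef, Space.fn_of, hF]
    linear_combination this
  set α : Lp ℂ 2 d.measure := U.symm (K - F₁) with hα
  have hαeq : (fun x : ℝ => (x : ℂ) * α x / x) =ᵐ[d.measure] α := by
    filter_upwards [d.ae_ne_zero] with x hx
    have : (x : ℂ) ≠ 0 := by exact_mod_cast hx
    field_simp
  have hmemα : MemLp (fun x : ℝ => (x : ℂ) * α x / x) 2 d.measure :=
    (memLp_congr_ae hαeq).2 (Lp.memLp α)
  have hmemb : MemLp (fun x : ℝ => (1 : ℂ) / x) 2 d.measure := by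
    rw [d.memLp_two_iff]
    refine (summable_inv_norm_zeroFn (d := d) hz).congr fun n => ?_
    rw [norm_div, norm_one, Complex.norm_real, div_pow, Real.norm_eq_abs, sq_abs, one_pow, one_div,
      mul_inv]
  have hUα : U α = K - F₁ := U.apply_symm_apply _
  have hint : ∀ (h : α ∈ (mulOp d.measure).domain) (z : ℂ), (U (mulOp d.measure ⟨α, h⟩)).fn z =
      z * (U α).fn z - (∫ x, α x * conj (1 : ℂ) ∂d.measure) * E.A z := by
    -- The multiplication formula involves only `b`, so an auxiliary perturbation with `a = 0`
    -- supplies it before the condition on `κ` is known.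
    let P₀ : SingularPerturbation d :=
      { a := fun _ => 0
        b := fun _ => 1
        κ := 1
        memLp_a := by simp
        memLp_b := hmemb
        κ_ne_zero := one_ne_zero
        κ_ne := by simp }
    exact fun h z => sampling_mulOp (P := P₀) (hz := hz) hU ⟨α, h⟩ z
  let P : SingularPerturbation d :=
    { a := fun x => x * α x
      b := fun _ => 1
      κ := κ
      memLp_a := hmemα
      memLp_b := hmemb
      κ_ne_zero := div_ne_zero hG0 hA0
      κ_ne := by
        intro ha h
        have h1 : ∫ x : ℝ, (x : ℂ)⁻¹ * (x * α x) * conj (1 : ℂ) ∂d.measure =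
            ∫ x, α x * conj (1 : ℂ) ∂d.measure := by
          refine integral_congr_ae ?_
          filter_upwards [d.ae_ne_zero] with x hx
          have : (x : ℂ) ≠ 0 := by exact_mod_cast hx
          field_simp
        rw [h1] at h
        refine hG.notMem ?_
        -- For the excluded `κ`, `U(Aα) = z Uα - κ A = -G`, contradicting `G ∉ H(E)`.
        have h2 : G = (-(U (mulOp d.measure ⟨α, ha⟩))).fn := by
          funext z
          have h3 := hint ha z
          rw [← h, hUα, hK'] at h3
          rw [Space.fn_neg, Pi.neg_apply, h3]
          ring
        rw [h2]
        exact Space.fn_mem _ }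
  refine ⟨_, d, P, fun n => one_ne_zero, unitarilyEquivalent_of_model (P := P) (hz := hz) (U := U) hA0
    (fun n => one_ne_zero) hU fun z => ?_⟩
  have hinv : P.invA = α := by
    refine Lp.ext ?_
    filter_upwards [P.memLp_a.coeFn_toLp, hαeq] with x h1 h2
    rw [SingularPerturbation.invA, h1]
    exact h2
  rw [hinv, hUα, hK']
  ring

end HermiteBiehler

/-! ### Weierstrass products -/

/-- The Weierstrass primary factor `(1 - u) exp (u + u² / 2 + ⋯ + uᵏ / k)`. -/
def primaryFactor (k : ℕ) (u : ℂ) : ℂ := (1 - u) * Complex.exp (-Complex.logTaylor (k + 1) (-u))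

/-- The factor is the exponential of the Taylor remainder of `log (1 - u)`, which is at most `2⁻ᵏ`
here, and `|exp v - 1| ≤ 2|v|` for `|v| ≤ 1`. -/
theorem norm_primaryFactor_sub_one_le (k : ℕ) {u : ℂ} (hu : ‖u‖ ≤ 1 / 2) :
    ‖primaryFactor k u - 1‖ ≤ 2 * (1 / 2) ^ k := by
  have hu1 : ‖-u‖ < 1 := by rw [norm_neg]; linarith
  have hne : 1 - u ≠ 0 := fun h => by
    rw [← sub_eq_zero.1 h] at hu
    norm_num at hu
  have h1 := Complex.norm_log_sub_logTaylor_le k hu1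
  rw [← sub_eq_add_neg, norm_neg] at h1
  have h2 : ‖Complex.log (1 - u) - Complex.logTaylor (k + 1) (-u)‖ ≤ (1 / 2) ^ k := by
    refine h1.trans ?_
    have h3 : (1 - ‖u‖)⁻¹ ≤ 2 := by
      rw [inv_le_comm₀ (by linarith) two_pos]
      linarith
    calc ‖u‖ ^ (k + 1) * (1 - ‖u‖)⁻¹ / (k + 1) ≤ ‖u‖ ^ (k + 1) * (1 - ‖u‖)⁻¹ := by
          refine div_le_self (mul_nonneg (by positivity) (inv_nonneg.2 (by linarith))) ?_
          linarith [(Nat.cast_nonneg k : (0 : ℝ) ≤ k)]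
      _ ≤ (1 / 2) ^ (k + 1) * 2 := by
          have : 0 ≤ (1 - ‖u‖)⁻¹ := inv_nonneg.2 (by linarith)
          gcongr
      _ = (1 / 2) ^ k := by ring
  have h4 : primaryFactor k u =
      Complex.exp (Complex.log (1 - u) - Complex.logTaylor (k + 1) (-u)) := by
    rw [sub_eq_add_neg, Complex.exp_add, Complex.exp_log hne, primaryFactor]
  rw [h4]
  refine (Complex.norm_exp_sub_one_le (h2.trans (pow_le_one₀ (by norm_num) (by norm_num)))).trans ?_
  gcongr

theorem primaryFactor_eq_zero_iff {k : ℕ} {u : ℂ} : primaryFactor k u = 0 ↔ u = 1 := by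
  rw [primaryFactor, mul_eq_zero, or_iff_left (Complex.exp_ne_zero _), sub_eq_zero, eq_comm]

theorem differentiable_logTaylor (k : ℕ) : Differentiable ℂ (Complex.logTaylor k) := by
  have : Complex.logTaylor k = fun z : ℂ => ∑ j ∈ Finset.range k, (-1) ^ (j + 1) * z ^ j / j := rfl
  rw [this]
  fun_prop

theorem differentiable_primaryFactor (k : ℕ) : Differentiable ℂ (primaryFactor k) := by
  have h : Differentiable ℂ fun u : ℂ => Complex.logTaylor (k + 1) (-u) :=
    (differentiable_logTaylor _).comp differentiable_neg
  have : Differentiable ℂ fun u : ℂ =>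
      (1 - u) * Complex.exp (-Complex.logTaylor (k + 1) (-u)) := by fun_prop
  exact this

theorem conj_primaryFactor (k : ℕ) (u : ℂ) :
    conj (primaryFactor k u) = primaryFactor k (conj u) := by
  simp [primaryFactor, Complex.logTaylor, ← Complex.exp_conj]

namespace DiscreteMeasure

variable {ι : Type}

/-- Partial Weierstrass products over a subset of the index set. -/
theorem exists_products (d : DiscreteMeasure ι) : ∃ h : ι → ℂ → ℂ,
    (∀ n, Differentiable ℂ (h n)) ∧ (∀ n z, conj (h n (conj z)) = h n z) ∧
    (∀ n z, 1 + h n z = 0 ↔ z = d.t n) ∧ (∀ n, deriv (h n) (d.t n) ≠ 0) ∧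
    ∀ s : Set ι, Differentiable ℂ (fun z => ∏' n, (1 + s.indicator (fun n => h n z) n)) ∧
      (∀ z, Multipliable fun n => 1 + s.indicator (fun n => h n z) n) ∧
      ∀ z : ℂ, (∀ n ∈ s, z ≠ d.t n) → ∏' n, (1 + s.indicator (fun n => h n z) n) ≠ 0 := by
  have := d.countable
  -- Using an injective enumeration as the order of the primary factors makes the bounds `2 · 2⁻ᵏ`
  -- summable.
  obtain ⟨k, hk⟩ := exists_injective_nat ι
  have ht : ∀ n, (d.t n : ℂ) ≠ 0 := fun n => by exact_mod_cast d.ne_zero n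
  have hd : ∀ n, Differentiable ℂ fun z => primaryFactor (k n) (z / d.t n) - 1 := fun n =>
    ((differentiable_primaryFactor _).comp (differentiable_id.div_const _)).sub_const 1
  refine ⟨fun n z => primaryFactor (k n) (z / d.t n) - 1, hd, fun n z => ?_, fun n z => ?_,
    fun n => ?_, fun s => ?_⟩
  · simp [conj_primaryFactor]
  · rw [add_sub_cancel, primaryFactor_eq_zero_iff, div_eq_one_iff_eq (ht n)]
  · rw [deriv_sub_const]
    have h1 : HasDerivAt (fun z : ℂ => 1 - z / d.t n) (-(1 / d.t n)) (d.t n) := by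
      simpa using ((hasDerivAt_id (d.t n : ℂ)).div_const (d.t n : ℂ)).const_sub 1
    have h2 : DifferentiableAt ℂ
        (fun z : ℂ => Complex.exp (-Complex.logTaylor (k n + 1) (-(z / d.t n)))) (d.t n) := by
      have : Differentiable ℂ fun z : ℂ => Complex.logTaylor (k n + 1) (-(z / d.t n)) :=
        (differentiable_logTaylor _).comp (differentiable_id.div_const _).neg
      exact this.neg.cexp _
    have h3 := (h1.mul h2.hasDerivAt).deriv
    change deriv (fun z : ℂ => (1 - z / d.t n) *
      Complex.exp (-Complex.logTaylor (k n + 1) (-(z / d.t n)))) (d.t n) ≠ 0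
    change deriv (fun z : ℂ => (1 - z / d.t n) *
      Complex.exp (-Complex.logTaylor (k n + 1) (-(z / d.t n)))) (d.t n) = _ at h3
    rw [h3, div_self (ht n), sub_self, zero_mul, add_zero]
    exact mul_ne_zero (neg_ne_zero.2 (one_div_ne_zero (ht n))) (Complex.exp_ne_zero _)
  · set f : ι → ℂ → ℂ := fun n z =>
      s.indicator (fun n => primaryFactor (k n) (z / d.t n) - 1) n with hf
    have hfd : ∀ n, Differentiable ℂ (f n) := fun n => by
      by_cases hn : n ∈ s
      · simpa [hf, hn] using hd n
      · simp [hf, hn]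
    have hu : Summable fun n : ι => 2 * (1 / 2 : ℝ) ^ k n :=
      (summable_geometric_two.comp_injective hk).mul_left 2
    have hbound : ∀ R : ℝ, ∀ᶠ n in cofinite, ∀ z ∈ Metric.ball (0 : ℂ) R,
        ‖f n z‖ ≤ 2 * (1 / 2 : ℝ) ^ k n := by
      intro R
      rw [eventually_cofinite]
      refine (d.finite_abs_lt (2 * R)).subset fun n hn => ?_
      by_contra h
      refine hn fun z hz => ?_
      by_cases hns : n ∈ s
      · simp only [hf, Set.indicator_of_mem hns]
        refine norm_primaryFactor_sub_one_le _ ?_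
        have h1 : 0 < |d.t n| := abs_pos.2 (d.ne_zero n)
        have h2 : ‖z‖ < R := by simpa using hz
        have h3 : 2 * R ≤ |d.t n| := not_lt.1 h
        rw [norm_div, Complex.norm_real, Real.norm_eq_abs, div_le_iff₀ h1]
        linarith
      · simp [hf, hns]
    have hsum : ∀ z, Summable fun n => ‖f n z‖ := fun z =>
      hu.of_norm_bounded_eventually (by
        filter_upwards [hbound (‖z‖ + 1)] with n hn
        rw [norm_norm]
        exact hn z (by simp))
    refine ⟨fun z => ?_, fun z => multipliable_one_add_of_summable (hsum z), fun z hz =>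
      tprod_one_add_ne_zero_of_summable (fun n => ?_) (hsum z)⟩
    · have h1 := Summable.hasProdLocallyUniformlyOn_one_add (f := f) Metric.isOpen_ball hu
        (hbound (‖z‖ + 1)) fun n => (hfd n).continuous.continuousOn
      have h2 := TendstoLocallyUniformlyOn.differentiableOn h1 (.of_forall fun r =>
        DifferentiableOn.fun_finsetProd fun n _ => ((hfd n).const_add 1).differentiableOn)
        Metric.isOpen_ball
      exact h2.differentiableAt (Metric.isOpen_ball.mem_nhds (by simp))
    · by_cases hn : n ∈ s
      · simp only [Set.indicator_of_mem hn, add_sub_cancel]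
        rw [Ne, primaryFactor_eq_zero_iff, div_eq_one_iff_eq (ht n)]
        exact hz n hn
      · simp [hn]

/-- A real entire function with prescribed simple real zeros. -/
theorem exists_entire (d : DiscreteMeasure ι) : ∃ A : ℂ → ℂ, Differentiable ℂ A ∧
    starFun A = A ∧ (∀ z, A z = 0 ↔ ∃ n, z = d.t n) ∧ ∀ n, deriv A (d.t n) ≠ 0 := by
  obtain ⟨h, hd, hconj, hzero, hderiv, hprod⟩ := d.exists_products
  -- Isolating one factor exhibits the zero at `t_m` as simple: the complementary product does not
  -- vanish there. This is why products over arbitrary subsets were prepared.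
  have hsplit : ∀ m z, ∏' n, (1 + h n z) =
      (1 + h m z) * ∏' n, (1 + ({m}ᶜ : Set ι).indicator (fun n => h n z) n) := by
    classical
    intro m z
    have heq : ∀ n, (Function.update (fun n => 1 + h n z) m 1) n =
        1 + ({m}ᶜ : Set ι).indicator (fun n => h n z) n := by
      intro n
      by_cases hn : n = m
      · subst hn; simp
      · simp [hn]
    rw [Multipliable.tprod_eq_mul_tprod_ite' m (by
      simpa only [funext heq] using (hprod {m}ᶜ).2.1 z)]
    congr 1
    refine tprod_congr fun n => ?_
    by_cases hn : n = m <;> simp [hn]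
  have huniv := hprod Set.univ
  simp only [Set.indicator_univ] at huniv
  refine ⟨fun z => ∏' n, (1 + h n z), huniv.1, ?_, fun z => ⟨fun h0 => ?_, ?_⟩, fun m => ?_⟩
  · funext z
    rw [starFun, (huniv.2.1 (conj z)).map_tprod (starRingEnd ℂ) Complex.continuous_conj]
    refine tprod_congr fun n => ?_
    rw [map_add, map_one, hconj]
  · by_contra hne
    push Not at hne
    exact huniv.2.2 z (fun n _ => hne n) h0
  · rintro ⟨m, rfl⟩
    change ∏' n, (1 + h n (d.t m)) = 0
    rw [hsplit m, (hzero m _).2 rfl, zero_mul]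
  · have h1 := ((hd m (d.t m)).hasDerivAt.const_add 1).mul ((hprod {m}ᶜ).1 (d.t m)).hasDerivAt
    have h2 : (fun z => ∏' n, (1 + h n z)) = (fun z => 1 + h m z) * fun z => ∏' n, (1 + ({m}ᶜ : Set ι).indicator (fun n => h n z) n) := by
      funext z
      exact hsplit m z
    rw [h2]
    refine ne_of_eq_of_ne h1.deriv ?_
    rw [(hzero m _).2 rfl, zero_mul, add_zero]
    refine mul_ne_zero (hderiv m) ((hprod {m}ᶜ).2.2 _ fun n hn hnm => hn ?_)
    exact d.injective (Complex.ofReal_injective hnm).symm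

end DiscreteMeasure

/-! ### Hermite–Biehler functions with prescribed zeros and norms -/

theorem isHardyCont_inv_sub {ζ : ℂ} (hζ : ζ.im < 0) : IsHardyCont fun z => (z - ζ)⁻¹ := by
  have hne : ∀ z : ℂ, 0 ≤ z.im → z - ζ ≠ 0 := fun z hz h => by
    rw [sub_eq_zero.1 h] at hz; linarith
  have hc : ContinuousOn (fun z : ℂ => (z - ζ)⁻¹) {z | 0 ≤ z.im} :=
    ContinuousOn.inv₀ (by fun_prop) hne
  refine ⟨isHardy_of_norm_mul_le hc ?_ IsHardy.zero ζ 1 fun z hz => ?_, hc⟩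
  · exact DifferentiableOn.inv (by fun_prop) fun z (hz : 0 < z.im) => hne z hz.le
  · rw [← norm_mul, inv_mul_cancel₀ (hne z hz.le)]
    simp

namespace HermiteBiehler

variable {E : HermiteBiehler}

theorem A_ofReal (x : ℝ) : E.A x = ((E.E x).re : ℂ) := by
  rw [A, starFun_ofReal, Complex.add_conj]
  push_cast
  ring

/-- The norm of `A / (z - t)` in terms of the residue of `E* / E`. -/
theorem norm_sq_zeroFn {t c : ℝ} (ht : E.A t = 0)
    (hc : E.E t = Complex.I * c * (E.zeroFn t ht).fn t) : ‖E.zeroFn t ht‖ ^ 2 = Real.pi / c := by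
  set e := E.zeroFn t ht
  have hE0 : E.E t ≠ 0 := E.ne_zero t (by simp)
  have het : e.fn t ≠ 0 := zeroFn_apply_self_ne_zero t ht
  have hc0 : (c : ℂ) ≠ 0 := fun h => hE0 (by rw [hc, h]; ring)
  set ζ : ℂ := t - Complex.I with hζ
  have hζim : ζ.im < 0 := by simp [hζ]
  have hne : ∀ z : ℂ, 0 ≤ z.im → z - ζ ≠ 0 := fun z hz h => by
    rw [sub_eq_zero.1 h] at hz; linarith
  -- The coefficient `-1/c` makes `u(t) = 0`, so `u/(z - t)` is in `H²` and has integral zero.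
  set u : ℂ → ℂ := fun z => e.fn z / E.E z + (-1 / c : ℂ) * (z - ζ)⁻¹ with hu
  have hu0 : u t = 0 := by
    have h1 : (t : ℂ) - ζ = Complex.I := by rw [hζ]; ring
    simp only [hu, h1, hc]
    have := Complex.I_ne_zero
    field_simp
    ring
  have hH : IsHardyCont u := e.hardy.add ((isHardyCont_inv_sub hζim).const_mul _)
  set s : Set ℂ := {z | E.E z ≠ 0} ∩ {z | z - ζ ≠ 0} with hs
  have hsopen : IsOpen s := (isOpen_ne_fun E.entire.continuous continuous_const).inter
    (isOpen_ne_fun (by fun_prop) continuous_const)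
  have hsub : {z : ℂ | 0 ≤ z.im} ⊆ s := fun z hz => ⟨E.ne_zero z hz, hne z hz⟩
  have hst : s ∈ 𝓝 (t : ℂ) := hsopen.mem_nhds (hsub (by simp))
  have hud : DifferentiableOn ℂ u s :=
    (e.differentiable.differentiableOn.div E.entire.differentiableOn fun z hz => hz.1).add
      ((DifferentiableOn.inv (by fun_prop) fun z hz => hz.2).const_mul _)
  have hvd := (Complex.differentiableOn_dslope hst).2 hud
  have hvmul : ∀ z, (z - t) * dslope u t z = u z := fun z => by
    rw [← smul_eq_mul, sub_smul_dslope, hu0, sub_zero]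
  have hvc : ContinuousOn (dslope u t) {z | 0 ≤ z.im} := hvd.continuousOn.mono hsub
  have hv : IsHardyCont (dslope u t) := by
    refine ⟨isHardy_of_norm_mul_le hvc (hvd.mono fun z (hz : 0 < z.im) => hsub hz.le) hH.hardy t 0
      fun z _ => ?_, hvc⟩
    rw [← norm_mul, mul_comm, hvmul, add_zero]
  obtain ⟨hi, h0⟩ := hv.integral_eq_zero hH t fun z _ => hvmul z
  have hre : ∫ x : ℝ, (dslope u t x).re = 0 := by
    have := integral_re hi
    rw [h0] at this
    simpa using this
  -- On the line `(x - t) e = A = Re E`, so the real part of `e/((x - t) E)` is `|e/E|²`. The other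
  -- term contributes a Poisson kernel of total mass `π/c`.
  have hae : ∀ᵐ x : ℝ, (dslope u t x).re =
      ‖e.fn x / E.E x‖ ^ 2 - c⁻¹ * ((x - t) ^ 2 + 1 ^ 2)⁻¹ := by
    filter_upwards [compl_mem_ae_iff.2 (measure_singleton t)] with x hx
    have hxt : x - t ≠ 0 := sub_ne_zero.2 hx
    have hxt' : (x : ℂ) - t ≠ 0 := by exact_mod_cast hxt
    have h1 := hvmul x
    have h2 := zeroFn_mul t ht x
    have hEx : E.E x ≠ 0 := E.ne_zero x (by simp)
    have hex : e.fn x = (((E.E x).re / (x - t) : ℝ) : ℂ) := by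
      rw [A_ofReal] at h2
      push_cast
      rw [eq_div_iff hxt', ← h2]
      ring
    have hv : dslope u t x = (((E.E x).re / (x - t) ^ 2 : ℝ) : ℂ) * (E.E x)⁻¹ -
        ((c⁻¹ / (x - t) : ℝ) : ℂ) * ((x : ℂ) - ζ)⁻¹ := by
      have : dslope u t x = u x / (x - t) := by rw [eq_div_iff hxt', ← h1]; ring
      rw [this]
      simp only [hu, hex]
      push_cast
      field_simp
      ring
    have hns : Complex.normSq ((x : ℂ) - ζ) = (x - t) ^ 2 + 1 ^ 2 := by
      rw [Complex.normSq_apply, hζ]; simp; ring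
    have hre' : ((x : ℂ) - ζ).re = x - t := by simp [hζ]
    have hns' : Complex.normSq (E.E x) ≠ 0 := (Complex.normSq_pos.2 hEx).ne'
    rw [hv, Complex.sub_re, Complex.re_ofReal_mul, Complex.re_ofReal_mul, Complex.inv_re,
      Complex.inv_re, hns, hre', norm_div, div_pow, ← Complex.normSq_eq_norm_sq,
      ← Complex.normSq_eq_norm_sq, hex, Complex.normSq_ofReal]
    have hq : (x - t) ^ 2 + 1 ^ 2 ≠ 0 := by positivity
    have hcr : c ≠ 0 := by exact_mod_cast hc0
    field_simp
  rw [integral_congr_ae hae, integral_sub e.hardy.integrable_sq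
    ((integrable_inv_sub_sq_add_sq t one_pos).const_mul _), integral_const_mul,
    integral_inv_sub_sq_add_sq t one_pos, ← e.norm_sq_eq, sub_eq_zero] at hre
  rw [hre]
  ring

/-- If `A ∈ H(E)`, then `A / E` decays like `1 / y` along the imaginary axis. -/
theorem exists_bound_of_A_mem (h : E.A ∈ E.space) : ∃ C : ℝ, ∀ y : ℝ, 0 < y →
    y * ‖E.A (y * Complex.I) / E.E (y * Complex.I)‖ ≤ C := by
  set F : E.Space := Space.of E.A h
  have hF : IsHardyCont fun z => E.A z / E.E z := F.hardy
  refine ⟨∫ x : ℝ, ‖E.A x / E.E x‖ ^ 2, fun y hy => ?_⟩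
  have hyI : 0 < (y * Complex.I : ℂ).im := by simpa using hy
  have h1 := hF.cauchy hyI
  have h2 := hF.integral_div_eq_zero (ζ := conj (y * Complex.I)) (by simpa using hy)
  have hi1 := hF.integrable_div (w := y * Complex.I) hyI.ne'
  have hi2 := hF.integrable_div (w := conj (y * Complex.I)) (by simpa using hy.ne')
  have h3 : ∫ x : ℝ, conj (E.A x / E.E x / (x - conj (y * Complex.I))) = 0 := by
    rw [integral_conj, h2, map_zero]
  have hi3 : Integrable fun x : ℝ => conj (E.A x / E.E x / (x - conj (y * Complex.I))) :=
    LinearIsometryEquiv.integrable_comp_iff (Complex.conjLIE) |>.2 hi2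
  have h4 := integral_add hi1 hi3
  rw [h1, h3, add_zero] at h4
  -- On the line `A = Re E`, hence `A/E + conj(A/E) = 2|A/E|²`. So `2πi (A/E)(iy)` is the Cauchy
  -- integral of an `L¹` function, which is `O(1/y)`.
  have h5 : ∀ x : ℝ, E.A x / E.E x / (x - y * Complex.I) +
      conj (E.A x / E.E x / (x - conj (y * Complex.I))) =
      ((2 * ‖E.A x / E.E x‖ ^ 2 : ℝ) : ℂ) / (x - y * Complex.I) := by
    intro x
    have hne := ofReal_sub_ne hyI.ne' x
    have hEx : E.E x ≠ 0 := E.ne_zero x (by simp)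
    have hEx' : conj (E.E x) ≠ 0 := (map_ne_zero _).2 hEx
    have hn : ((‖E.A x / E.E x‖ ^ 2 : ℝ) : ℂ) = E.A x / E.E x * conj (E.A x / E.E x) := by
      rw [Complex.mul_conj, Complex.normSq_eq_norm_sq]
    have hA : E.A x = (E.E x + conj (E.E x)) / 2 := by rw [A, starFun_ofReal]
    rw [Complex.ofReal_mul, hn]
    simp only [map_div₀, map_sub, Complex.conj_ofReal, Complex.conj_conj, hA, map_add, map_ofNat]
    push_cast
    field_simp
    ring
  simp_rw [h5] at h4
  have h6 : ‖∫ x : ℝ, ((2 * ‖E.A x / E.E x‖ ^ 2 : ℝ) : ℂ) / (x - y * Complex.I)‖ ≤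
      ∫ x : ℝ, 2 / y * ‖E.A x / E.E x‖ ^ 2 := by
    refine norm_integral_le_of_norm_le (hF.integrable_sq.const_mul _) (.of_forall fun x => ?_)
    have h7 : y ≤ ‖(x : ℂ) - y * Complex.I‖ := by
      refine le_trans ?_ (Complex.abs_im_le_norm _)
      simp [abs_of_pos hy]
    rw [norm_div, Complex.norm_real, Real.norm_of_nonneg (by positivity)]
    calc _ ≤ 2 * ‖E.A x / E.E x‖ ^ 2 / y := by gcongr
      _ = _ := by ring
  rw [h4, integral_const_mul, norm_mul] at h6
  have h8 : ‖(2 * Real.pi * Complex.I : ℂ)‖ = 2 * Real.pi := by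
    simp [abs_of_pos Real.pi_pos]
  rw [h8] at h6
  set I := ∫ x : ℝ, ‖E.A x / E.E x‖ ^ 2
  have h9 : 2 / y * I = 2 * I / y := by ring
  rw [h9, le_div_iff₀ hy] at h6
  nlinarith [Real.pi_gt_three, mul_nonneg hy.le (norm_nonneg
    (E.A (y * Complex.I) / E.E (y * Complex.I)))]

end HermiteBiehler

namespace DiscreteMeasure

variable {ι : Type}

/-- A Hermite–Biehler function `A - i B` for which `B / A` has prescribed simple real poles `tₙ`
and residues `-cₙ`. -/
theorem exists_hermiteBiehler (d : DiscreteMeasure ι) {c : ι → ℝ} (hc : ∀ n, 0 < c n)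
    (hcs : Summable fun n => c n / d.t n ^ 2) : ∃ E : HermiteBiehler,
      (∀ z, E.A z = 0 ↔ ∃ n, z = d.t n) ∧ E.A ∉ E.space ∧
      ∀ n (hz : E.A (d.t n) = 0), ‖E.zeroFn (d.t n) hz‖ ^ 2 = Real.pi / c n := by
  obtain ⟨A, hA, hAs, hA0, hAd⟩ := d.exists_entire
  have hz : ∀ n, A (d.t n) = 0 := fun n => (hA0 _).2 ⟨n, rfl⟩
  have ht : ∀ n, (d.t n : ℂ) ≠ 0 := fun n => by exact_mod_cast d.ne_zero n
  have hsum : Summable fun n => ‖((c n / d.t n : ℝ) : ℂ)‖ / |d.t n| := by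
    refine hcs.congr fun n => ?_
    rw [Complex.norm_real, norm_div, Real.norm_of_nonneg (hc n).le, Real.norm_eq_abs, div_div,
      ← sq, sq_abs]
  obtain ⟨hS, hSd⟩ := d.mittagLeffler hA hz hsum
  -- With `B = -zS` one gets `B/A = ∑ c_n (1/(t_n - z) - 1/t_n)`; the subtracted constants make the
  -- series converge under `∑ c_n/t_n² < ∞`.
  set S : ℂ → ℂ := fun z => ∑' n, ((c n / d.t n : ℝ) : ℂ) * dslope A (d.t n) z with hSdef
  set B : ℂ → ℂ := fun z => -z * S z with hB
  have hBd : Differentiable ℂ B := differentiable_neg.mul hSd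
  have hAc : ∀ z, conj (A (conj z)) = A z := fun z => congrFun hAs z
  have hconj : ∀ n z, conj (dslope A (d.t n) (conj z)) = dslope A (d.t n) z := by
    intro n z
    rcases eq_or_ne z (d.t n : ℂ) with rfl | hne
    · have hcont := (exists_entire_sub_mul_eq hA (hz n)).1.continuous
      have h1 : Continuous fun z => conj (dslope A (d.t n) (conj z)) :=
        Complex.continuous_conj.comp (hcont.comp Complex.continuous_conj)
      refine tendsto_nhds_unique_of_eventuallyEq (l := 𝓝[≠] (d.t n : ℂ))
        ((h1.tendsto _).mono_left nhdsWithin_le_nhds)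
        ((hcont.tendsto _).mono_left nhdsWithin_le_nhds) ?_
      filter_upwards [self_mem_nhdsWithin] with w hw
      have hw' : w - d.t n ≠ 0 := sub_ne_zero.2 hw
      refine mul_left_cancel₀ hw' ?_
      have h2 := congrArg conj ((exists_entire_sub_mul_eq hA (hz n)).2 (conj w))
      rw [map_mul, map_sub, Complex.conj_conj, Complex.conj_ofReal, hAc] at h2
      rw [h2, (exists_entire_sub_mul_eq hA (hz n)).2]
    · refine mul_left_cancel₀ (sub_ne_zero.2 hne) ?_
      have h2 := congrArg conj ((exists_entire_sub_mul_eq hA (hz n)).2 (conj z))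
      rw [map_mul, map_sub, Complex.conj_conj, Complex.conj_ofReal, hAc] at h2
      rw [h2, (exists_entire_sub_mul_eq hA (hz n)).2]
  have hBs : ∀ z, conj (B (conj z)) = B z := by
    intro z
    simp only [hB, hSdef, map_mul, map_neg, Complex.conj_conj, Complex.conj_tsum,
      Complex.conj_ofReal, hconj]
  have hBt : ∀ n, B (d.t n) = -(c n) * dslope A (d.t n) (d.t n) := by
    intro m
    have h1 : S (d.t m) = ((c m / d.t m : ℝ) : ℂ) * dslope A (d.t m) (d.t m) := by
      refine (hS (d.t m)).hasSum.unique (hasSum_single m fun n hn => ?_)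
      have h2 := (exists_entire_sub_mul_eq hA (hz n)).2 (d.t m)
      rw [hz m] at h2
      have h3 : (d.t m : ℂ) - d.t n ≠ 0 := sub_ne_zero.2
        (by exact_mod_cast d.injective.ne hn.symm)
      rw [(mul_eq_zero.1 h2).resolve_left h3, mul_zero]
    simp only [hB, h1]
    have := ht m
    push_cast
    field_simp
  have hratio : ∀ z, A z ≠ 0 →
      HasSum (fun n => (c n : ℂ) * (z / (d.t n * (d.t n - z)))) (B z / A z) := by
    intro z hzA
    have h := (hS z).hasSum.mul_left (-z / A z)
    have h1 : -z / A z * S z = B z / A z := by simp only [hB]; ring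
    rw [← h1]
    refine h.congr_fun fun n => ?_
    have h2 := (exists_entire_sub_mul_eq hA (hz n)).2 z
    have h3 : z - d.t n ≠ 0 := sub_ne_zero.2 fun h => hzA (by rw [h, hz n])
    have h4 : (d.t n : ℂ) - z ≠ 0 := sub_ne_zero.2 fun h => hzA (by rw [← h, hz n])
    have h5 : dslope A (d.t n) z = A z / (z - d.t n) := by
      rw [eq_div_iff h3, ← h2]; ring
    have := ht n
    rw [h5]
    push_cast
    field_simp
    ring
  have him : ∀ z : ℂ, z.im ≠ 0 → A z ≠ 0 := fun z h h0 => by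
    obtain ⟨n, rfl⟩ := (hA0 z).1 h0
    simp at h
  have hpos : ∀ z : ℂ, 0 < z.im → 0 < (B z / A z).im := by
    intro z hzim
    have h1 := Complex.hasSum_im (hratio z (him z hzim.ne'))
    have h2 : ∀ n, ((c n : ℂ) * (z / (d.t n * (d.t n - z)))).im =
        c n * (z.im / Complex.normSq (d.t n - z)) := by
      intro n
      have h4 : (d.t n : ℂ) - z ≠ 0 := sub_ne_zero.2 fun h => by
        rw [← h] at hzim; simp at hzim
      have h5 : z / (d.t n * (d.t n - z)) = ((d.t n : ℂ) - z)⁻¹ - ((d.t n)⁻¹ : ℝ) := by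
        have := ht n
        push_cast
        field_simp
        ring
      rw [Complex.im_ofReal_mul, h5, Complex.sub_im, Complex.ofReal_im, Complex.inv_im]
      simp
    simp_rw [h2] at h1
    have h3 : ∀ n, 0 < c n * (z.im / Complex.normSq (d.t n - z)) := by
      intro n
      have h4 : (d.t n : ℂ) - z ≠ 0 := sub_ne_zero.2 fun h => by
        rw [← h] at hzim; simp at hzim
      exact mul_pos (hc n) (div_pos hzim (Complex.normSq_pos.2 h4))
    obtain ⟨n⟩ := d.nonempty
    rw [← h1.tsum_eq]
    exact h1.summable.tsum_pos (fun n => (h3 n).le) n (h3 n)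
  have hstar : ∀ z, starFun (fun z => A z - Complex.I * B z) z = A z + Complex.I * B z := by
    intro z
    simp [starFun, hAc, hBs]
  -- Cayley transform: `|1 + i m| < |1 - i m|` when `m = B/A` has positive imaginary part.
  have hlt : ∀ z : ℂ, 0 < z.im → ‖A z + Complex.I * B z‖ < ‖A z - Complex.I * B z‖ := by
    intro z hzim
    have hA' := him z hzim.ne'
    have h1 : A z + Complex.I * B z = A z * (1 + Complex.I * (B z / A z)) := by field_simp
    have h2 : A z - Complex.I * B z = A z * (1 - Complex.I * (B z / A z)) := by field_simp
    rw [h1, h2, norm_mul, norm_mul]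
    refine mul_lt_mul_of_pos_left ?_ (norm_pos_iff.2 hA')
    rw [← sq_lt_sq₀ (norm_nonneg _) (norm_nonneg _), Complex.sq_norm, Complex.sq_norm,
      Complex.normSq_apply, Complex.normSq_apply]
    have := hpos z hzim
    simp
    nlinarith
  have hA0' : ∀ n, dslope A (d.t n) (d.t n) ≠ 0 := fun n => by
    rw [dslope_same]; exact hAd n
  set E : HermiteBiehler :=
    { E := fun z => A z - Complex.I * B z
      entire := hA.sub (hBd.const_mul _)
      ne_zero := by
        intro z hzim h0
        rcases hzim.lt_or_eq with h | h
        · have := hlt z h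
          rw [h0, norm_zero] at this
          exact (norm_nonneg _).not_gt this
        · obtain ⟨x, rfl⟩ : ∃ x : ℝ, (x : ℂ) = z := ⟨z.re, Complex.ext (by simp) (by simp [h])⟩
          have h1 := congrArg conj h0
          have h2 := hAc x
          have h3 := hBs x
          rw [Complex.conj_ofReal] at h2 h3
          rw [map_zero, map_sub, map_mul, h2, h3, Complex.conj_I] at h1
          have h4 : A x = 0 := by linear_combination (h0 + h1) / 2
          have h5 : B x = 0 := by
            rw [h4] at h0
            simpa using h0
          obtain ⟨n, hn⟩ := (hA0 _).1 h4
          -- A real zero of `E` would be a common zero of `A` and `B`, but `B(t_n) = -c_n A'(t_n) ≠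
          -- 0`.
          rw [hn, hBt] at h5
          refine mul_ne_zero (neg_ne_zero.2 ?_) (hA0' n) h5
          exact_mod_cast (hc n).ne'
      norm_lt := fun z hzim => by
        rw [hstar]
        exact hlt z hzim } with hE
  have hEA : E.A = A := by
    funext z
    rw [HermiteBiehler.A, hstar]
    simp only [hE]
    ring
  refine ⟨E, fun z => by rw [hEA, hA0], fun hmem => ?_, fun n hzn => ?_⟩
  · obtain ⟨C, hC⟩ := HermiteBiehler.exists_bound_of_A_mem hmem
    -- `|B/A|(iy) ≤ y r(y)` with `r → 0` by dominated convergence. Hence `|E| ≤ |A|(1 + y r(y))` at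
    -- `iy`, and a bound `y |A/E| ≤ C` would give `1 ≤ C (1/y + r(y)) → 0`.
    set r : ℝ → ℝ := fun y => ∑' n, c n * (|d.t n| * ‖(d.t n : ℂ) - y * Complex.I‖)⁻¹ with hr
    have habs : ∀ n (y : ℝ), |d.t n| ≤ ‖(d.t n : ℂ) - y * Complex.I‖ := fun n y => by
      refine le_trans ?_ (Complex.abs_re_le_norm _)
      simp
    have habs' : ∀ n (y : ℝ), |y| ≤ ‖(d.t n : ℂ) - y * Complex.I‖ := fun n y => by
      refine le_trans ?_ (Complex.abs_im_le_norm _)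
      simp
    have htpos : ∀ n, 0 < |d.t n| := fun n => abs_pos.2 (d.ne_zero n)
    have hdom : ∀ n (y : ℝ), c n * (|d.t n| * ‖(d.t n : ℂ) - y * Complex.I‖)⁻¹ ≤
        c n / d.t n ^ 2 := by
      intro n y
      rw [← div_eq_mul_inv, ← sq_abs (d.t n), sq]
      have := htpos n
      have := (hc n).le
      gcongr
      exact habs n y
    have hnn : ∀ n (y : ℝ), 0 ≤ c n * (|d.t n| * ‖(d.t n : ℂ) - y * Complex.I‖)⁻¹ := fun n y =>
      mul_nonneg (hc n).le (by positivity)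
    have hr0 : Tendsto r atTop (𝓝 0) := by
      have := tendsto_tsum_of_dominated_convergence (𝓕 := atTop) (g := fun _ : ι => (0 : ℝ))
        (f := fun (y : ℝ) n => c n * (|d.t n| * ‖(d.t n : ℂ) - y * Complex.I‖)⁻¹) hcs
        (fun n => ?_) (.of_forall fun y n => ?_)
      · rwa [tsum_zero] at this
      · rw [← mul_zero (c n)]
        refine (Tendsto.inv_tendsto_atTop ?_).const_mul _
        refine Tendsto.const_mul_atTop (htpos n) ?_
        exact tendsto_atTop_mono (fun y => (le_abs_self y).trans (habs' n y)) tendsto_id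
      · rw [Real.norm_of_nonneg (hnn n y)]
        exact hdom n y
    have hle : ∀ y : ℝ, 0 < y → 1 ≤ C * (y⁻¹ + r y) := by
      intro y hy
      have hyI : 0 < (y * Complex.I : ℂ).im := by simpa using hy
      have hA' := him _ hyI.ne'
      have hB' : ‖B (y * Complex.I) / A (y * Complex.I)‖ ≤ y * r y := by
        have hs' : Summable fun n => c n * (|d.t n| * ‖(d.t n : ℂ) - y * Complex.I‖)⁻¹ :=
          hcs.of_nonneg_of_le (fun n => hnn n y) fun n => hdom n y
        rw [← (hratio _ hA').tsum_eq, hr, ← tsum_mul_left]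
        refine tsum_of_norm_bounded (hs'.mul_left y).hasSum fun n => le_of_eq ?_
        rw [norm_mul, norm_div, norm_mul, norm_mul, Complex.norm_real, Complex.norm_real,
          Complex.norm_real, Complex.norm_I, Real.norm_of_nonneg hy.le,
          Real.norm_of_nonneg (hc n).le, Real.norm_eq_abs]
        ring
      have h1 := hC y hy
      have hEne : E.E (y * Complex.I) ≠ 0 := E.ne_zero _ hyI.le
      have hAn : 0 < ‖A (y * Complex.I)‖ := norm_pos_iff.2 hA'
      have h2 : ‖E.E (y * Complex.I)‖ ≤ ‖A (y * Complex.I)‖ * (1 + y * r y) := by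
        have : E.E (y * Complex.I) = A (y * Complex.I) *
            (1 - Complex.I * (B (y * Complex.I) / A (y * Complex.I))) := by
          simp only [hE]
          field_simp
        rw [this, norm_mul]
        gcongr
        refine (norm_sub_le _ _).trans ?_
        rw [norm_mul, Complex.norm_I, norm_one, one_mul]
        gcongr
      rw [hEA, norm_div, mul_div_assoc', div_le_iff₀ (norm_pos_iff.2 hEne)] at h1
      have hC0 : 0 < C := by
        by_contra hneg
        have := mul_nonneg (sub_nonneg.2 (not_lt.1 hneg)) (norm_nonneg (E.E (y * Complex.I)))
        have := mul_pos hy hAn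
        linarith
      have h3 : y * ‖A (y * Complex.I)‖ ≤ C * (1 + y * r y) * ‖A (y * Complex.I)‖ := by
        nlinarith
      have h4 := le_of_mul_le_mul_right h3 hAn
      calc (1 : ℝ) = y⁻¹ * y := (inv_mul_cancel₀ hy.ne').symm
        _ ≤ y⁻¹ * (C * (1 + y * r y)) := by gcongr
        _ = C * (y⁻¹ + r y) := by field_simp
    have hlim : Tendsto (fun y => C * (y⁻¹ + r y)) atTop (𝓝 0) := by
      simpa using (tendsto_inv_atTop_zero.add hr0).const_mul C
    have := ge_of_tendsto hlim ((eventually_gt_atTop 0).mono hle)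
    linarith
  · refine HermiteBiehler.norm_sq_zeroFn hzn ?_
    have h1 : (E.zeroFn (d.t n) hzn).fn (d.t n) = dslope A (d.t n) (d.t n) := by
      rw [HermiteBiehler.zeroFn, HermiteBiehler.Space.fn_of, hEA]
    rw [h1]
    simp only [hE, hz n, hBt]
    ring

end DiscreteMeasure

/-! ### The functional model of a given perturbation -/

namespace SingularPerturbation

variable {ι : Type} {d : DiscreteMeasure ι}

/-- A singular rank one perturbation with cyclic `b` has a functional model. -/
theorem exists_model (L : SingularPerturbation d) (hb : ∀ n, L.b (d.t n) ≠ 0) :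
    ∃ (E : HermiteBiehler) (G : ℂ → ℂ),
      E.A ∉ E.space ∧ E.A 0 ≠ 0 ∧ E.IsGenerator G ∧ G 0 ≠ 0 ∧
      UnitarilyEquivalent L.op (E.modelOp G) := by
  have hbpos : ∀ n, 0 < ‖L.b (d.t n)‖ := fun n => norm_pos_iff.2 (hb n)
  obtain ⟨E, hA0, hA, hnorm⟩ := d.exists_hermiteBiehler
    -- Then `‖e_n‖² = π/c_n = 1/(|b(t_n)|² μ_n)`, the normalization required by `exists_unitary`;
    -- summability of `c_n/t_n²` is the hypothesis `b/x ∈ L²(μ)`.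
    (c := fun n => Real.pi * (‖L.b (d.t n)‖ ^ 2 * d.mass n))
    (fun n => mul_pos Real.pi_pos (mul_pos (pow_pos (hbpos n) 2) (d.mass_pos n))) (by
      have h := (d.memLp_two_iff.1 L.memLp_b).mul_left Real.pi
      refine h.congr fun n => ?_
      rw [norm_div, div_pow, Complex.norm_real, Real.norm_eq_abs, sq_abs]
      ring)
  have hz : ∀ n, E.A (d.t n) = 0 := fun n => (hA0 _).2 ⟨n, rfl⟩
  have hAzero : E.A 0 ≠ 0 := fun h => by
    obtain ⟨n, hn⟩ := (hA0 0).1 h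
    exact d.ne_zero n (by exact_mod_cast hn.symm)
  obtain ⟨U, hU⟩ := HermiteBiehler.exists_unitary (d := d) hA hz
    (fun s hs => by
      obtain ⟨n, hn⟩ := (hA0 s).1 hs
      exact ⟨n, by exact_mod_cast hn.symm⟩)
    (w := fun n => conj (L.b (d.t n)) * d.mass n) fun n => by
      have h1 := (d.mass_pos n).ne'
      have h2 := (hbpos n).ne'
      rw [hnorm n (hz n), norm_mul, RCLike.norm_conj, Complex.norm_real,
        Real.norm_of_nonneg (d.mass_pos n).le]
      field_simp
  set F := U L.invA
  have hGd : Differentiable ℂ fun z => L.κ * E.A z - z * F.fn z :=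
    (HermiteBiehler.differentiable_A.const_mul _).sub (differentiable_id.mul F.differentiable)
  refine ⟨E, fun z => L.κ * E.A z - z * F.fn z, hA, hAzero, ⟨hGd, ?_, ?_, ?_⟩, ?_, ?_⟩
  · exact HermiteBiehler.notMem_space_of_model hAzero hb hU fun z => rfl
  · intro z₀ hz₀
    obtain ⟨hKd, hK⟩ := exists_entire_sub_mul_eq hGd hz₀
    refine ⟨_, ?_, hK⟩
    -- Adding `F` to `G/(z - z₀)` replaces the factor `z` by `z₀`: the sum is `(κ A - z₀ F)/(z -
    -- z₀)`, whose numerator lies in `H(E) + ℂ A`.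
    have hmem : (fun z => dslope (fun z => L.κ * E.A z - z * F.fn z) z₀ z + F.fn z) ∈ E.space := by
      refine HermiteBiehler.mem_space_of_sub_mul_eq (hKd.add F.differentiable) ((-z₀) • F) L.κ z₀
        fun z => ?_
      simp only [HermiteBiehler.Space.fn_smul, Pi.smul_apply, smul_eq_mul]
      linear_combination hK z
    have h := E.space.sub_mem hmem F.fn_mem
    convert h using 1
    funext z
    simp
  · intro _
    obtain ⟨n⟩ := d.nonempty
    -- Writing `A = (z - t_n) e` gives `G = -κ t_n e + z (κ e - F)`.
    set e := E.zeroFn (d.t n) (hz n)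
    refine ⟨((-(L.κ * d.t n)) • e).fn, HermiteBiehler.Space.fn_mem _, (L.κ • e - F).fn,
      HermiteBiehler.Space.fn_mem _, fun z => ?_⟩
    have := HermiteBiehler.zeroFn_mul (d.t n) (hz n) z
    simp only [HermiteBiehler.Space.fn_smul, HermiteBiehler.Space.fn_sub, Pi.smul_apply,
      Pi.sub_apply, smul_eq_mul]
    linear_combination -L.κ * this
  · simpa using ⟨L.κ_ne_zero, hAzero⟩
  · exact HermiteBiehler.unitarilyEquivalent_of_model hAzero hb hU fun z => rfl

end SingularPerturbation

end

theorem theorem4p1 :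
    (∀ (ι : Type) (d : DiscreteMeasure ι) (L : SingularPerturbation d),
      (∀ n, L.b (d.t n) ≠ 0) →
      ∃ (E : HermiteBiehler) (G : ℂ → ℂ),
        E.A ∉ E.space ∧ E.A 0 ≠ 0 ∧ E.IsGenerator G ∧ G 0 ≠ 0 ∧
        UnitarilyEquivalent L.op (E.modelOp G)) ∧
    (∀ (E : HermiteBiehler) (G : ℂ → ℂ),
      E.A ∉ E.space → E.A 0 ≠ 0 → E.IsGenerator G → G 0 ≠ 0 →
      ∃ (ι : Type) (d : DiscreteMeasure ι) (L : SingularPerturbation d),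
        (∀ n, L.b (d.t n) ≠ 0) ∧
        UnitarilyEquivalent L.op (E.modelOp G)) :=
  ⟨fun _ _ L hb => L.exists_model hb,
    fun _ _ hA hA0 hG hG0 => HermiteBiehler.exists_singularPerturbation hA hA0 hG hG0⟩
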